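/- **Setting.** Let $0<r_i<r_e$ and $0<\epsilon<r_e-r_i$. Put $$c_i=\frac{r_e^2-r_i^2-(r_e-r_i-\epsilon)^2}{2(r_e-r_i-\epsilon)},\qquad c_e=c_i+r_e-r_i-\epsilon,$$ and let $B_i$, $B_e$ be the open disks in $\mathbb R^2$ with centers $\mathbf c_i=(c_i,0)$, $\mathbf c_e=(c_e,0)$ and radii $r_i$, $r_e$; then $\overline{B_i}\subset B_e$ and the two circles are at distance $\epsilon$. For conductivities $k_i,k_e>0$, $k_e\ne1$, let $\sigma=k_i$ in $B_i$, $\sigma=k_e$ in $B_e\setminus B_i$ and $\sigma=1$ in $\mathbb R^2\setminus B_e$. Let $H$ be an entire harmonic function on $\mathbb R^2$, and let $u\in H^1_{\mathrm{loc}}(\mathbb R^2)$ be the solution of $$\nabla\cdot(\sigma\nabla u)=0\ \text{ in }\mathbb R^2\ \text{(weakly)},\qquad u(\mathbf x)-H(\mathbf x)=O(|\mathbf x|^{-1})\ \text{ as }|\mathbf x|\to\infty .$$ Set $$\alpha=\frac{\sqrt{\epsilon(2r_i+\epsilon)(2r_e-\epsilon)(2r_e-2r_i-\epsilon)}}{2(r_e-r_i-\epsilon)},\quad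 r_*=\sqrt{\frac{2r_ir_e}{r_e-r_i}},\quad \xi_i=\ln|c_i+\alpha|-\ln r_i,$$ $$\tau_i=\frac{k_i-k_e}{k_i+k_e},\quad \tau_e=\frac{1-k_e}{1+k_e},\quad \tau=\tau_i\tau_e,\quad \beta=\frac{r_*(-\ln\tau)}{4\sqrt\epsilon},\quad (C_x,C_y)=\nabla H(\mathbf 0).$$ **Theorem.** Fix $r_i$, $r_e$, $H$ and $\epsilon_0<r_e-r_i$. Below, $0<\epsilon\le\epsilon_0$, and the constants $C$ do not depend on $\epsilon$, $k_i$, $k_e$ or $\mathbf x$. (1) There is $C$ such that $\|\nabla(u-H)\|_{L^\infty(\mathbb R^2\setminus\overline{(B_e\setminus B_i)})}\le C$ for all $k_i>0$ and $0<k_e\neq1$. (2) The gradient of $u$ can blow up only when both $\tau_i$ and $\tau_e$ are close to $1$: for every $\delta>0$ there is $C=C(\delta)$ such that $\|\nabla(u-H)\|_{L^\infty(\mathbb R^2)}\le C$ for all $k_i>0$, $0<k_e\ne1$ with $\tau_i\le1-\delta$ or $\tau_e\le 1-\delta$. (As $1-\tau_i=\frac{2k_e}{k_i+k_e}$ and $1-\tau_e=\frac{2k_e}{1+k_e}$,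 both are close to $1$ exactly when $k_e\ll 1$ and $k_e\ll k_i$.) (3) There is $C$ such that, whenever $0<k_e<1$ and $k_e<k_i$, one has for (almost every) $\mathbf x$ in the open shell $B_e\setminus\overline{B_i}$ $$\begin{aligned}u(\mathbf x)=H(\mathbf x)&+\frac{C_xr_*^2}{2}\left[\int_{-\infty}^{-\alpha}\ln|\mathbf x-\mathbf s|\,\varphi_1(s)\,ds-\int_{\alpha}^{c_i}\ln|\mathbf x-\mathbf s|\,\varphi_2(s)\,ds\right]\\&+\frac{C_yr_*^2}{2}\left[\int_{-\infty}^{-\alpha}\frac{\langle\mathbf x-\mathbf s,\mathbf e_2\rangle}{|\mathbf x-\mathbf s|^2}\psi_1(s)\,ds-\int_{\alpha}^{c_i}\frac{\langle\mathbf x-\mathbf s,\mathbf e_2\rangle}{|\mathbf x-\mathbf s|^2}\psi_2(s)\,ds\right]+r(\mathbf x),\end{aligned}$$ where $\mathbf s=(s,0)$, $\mathbf e_2=(0,1)$, all four integrals converge absolutely, $r$ is differentiable in the open shell with $|\nabla r|\le C$ there, and $$\varphi_1(s)=(\tau+\tau_e)\,2\alpha\beta\,\frac{|s+\alpha|^{\beta-1}}{|s-\alpha|^{\beta+1}},\qquad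 \psi_1(s)=(\tau+\tau_e)\Big(\frac{s+\alpha}{s-\alpha}\Big)^{\beta}\qquad(s\le-\alpha),$$ $$\varphi_2(s)=(\tau+\tau_i)\,2\alpha\beta\, e^{2\beta\xi_i}\,\frac{(s-\alpha)^{\beta-1}}{(s+\alpha)^{\beta+1}},\qquad \psi_2(s)=(\tau+\tau_i)\,e^{2\beta\xi_i}\Big(\frac{s-\alpha}{s+\alpha}\Big)^{\beta}\qquad(\alpha\le s\le c_i).$$ -/

import Mathlib

open MeasureTheory Set Filter Topology Asymptotics InnerProductSpace
open scoped ContDiff Gradient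

noncomputable section

namespace CoreShell

/-! The plane `ℝ²` is identified with `ℂ` through `(x, y) ↔ x + i y`; with its real inner product
`inner ℝ z w = z.re * w.re + z.im * w.im` and its Lebesgue measure, `ℂ` is the Euclidean plane.
Gradients of real functions on the plane are vectors, i.e. elements of `ℂ`. -/

/-! ### Geometry: core of radius `ri`, shell of outer radius `re`, distance `ε` of the circles -/

/-- First coordinate of the centre of the core `B_i`. -/
def centerI (ri re ε : ℝ) : ℝ :=
  (re ^ 2 - ri ^ 2 - (re - ri - ε) ^ 2) / (2 * (re - ri - ε))

/-- First coordinate of the centre of `B_e`. -/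
def centerE (ri re ε : ℝ) : ℝ := centerI ri re ε + re - ri - ε

/-- The core `B_i`. -/
def diskI (ri re ε : ℝ) : Set ℂ := Metric.ball (centerI ri re ε : ℂ) ri

/-- The disk `B_e`. -/
def diskE (ri re ε : ℝ) : Set ℂ := Metric.ball (centerE ri re ε : ℂ) re

/-- The (open) shell between the two circles. -/
def shell (ri re ε : ℝ) : Set ℂ := diskE ri re ε \ closure (diskI ri re ε)

/-- The poles of the bipolar coordinates are `(-α, 0)` and `(α, 0)`: the common fixed points of
the compositions of the reflections across the two circles. -/
def alpha (ri re ε : ℝ) : ℝ :=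
  Real.sqrt (ε * (2 * ri + ε) * (2 * re - ε) * (2 * re - 2 * ri - ε)) / (2 * (re - ri - ε))

/-- The bipolar coordinate `ξ_i` of the circle `∂B_i`. -/
def xiI (ri re ε : ℝ) : ℝ :=
  Real.log |centerI ri re ε + alpha ri re ε| - Real.log ri

/-- The constant `r_*`. -/
def rStar (ri re : ℝ) : ℝ := Real.sqrt (2 * ri * re / (re - ri))

/-! ### Material parameters -/

def tauI (ki ke : ℝ) : ℝ := (ki - ke) / (ki + ke)

def tauE (ke : ℝ) : ℝ := (1 - ke) / (1 + ke)

def tau (ki ke : ℝ) : ℝ := tauI ki ke * tauE ke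

def beta (ri re ε ki ke : ℝ) : ℝ :=
  rStar ri re * (-Real.log (tau ki ke)) / (4 * Real.sqrt ε)

open Classical in
/-- The conductivity: `ki` in the core, `ke` in the shell, `1` outside. -/
def conductivity (ri re ε ki ke : ℝ) (z : ℂ) : ℝ :=
  if z ∈ diskI ri re ε then ki else if z ∈ diskE ri re ε then ke else 1

/-! ### Weak solutions of the conductivity problem -/

/-- `G` is the weak gradient of `u` on the plane, and both are locally square integrable
(so `u` belongs to `H¹_loc(ℝ²)`). -/
structure HasWeakGradient (u : ℂ → ℝ) (G : ℂ → ℂ) : Prop where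
  memLp_fun : ∀ R : ℝ, MemLp u 2 (volume.restrict (Metric.ball (0 : ℂ) R))
  memLp_grad : ∀ R : ℝ, MemLp G 2 (volume.restrict (Metric.ball (0 : ℂ) R))
  integral_eq : ∀ φ : ℂ → ℝ, ContDiff ℝ ∞ φ → HasCompactSupport φ →
    ∫ z, u z • ∇ φ z = -∫ z, φ z • G z

/-- `u`, with weak gradient `G`, is a solution of `∇ · (σ ∇u) = 0` in the plane (in the weak sense)
with `u(z) - H(z) = O(|z|⁻¹)` as `|z| → ∞`. -/
structure IsSolution (σ H u : ℂ → ℝ) (G : ℂ → ℂ) : Prop where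
  weakGradient : HasWeakGradient u G
  equation : ∀ φ : ℂ → ℝ, ContDiff ℝ ∞ φ → HasCompactSupport φ →
    ∫ z, σ z * inner ℝ (G z) (∇ φ z) = 0
  decay : (fun z => u z - H z) =O[cocompact ℂ ⊓ ae volume] fun z => ‖z‖⁻¹

/-! ### Image line charges -/

/-- Density on `(-∞, -α]`.  There both `s + α` and `s - α` are nonpositive; the quotient
`(s + α)^(β-1) / (s - α)^(β+1) = ((s + α) / (s - α))^(β-1) / (s - α)²` is expressed
through absolute values. -/
def phi1 (ri re ε ki ke s : ℝ) : ℝ :=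
  (tau ki ke + tauE ke) * (2 * alpha ri re ε * beta ri re ε ki ke) *
    (|s + alpha ri re ε| ^ (beta ri re ε ki ke - 1) /
      |s - alpha ri re ε| ^ (beta ri re ε ki ke + 1))

/-- Density on `(-∞, -α]`. -/
def psi1 (ri re ε ki ke s : ℝ) : ℝ :=
  (tau ki ke + tauE ke) *
    ((s + alpha ri re ε) / (s - alpha ri re ε)) ^ beta ri re ε ki ke

/-- Density on `[α, c_i]`. -/
def phi2 (ri re ε ki ke s : ℝ) : ℝ :=
  (tau ki ke + tauI ki ke) * (2 * alpha ri re ε * beta ri re ε ki ke) *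
    Real.exp (2 * beta ri re ε ki ke * xiI ri re ε) *
    ((s - alpha ri re ε) ^ (beta ri re ε ki ke - 1) /
      (s + alpha ri re ε) ^ (beta ri re ε ki ke + 1))

/-- Density on `[α, c_i]`. -/
def psi2 (ri re ε ki ke s : ℝ) : ℝ :=
  (tau ki ke + tauI ki ke) * Real.exp (2 * beta ri re ε ki ke * xiI ri re ε) *
    ((s - alpha ri re ε) / (s + alpha ri re ε)) ^ beta ri re ε ki ke

/-- The kernel `ln |x - s|` at the point `(s, 0)` of the axis. -/
def logKernel (z : ℂ) (s : ℝ) : ℝ := Real.log ‖z - (s : ℂ)‖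

/-- The kernel `⟨x - s, e₂⟩ / |x - s|²` at the point `(s, 0)` of the axis. -/
def dipoleKernel (z : ℂ) (s : ℝ) : ℝ := (z - (s : ℂ)).im / ‖z - (s : ℂ)‖ ^ 2

end CoreShell

end

open CoreShell

/-! ### Weak equations tested against compactly supported functions with square integrable gradient.
-/

section

open scoped Convolution
open ContinuousLinearMap

/-! The proof writes the solution down by the method of images and estimates it; uniqueness
transfers the estimates to every weak solution.

Uniqueness (`CoreShell.IsSolution.unique`) is a Caccioppoli argument: if `w = O(1/|z|)` solves the
equation, its energy in a ball of radius `R` is `O(R⁻²)`, so its gradient vanishes. Conversely,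
holomorphic potentials on core, shell and exterior with matching real parts and fluxes form a weak
solution (`isSolution_of_potentials`), by the divergence theorem on annuli.

Let `H = Re h` with `h` entire, and let `R_i`, `R_e` be the reflections in the two circles. The
composition `R_i ∘ R_e` is a Möbius map fixing `±α`; in the coordinate `(z - α)/(z + α)` it is
multiplication by `l = multiplier`. Its powers are `orbit α (lⁿ)`, and on the outer circle it
coincides with `R_i`. Put `a = (1 + τ_e) ∑ τⁿ h(orbit α (lⁿ) z)`. Up to one common constant the
solution is the real part of `(1 - τ_i) a` in the core, of `a - τ_i conj(a ∘ R_i)` in the shell, and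
of `h + τ_e conj(h ∘ R_e) - (1 - τ_e) τ_i conj(a ∘ R_i)` outside (`NestedCircles.exists_solution`).
The condition on the outer circle is the functional equation `a = (1 + τ_e) h + τ a ∘ orbit α l`.

Bounds. The terms of the differentiated series have total variation along the orbit bounded
uniformly in `ε` (`norm_orbitTerm_sub_le`), so Abel summation gives `(1 - τ) |a'| ≤ (1 + τ_e) B`.
Outside the shell the factors `1 - τ_i` and `1 - τ_e` compensate for `1/(1 - τ)`. In the shell no
such factor is present, but `(1 + τ_e)/(1 - τ)` stays bounded unless both `τ_i` and `τ_e` approach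
`1`. This proves (1) and (2).

Image charges. With `L = -log l` and `t = -log τ`, the series for `a'` samples a function of `q` at
the points `q = lⁿ` and differs by a bounded amount from `1/L` times an integral over `[0, 1]`
(`norm_tsum_sub_integral_le`). There `h'` may be frozen at `0`, the exponent `t/L` replaced by `β`
and `1/L` by `r_*²/(4α)`, all at bounded cost, because `L` is `4√ε/r_*` to leading order
(`exists_multiplier_bounds`). Hence `a'` is, up to a bounded error, the derivative of a multiple of
`imagePotential`. The substitution `q = (s + α)/(s - α)` turns that potential into the charges on
`(-∞, -α]`, and its reflection in the inner circle gives those on `[α, c_i]`. This proves (3). -/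

theorem continuous_integral_inner_translate {f V : ℂ → ℂ} (hf : MemLp f 2) (hV : MemLp V 2) :
    Continuous fun y : ℂ => ∫ x, inner ℝ (f x) (V (x + y)) := by
  let G : C(ℂ × ℂ, ℂ) := ⟨fun p => p.2 + p.1, by fun_prop⟩
  let g : C(ℂ, C(ℂ, ℂ)) := G.curry
  have hmp : ∀ y : ℂ, MeasurePreserving (g y) volume volume :=
    fun y => measurePreserving_add_right volume y
  have : Fact ((2 : ENNReal) ≠ ⊤) := ⟨by norm_num⟩
  -- Translations act continuously on `L²`, so the correlation is an inner product with a continuous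
  -- curve in `L²`.
  have hc : Continuous fun y : ℂ =>
      inner ℝ (hf.toLp f) (Lp.compMeasurePreserving (g y) (hmp y) (hV.toLp V)) :=
    continuous_const.inner
      (continuous_const.compMeasurePreservingLp g.continuous hmp (by norm_num))
  refine hc.congr fun y => ?_
  rw [L2.inner_def]
  refine integral_congr_ae ?_
  filter_upwards [hf.coeFn_toLp, Lp.coeFn_compMeasurePreserving (hV.toLp V) (hmp y),
    (hmp y).quasiMeasurePreserving.ae (hV.coeFn_toLp)] with x h1 h2 h3
  rw [h1, h2, Function.comp_apply, h3]
  rfl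

theorem hasGradientAt_of_hasFDerivAt {f : ℂ → ℝ} {L : ℂ →L[ℝ] ℝ} {g x : ℂ}
    (h : HasFDerivAt f L x) (hL : ∀ y, L y = inner ℝ g y) : HasGradientAt f g x := by
  rw [hasGradientAt_iff_hasFDerivAt]
  have : L = toDual ℝ ℂ g := ContinuousLinearMap.ext fun y => by
    rw [hL, toDual_apply_apply]
  rwa [← this]

theorem continuous_gradient {ρ : ℂ → ℝ} (hρ : ContDiff ℝ ∞ ρ) : Continuous (∇ ρ) := by
  unfold gradient
  exact (toDual ℝ ℂ).symm.continuous.comp (hρ.continuous_fderiv (by simp))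

theorem gradient_hasCompactSupport {ρ : ℂ → ℝ} (hρ : HasCompactSupport ρ) :
    HasCompactSupport (∇ ρ) := by
  unfold gradient
  exact (hρ.fderiv (𝕜 := ℝ)).comp_left (map_zero _)

theorem contDiff_hasGradientAt {ρ : ℂ → ℝ} (hρ : ContDiff ℝ ∞ ρ) (x : ℂ) :
    HasGradientAt ρ (∇ ρ x) x :=
  (hρ.differentiable (by simp) x).hasGradientAt

/-- The derivative first falls on the kernel; since `t ↦ ρ (x - t)` is an admissible test function,
the definition of the weak gradient then moves it onto `v`. -/
theorem hasGradientAt_bump_convolution {ρ v : ℂ → ℝ} {V : ℂ → ℂ} (hρ : ContDiff ℝ ∞ ρ)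
    (hρc : HasCompactSupport ρ) (hv : LocallyIntegrable v)
    (hw : ∀ φ : ℂ → ℝ, ContDiff ℝ ∞ φ → HasCompactSupport φ →
      ∫ z, v z • ∇ φ z = -∫ z, φ z • V z) (x : ℂ) :
    HasGradientAt (ρ ⋆[lsmul ℝ ℝ] v) (∫ t, ρ t • V (x - t)) x := by
  have h1 := hρc.hasFDerivAt_convolution_left (lsmul ℝ ℝ) (μ := volume)
    (hρ.of_le (by exact_mod_cast le_top)) hv x
  refine hasGradientAt_of_hasFDerivAt h1 fun y => ?_
  have hd : ∀ t, HasGradientAt (fun t => ρ (x - t)) (-(∇ ρ (x - t))) t := by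
    intro t
    have h2 : HasFDerivAt ρ (fderiv ℝ ρ (x - t)) (x - t) :=
      (hρ.differentiable (by simp) _).hasFDerivAt
    have h3 : HasFDerivAt (fun t => x - t) (-(ContinuousLinearMap.id ℝ ℂ)) t :=
      (hasFDerivAt_id t).const_sub x
    refine hasGradientAt_of_hasFDerivAt (h2.comp t h3) fun y => ?_
    rw [inner_neg_left, inner_gradient_left]
    simp
  have h4 := hw (fun t => ρ (x - t)) (hρ.comp (by fun_prop))
    (hρc.comp_homeomorph (Homeomorph.subLeft x))
  have h5 : ∇ (fun t => ρ (x - t)) = fun t => -(∇ ρ (x - t)) := gradient_eq hd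
  rw [h5] at h4
  have h6 : ∫ t, ρ (x - t) • V t = ∫ t, ρ t • V (x - t) := by
    rw [← integral_sub_left_eq_self _ volume x]
    simp
  have h7 : ∫ t, v t • ∇ ρ (x - t) = ∫ t, ρ t • V (x - t) := by
    simp only [smul_neg, integral_neg] at h4
    rw [← h6]
    exact neg_injective h4
  have hint : Integrable (fun t => v t • ∇ ρ (x - t)) :=
    hv.integrable_smul_right_of_hasCompactSupport (g := fun t => ∇ ρ (x - t))
      ((continuous_gradient hρ).comp (by fun_prop))
      ((gradient_hasCompactSupport hρc).comp_homeomorph (Homeomorph.subLeft x))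
  have hex := (hρc.fderiv (𝕜 := ℝ)).convolutionExists_left ((lsmul ℝ ℝ : ℝ →L[ℝ] ℝ →L[ℝ] ℝ).precompL ℂ) (μ := volume)
    (hρ.continuous_fderiv (by simp)) hv x
  rw [← h7, ← real_inner_comm, ← integral_inner hint, convolution_def,
    ContinuousLinearMap.integral_apply hex, ← integral_sub_left_eq_self _ volume x]
  refine integral_congr_ae (.of_forall fun t => ?_)
  simp only [inner_smul_right]
  simp [mul_comm]

/-- Mollifying `v` gives smooth test functions whose gradients are the mollified `V`. By Fubini each
resulting identity says that a mollification of `y ↦ ∫ x, inner ℝ (f x) (V (x + y))` vanishes at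
`0`, where `f` is a truncation of `F`. This correlation is continuous, so it vanishes at `0` itself.
-/
theorem integral_inner_eq_zero_of_weakGradient {v : ℂ → ℝ} {V F : ℂ → ℂ} {R : ℝ}
    (hv : LocallyIntegrable v) (hV : MemLp V 2)
    (hsv : ∀ z, R < ‖z‖ → v z = 0) (hsV : ∀ z, R < ‖z‖ → V z = 0)
    (hw : ∀ φ : ℂ → ℝ, ContDiff ℝ ∞ φ → HasCompactSupport φ →
      ∫ z, v z • ∇ φ z = -∫ z, φ z • V z)
    (hF : ∀ R : ℝ, MemLp F 2 (volume.restrict (Metric.ball (0 : ℂ) R)))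
    (heq : ∀ φ : ℂ → ℝ, ContDiff ℝ ∞ φ → HasCompactSupport φ → ∫ z, inner ℝ (F z) (∇ φ z) = 0) :
    ∫ z, inner ℝ (F z) (V z) = 0 := by
  -- The mollifiers have radius at most `1`, so only `F` on the ball of radius `R + 1` matters; the
  -- truncation makes it globally square integrable.
  set f : ℂ → ℂ := (Metric.ball (0 : ℂ) (R + 2)).indicator F with hfdef
  have hf : MemLp f 2 := (memLp_indicator_iff_restrict Metric.isOpen_ball.measurableSet).2 (hF _)
  have hfF : ∀ z, ‖z‖ ≤ R + 1 → f z = F z := fun z hz =>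
    indicator_of_mem (by simpa using by linarith) F
  let ρ : ℕ → ContDiffBump (0 : ℂ) := fun n =>
    ⟨1 / (2 * (n + 1)), 1 / (n + 1), by positivity, by
      rw [div_lt_div_iff₀ (by positivity) (by positivity)]; linarith [n.cast_nonneg (α := ℝ)]⟩
  have hρ0 : Tendsto (fun n => (ρ n).rOut) atTop (𝓝 0) := tendsto_one_div_add_atTop_nhds_zero_nat
  have hcont := continuous_integral_inner_translate hf hV
  have hlim := ContDiffBump.convolution_tendsto_right_of_continuous (μ := volume) hρ0 hcont 0
  have hzero : ∀ n, ((ρ n).normed volume ⋆[lsmul ℝ ℝ] fun y : ℂ => ∫ x, inner ℝ (f x) (V (x + y))) 0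
      = 0 := by
    intro n
    set r : ℂ → ℝ := (ρ n).normed volume with hr
    have hr1 : ContDiff ℝ ∞ r := (ρ n).contDiff_normed
    have hr2 : HasCompactSupport r := (ρ n).hasCompactSupport_normed
    have hri : Integrable r := hr1.continuous.integrable_of_hasCompactSupport hr2
    have hrout : (ρ n).rOut ≤ 1 := by
      change 1 / ((n : ℝ) + 1) ≤ 1
      rw [div_le_one (by positivity)]; linarith [n.cast_nonneg (α := ℝ)]
    have hrs : ∀ t, 1 ≤ ‖t‖ → r t = 0 := fun t ht => by
      have : t ∉ Function.support r := by
        rw [hr, (ρ n).support_normed_eq]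
        simpa using by linarith
      simpa using this
    have hgrad := hasGradientAt_bump_convolution hr1 hr2 hv hw
    have hcd := hr2.contDiff_convolution_left (lsmul ℝ ℝ) (μ := volume) hr1 hv
    have hsupp : ∀ x, R + 1 < ‖x‖ → (r ⋆[lsmul ℝ ℝ] v) x = 0 := by
      intro x hx
      rw [convolution_def]
      refine integral_eq_zero_of_ae (.of_forall fun t => ?_)
      by_cases ht : 1 ≤ ‖t‖
      · simp [hrs t ht]
      · have : R < ‖x - t‖ := by
          have := norm_sub_norm_le x t
          push Not at ht; linarith
        simp [hsv _ this]
    have hcs : HasCompactSupport (r ⋆[lsmul ℝ ℝ] v) := by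
      refine HasCompactSupport.intro (isCompact_closedBall (0 : ℂ) (R + 1)) fun x hx => hsupp x ?_
      simpa using hx
    have h1 := heq _ hcd hcs
    rw [gradient_eq hgrad] at h1
    have h2 : ∫ x, inner ℝ (f x) (∫ t, r t • V (x - t)) = 0 := by
      rw [← h1]
      refine integral_congr_ae (.of_forall fun x => ?_)
      by_cases hx : ‖x‖ ≤ R + 1
      · simp [hfF x hx]
      · have : ∫ t, r t • V (x - t) = 0 := by
          refine integral_eq_zero_of_ae (.of_forall fun t => ?_)
          by_cases ht : 1 ≤ ‖t‖
          · simp [hrs t ht]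
          · have : R < ‖x - t‖ := by
              have := norm_sub_norm_le x t
              push Not at ht hx; linarith
            simp [hsV _ this]
        simp only [this, inner_zero_right]
    rw [← h2, convolution_def]
    have hV1 : LocallyIntegrable V := hV.locallyIntegrable (by norm_num)
    have hswap : ∀ x, inner ℝ (f x) (∫ t, r t • V (x - t))
        = ∫ t, r t * inner ℝ (f x) (V (x - t)) := by
      intro x
      have hi : Integrable (fun t => r t • V (x - t)) := by
        have := (hV1.integrable_smul_left_of_hasCompactSupport (g := fun t => r (x - t))
          (hr1.continuous.comp (by fun_prop)) (hr2.comp_homeomorph (Homeomorph.subLeft x)))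
        simpa using this.comp_sub_left x
      rw [← integral_inner hi]
      simp only [inner_smul_right]
    simp only [hswap]
    rw [integral_integral_swap]
    · refine integral_congr_ae (.of_forall fun t => ?_)
      simp [integral_const_mul, sub_eq_add_neg]
    · have hV2 : Integrable (fun x => ‖V x‖ ^ 2) := hV.integrable_norm_pow (by norm_num)
      have hf2 : Integrable (fun x => ‖f x‖ ^ 2) := hf.integrable_norm_pow (by norm_num)
      -- Fubini is justified through `|f| |V| ≤ |f|² + |V|²`, each square being integrable against
      -- the kernel on the product.
      have i1 := hri.convolution_integrand (lsmul ℝ ℝ) hV2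
      have i2 := hf2.mul_prod hri
      refine (i1.norm.add i2.norm).mono' ?_ (.of_forall fun p => ?_)
      · have m1 : AEStronglyMeasurable (fun p : ℂ × ℂ => V (p.1 - p.2)) (volume.prod volume) :=
          hV.1.comp_quasiMeasurePreserving (quasiMeasurePreserving_sub _ _)
        have m2 : AEStronglyMeasurable (fun p : ℂ × ℂ => f p.1) (volume.prod volume) :=
          hf.1.comp_fst
        have m3 : AEStronglyMeasurable (fun p : ℂ × ℂ => r p.2) (volume.prod volume) :=
          hri.1.comp_snd
        exact m3.mul (m2.inner m1)
      · have h := abs_real_inner_le_norm (f p.1) (V (p.1 - p.2))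
        simp only [Function.uncurry, Pi.add_apply, norm_mul, Real.norm_eq_abs, lsmul_apply,
          smul_eq_mul, abs_pow, abs_norm]
        nlinarith [sq_nonneg (‖f p.1‖ - ‖V (p.1 - p.2)‖), abs_nonneg (r p.2),
          mul_nonneg (abs_nonneg (r p.2)) (sq_nonneg (‖f p.1‖ - ‖V (p.1 - p.2)‖)),
          mul_le_mul_of_nonneg_left h (abs_nonneg (r p.2)),
          mul_nonneg (abs_nonneg (r p.2)) (sq_nonneg (‖f p.1‖)),
          mul_nonneg (abs_nonneg (r p.2)) (sq_nonneg (‖V (p.1 - p.2)‖))]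
  have h0 : ∫ x, inner ℝ (f x) (V (x + 0)) = 0 :=
    tendsto_nhds_unique hlim (by simp only [hzero]; exact tendsto_const_nhds)
  rw [← h0]
  refine integral_congr_ae (.of_forall fun x => ?_)
  by_cases hx : ‖x‖ ≤ R + 1
  · simp [hfF x hx]
  · simp only [add_zero, hsV x (by push Not at hx; linarith), inner_zero_right]

end

/-! ### Energy estimate, Liouville property and uniqueness of weak solutions. -/

section

open scoped Convolution
open ContinuousLinearMap

theorem memLp_smul_of_local {E : Type*} [NormedAddCommGroup E] [NormedSpace ℝ E] {f : ℂ → E}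
    (hf : ∀ R : ℝ, MemLp f 2 (volume.restrict (Metric.ball (0 : ℂ) R))) {g : ℂ → ℝ}
    (hg : Continuous g) (hgc : HasCompactSupport g) : MemLp (fun z => g z • f z) 2 := by
  obtain ⟨R, hR⟩ := hgc.isCompact.isBounded.subset_ball (0 : ℂ)
  have h1 : MemLp ((Metric.ball (0 : ℂ) R).indicator f) 2 :=
    (memLp_indicator_iff_restrict Metric.isOpen_ball.measurableSet).2 (hf R)
  have h2 : MemLp g ⊤ := hg.memLp_top_of_hasCompactSupport hgc volume
  have h3 : MemLp (g • (Metric.ball (0 : ℂ) R).indicator f) 2 := h1.smul h2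
  refine (memLp_congr_ae (.of_forall fun z => ?_)).1 h3
  by_cases hz : z ∈ Metric.ball (0 : ℂ) R
  · simp [hz]
  · have : g z = 0 := image_eq_zero_of_notMem_tsupport fun h => hz (hR h)
    simp [this]

theorem memLp_smul_of_local' {f : ℂ → ℝ}
    (hf : ∀ R : ℝ, MemLp f 2 (volume.restrict (Metric.ball (0 : ℂ) R))) {g : ℂ → ℂ}
    (hg : Continuous g) (hgc : HasCompactSupport g) : MemLp (fun z => f z • g z) 2 := by
  obtain ⟨R, hR⟩ := hgc.isCompact.isBounded.subset_ball (0 : ℂ)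
  have h1 : MemLp ((Metric.ball (0 : ℂ) R).indicator f) 2 :=
    (memLp_indicator_iff_restrict Metric.isOpen_ball.measurableSet).2 (hf R)
  have h2 : MemLp g ⊤ := hg.memLp_top_of_hasCompactSupport hgc volume
  have h3 : MemLp ((Metric.ball (0 : ℂ) R).indicator f • g) 2 := h2.smul h1
  refine (memLp_congr_ae (.of_forall fun z => ?_)).1 h3
  by_cases hz : z ∈ Metric.ball (0 : ℂ) R
  · simp [hz]
  · have : g z = 0 := image_eq_zero_of_notMem_tsupport fun h => hz (hR h)
    simp [this]

theorem locallyIntegrable_of_memLp_ball {E : Type*} [NormedAddCommGroup E] {f : ℂ → E}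
    (hf : ∀ R : ℝ, MemLp f 2 (volume.restrict (Metric.ball (0 : ℂ) R))) : LocallyIntegrable f := by
  refine fun z => ⟨Metric.ball 0 (‖z‖ + 1), Metric.isOpen_ball.mem_nhds (by simp), ?_⟩
  have : IsFiniteMeasure (volume.restrict (Metric.ball (0 : ℂ) (‖z‖ + 1))) :=
    ⟨by rw [Measure.restrict_apply_univ]; exact measure_ball_lt_top⟩
  exact (hf _).integrable (by norm_num)

theorem integrable_inner_of_memLp {f g : ℂ → ℂ} (hf : MemLp f 2) (hg : MemLp g 2) :
    Integrable fun z => inner ℝ (f z) (g z) := by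
  refine ((hf.integrable_norm_pow (by norm_num)).add (hg.integrable_norm_pow (by norm_num))).mono'
    (hf.1.inner hg.1) (.of_forall fun z => ?_)
  have := abs_real_inner_le_norm (f z) (g z)
  simp only [Pi.add_apply, Real.norm_eq_abs]
  nlinarith [sq_nonneg (‖f z‖ - ‖g z‖), sq_nonneg ‖f z‖, sq_nonneg ‖g z‖]

theorem HasGradientAt.fun_mul {f g : ℂ → ℝ} {f' g' z : ℂ} (hf : HasGradientAt f f' z)
    (hg : HasGradientAt g g' z) :
    HasGradientAt (fun z => f z * g z) (f z • g' + g z • f') z := by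
  refine hasGradientAt_of_hasFDerivAt
    ((hasGradientAt_iff_hasFDerivAt.1 hf).mul (hasGradientAt_iff_hasFDerivAt.1 hg)) fun y => ?_
  simp only [inner_add_left, real_inner_smul_left, _root_.add_apply,
    _root_.smul_apply, toDual_apply_apply, smul_eq_mul]

theorem gradient_fun_mul {f g : ℂ → ℝ} (hf : ContDiff ℝ ∞ f) (hg : ContDiff ℝ ∞ g) :
    ∇ (fun z => f z * g z) = fun z => f z • ∇ g z + g z • ∇ f z :=
  gradient_eq fun z => (contDiff_hasGradientAt hf z).fun_mul (contDiff_hasGradientAt hg z)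

theorem weakGradient_mul {w : ℂ → ℝ} {F : ℂ → ℂ} (hw : HasWeakGradient w F) {η : ℂ → ℝ}
    (hη : ContDiff ℝ ∞ η) (hηc : HasCompactSupport η) {φ : ℂ → ℝ} (hφ : ContDiff ℝ ∞ φ)
    (hφc : HasCompactSupport φ) :
    ∫ z, (η z * w z) • ∇ φ z = -∫ z, φ z • (η z • F z + w z • ∇ η z) := by
  have h := hw.integral_eq (fun z => η z * φ z) (hη.mul hφ) hηc.mul_right
  rw [gradient_fun_mul hη hφ] at h
  have lw := locallyIntegrable_of_memLp_ball hw.memLp_fun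
  have lF := locallyIntegrable_of_memLp_ball hw.memLp_grad
  have hgφ := continuous_gradient hφ
  have hgη := continuous_gradient hη
  have i1 : Integrable fun z => w z • (η z • ∇ φ z) :=
    lw.integrable_smul_right_of_hasCompactSupport (hη.continuous.smul hgφ) hηc.smul_right
  have i2 : Integrable fun z => w z • (φ z • ∇ η z) :=
    lw.integrable_smul_right_of_hasCompactSupport (hφ.continuous.smul hgη) hφc.smul_right
  have i3 : Integrable fun z => (η z * φ z) • F z :=
    lF.integrable_smul_left_of_hasCompactSupport (hη.continuous.mul hφ.continuous) hηc.mul_right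
  have e1 : ∫ z, (η z * w z) • ∇ φ z = ∫ z, w z • (η z • ∇ φ z) := by
    congr 1; ext1 z; rw [smul_smul, mul_comm]
  have e2 : ∫ z, φ z • (η z • F z + w z • ∇ η z)
      = (∫ z, (η z * φ z) • F z) + ∫ z, w z • (φ z • ∇ η z) := by
    rw [← integral_add i3 i2]
    congr 1; ext1 z
    rw [smul_add, smul_smul, smul_smul, smul_smul, mul_comm (φ z), mul_comm (φ z)]
  rw [e1, e2, neg_add, ← h]
  simp only [smul_add]
  rw [integral_add i1 i2]
  abel

/-- The energy identity tested against `η² w`. -/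
theorem energy_identity {w σ : ℂ → ℝ} {F : ℂ → ℂ} (hw : HasWeakGradient w F)
    (hσF : ∀ R : ℝ, MemLp (fun z => σ z • F z) 2 (volume.restrict (Metric.ball (0 : ℂ) R)))
    (heq : ∀ φ : ℂ → ℝ, ContDiff ℝ ∞ φ → HasCompactSupport φ →
      ∫ z, σ z * inner ℝ (F z) (∇ φ z) = 0)
    {η : ℂ → ℝ} (hη : ContDiff ℝ ∞ η) (hηc : HasCompactSupport η) :
    ∫ z, σ z * (η z ^ 2 * ‖F z‖ ^ 2 + 2 * η z * w z * inner ℝ (F z) (∇ η z)) = 0 := by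
  set ζ : ℂ → ℝ := fun z => η z * η z with hζ
  have hζd : ContDiff ℝ ∞ ζ := hη.mul hη
  have hζc : HasCompactSupport ζ := hηc.mul_right
  obtain ⟨R, hR⟩ := hηc.isCompact.isBounded.subset_closedBall (0 : ℂ)
  have hz : ∀ z, R < ‖z‖ → z ∉ tsupport η := fun z hz h => by
    have := hR h; simp at this; linarith
  have hz1 : ∀ z, R < ‖z‖ → η z = 0 := fun z h => image_eq_zero_of_notMem_tsupport (hz z h)
  have m1 : MemLp (fun z => ζ z • F z) 2 := memLp_smul_of_local hw.memLp_grad hζd.continuous hζc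
  have hgζ := gradient_fun_mul hη hη
  have m2 : MemLp (fun z => w z • ∇ ζ z) 2 :=
    memLp_smul_of_local' hw.memLp_fun (continuous_gradient hζd) (gradient_hasCompactSupport hζc)
  have m3 : MemLp (fun z => ζ z • w z) 2 := memLp_smul_of_local hw.memLp_fun hζd.continuous hζc
  have key := integral_inner_eq_zero_of_weakGradient (v := fun z => ζ z * w z)
    (V := fun z => ζ z • F z + w z • ∇ ζ z) (F := fun z => σ z • F z) (R := R)
    (m3.locallyIntegrable (by norm_num)) (m1.add m2)
    (fun z h => by simp [hζ, hz1 z h])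
    (fun z h => by rw [hgζ]; simp [hζ, hz1 z h])
    (fun φ h1 h2 => weakGradient_mul hw hζd hζc h1 h2) hσF
    (fun φ h1 h2 => by
      rw [← heq φ h1 h2]; congr 1; ext1 z; rw [real_inner_smul_left])
  rw [← key]
  congr 1; ext1 z
  rw [hgζ]
  simp only [inner_add_right, real_inner_smul_left, real_inner_smul_right, real_inner_self_eq_norm_sq,
    hζ]
  ring

/-- All cutoffs are dilates of one bump, so a single `K` serves every radius; this is what allows
the radius to tend to infinity. -/
theorem exists_cutoff : ∃ K : ℝ, 0 ≤ K ∧ ∀ R : ℝ, 0 < R → ∃ η : ℂ → ℝ, ContDiff ℝ ∞ η ∧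
    HasCompactSupport η ∧ (∀ z, ‖z‖ ≤ R → η z = 1) ∧ (∀ z, ‖∇ η z‖ ≤ K / R) ∧
    (∀ z, ‖z‖ < R → ∇ η z = 0) ∧ (∀ z, 2 * R < ‖z‖ → ∇ η z = 0) := by
  let χ : ContDiffBump (0 : ℂ) := ⟨1, 2, by norm_num, by norm_num⟩
  have hχ : ContDiff ℝ ∞ χ := χ.contDiff
  obtain ⟨K, hK⟩ := (continuous_gradient hχ).bounded_above_of_compact_support
    (gradient_hasCompactSupport χ.hasCompactSupport)
  have hK0 : 0 ≤ K := (norm_nonneg _).trans (hK 0)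
  refine ⟨K, hK0, fun R hR => ?_⟩
  have hcd : ContDiff ℝ ∞ fun z : ℂ => χ (R⁻¹ • z) := hχ.comp (by fun_prop)
  have hg : ∇ (fun z : ℂ => χ (R⁻¹ • z)) = fun z => R⁻¹ • ∇ χ (R⁻¹ • z) := by
    refine gradient_eq fun z => ?_
    have h2 : HasFDerivAt χ (fderiv ℝ χ (R⁻¹ • z)) (R⁻¹ • z) :=
      (hχ.differentiable (by simp) _).hasFDerivAt
    have h3 : HasFDerivAt (fun z : ℂ => R⁻¹ • z) (R⁻¹ • ContinuousLinearMap.id ℝ ℂ) z :=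
      (hasFDerivAt_id z).const_smul R⁻¹
    refine hasGradientAt_of_hasFDerivAt (h2.comp z h3) fun y => ?_
    rw [real_inner_smul_left, inner_gradient_left]
    simp
  have hnorm : ∀ z : ℂ, ‖R⁻¹ • z‖ = ‖z‖ / R := fun z => by
    rw [norm_smul, Real.norm_of_nonneg (by positivity)]; field_simp
  refine ⟨_, hcd, χ.hasCompactSupport.comp_homeomorph (Homeomorph.smulOfNeZero R⁻¹ (by positivity)),
    fun z hz => χ.one_of_mem_closedBall ?_, fun z => ?_, fun z hz => ?_, fun z hz => ?_⟩
  · rw [mem_closedBall_zero_iff, hnorm, div_le_iff₀ hR]; simpa [χ] using hz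
  · rw [hg]; simp only [norm_smul, norm_inv, Real.norm_of_nonneg hR.le]
    rw [inv_mul_eq_div]; gcongr; exact hK _
  · refine ((hasGradientAt_const z (1 : ℝ)).congr_of_eventuallyEq ?_).gradient
    filter_upwards [(isOpen_lt continuous_norm continuous_const).mem_nhds hz] with y hy
    refine χ.one_of_mem_closedBall ?_
    rw [mem_closedBall_zero_iff, hnorm, div_le_iff₀ hR]; simpa [χ] using hy.le
  · refine ((hasGradientAt_const z (0 : ℝ)).congr_of_eventuallyEq ?_).gradient
    filter_upwards [(isOpen_lt continuous_const continuous_norm).mem_nhds hz] with y hy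
    refine χ.zero_of_le_dist ?_
    rw [dist_zero_right, hnorm, le_div_iff₀ hR]; simpa [χ] using le_of_lt hy

/-- Caccioppoli's inequality bounds the energy in a ball of radius `R` by `∫ w² |∇η|²` over `R ≤ |z|
≤ 2R`. The area there is `O(R²)` and the integrand `O(R⁻⁴)`, so the energy vanishes in the limit.
Only measurability and two-sided bounds of `σ` enter. -/
theorem grad_eq_zero_of_decay {w σ : ℂ → ℝ} {F : ℂ → ℂ} (hw : HasWeakGradient w F)
    (hσm : Measurable σ) {k₁ k₂ : ℝ} (hk₁ : 0 < k₁) (hσ₁ : ∀ z, k₁ ≤ σ z) (hσ₂ : ∀ z, σ z ≤ k₂)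
    (heq : ∀ φ : ℂ → ℝ, ContDiff ℝ ∞ φ → HasCompactSupport φ →
      ∫ z, σ z * inner ℝ (F z) (∇ φ z) = 0)
    (hdec : ∃ M R₀ : ℝ, ∀ᵐ z : ℂ, R₀ ≤ ‖z‖ → |w z| ≤ M / ‖z‖) :
    ∀ᵐ z, F z = 0 := by
  obtain ⟨M, R₀, hM⟩ := hdec
  obtain ⟨K, hK0, hcut⟩ := exists_cutoff
  have hk₂ : 0 ≤ k₂ := hk₁.le.trans ((hσ₁ 0).trans (hσ₂ 0))
  have hσb : ∀ z, ‖σ z‖ ≤ k₂ := fun z => by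
    rw [Real.norm_of_nonneg (hk₁.le.trans (hσ₁ z))]; exact hσ₂ z
  have hσF : ∀ R : ℝ, MemLp (fun z => σ z • F z) 2 (volume.restrict (Metric.ball (0 : ℂ) R)) := by
    intro R
    have : MemLp σ ⊤ (volume.restrict (Metric.ball (0 : ℂ) R)) :=
      memLp_top_of_bound hσm.aestronglyMeasurable k₂ (.of_forall hσb)
    exact (hw.memLp_grad R).smul this
  -- the energy in the ball of radius `R` is `O(R⁻²)`
  have hE : ∀ R : ℝ, 0 < R → R₀ ≤ R →
      ∫ z in Metric.ball (0 : ℂ) R, ‖F z‖ ^ 2 ≤ 16 * Real.pi * k₂ / k₁ * (M * K) ^ 2 / R ^ 2 := by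
    intro R hR hRR
    obtain ⟨η, hη, hηc, hη1, hηK, hη2, hη3⟩ := hcut R hR
    have e := energy_identity hw hσF heq hη hηc
    have hgη := continuous_gradient hη
    have hgηc := gradient_hasCompactSupport hηc
    have i1 : Integrable fun z => ‖η z • F z‖ ^ 2 :=
      (memLp_smul_of_local hw.memLp_grad hη.continuous hηc).integrable_norm_pow (by norm_num)
    have i2 : Integrable fun z => ‖w z • ∇ η z‖ ^ 2 :=
      (memLp_smul_of_local' hw.memLp_fun hgη hgηc).integrable_norm_pow (by norm_num)
    have m12 : Integrable fun z => inner ℝ (η z • F z) (w z • ∇ η z) :=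
      integrable_inner_of_memLp (memLp_smul_of_local hw.memLp_grad hη.continuous hηc)
        (memLp_smul_of_local' hw.memLp_fun hgη hgηc)
    have j1 : Integrable fun z => σ z * ‖η z • F z‖ ^ 2 :=
      i1.bdd_mul hσm.aestronglyMeasurable (.of_forall hσb)
    have j2 : Integrable fun z => σ z * ‖w z • ∇ η z‖ ^ 2 :=
      i2.bdd_mul hσm.aestronglyMeasurable (.of_forall hσb)
    have j12 : Integrable fun z => σ z * inner ℝ (η z • F z) (w z • ∇ η z) :=
      m12.bdd_mul hσm.aestronglyMeasurable (.of_forall hσb)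
    have e' : (∫ z, σ z * ‖η z • F z‖ ^ 2) + 2 * ∫ z, σ z * inner ℝ (η z • F z) (w z • ∇ η z)
        = 0 := by
      rw [← e, ← integral_const_mul, ← integral_add j1 (j12.const_mul 2)]
      congr 1; ext1 z
      rw [norm_smul, real_inner_smul_left, real_inner_smul_right, mul_pow, Real.norm_eq_abs, sq_abs]
      ring
    -- Young's inequality `2ab ≤ a²/2 + 2b²`: half of the energy is absorbed on the left.
    have l1 : (∫ z, σ z * ‖η z • F z‖ ^ 2) ≤ 4 * ∫ z, σ z * ‖w z • ∇ η z‖ ^ 2 := by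
      have : -(2 * ∫ z, σ z * inner ℝ (η z • F z) (w z • ∇ η z))
          ≤ ∫ z, (1 / 2 * (σ z * ‖η z • F z‖ ^ 2) + 2 * (σ z * ‖w z • ∇ η z‖ ^ 2)) := by
        rw [← integral_const_mul, ← integral_neg]
        refine integral_mono (j12.const_mul 2).neg ((j1.const_mul _).add (j2.const_mul _)) fun z => ?_
        have h1 := abs_real_inner_le_norm (η z • F z) (w z • ∇ η z)
        have h2 := neg_abs_le (inner ℝ (η z • F z) (w z • ∇ η z))
        have h3 : 0 ≤ σ z := hk₁.le.trans (hσ₁ z)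
        have h4 : -(2 * inner ℝ (η z • F z) (w z • ∇ η z))
            ≤ 1 / 2 * ‖η z • F z‖ ^ 2 + 2 * ‖w z • ∇ η z‖ ^ 2 := by
          nlinarith [sq_nonneg (‖η z • F z‖ - 2 * ‖w z • ∇ η z‖)]
        have h5 := mul_le_mul_of_nonneg_left h4 h3
        simp only at h5 ⊢
        linarith
      rw [integral_add (j1.const_mul _) (j2.const_mul _), integral_const_mul, integral_const_mul]
        at this
      linarith
    have l2 : k₁ * ∫ z in Metric.ball (0 : ℂ) R, ‖F z‖ ^ 2 ≤ ∫ z, σ z * ‖η z • F z‖ ^ 2 := by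
      rw [← integral_const_mul, ← integral_indicator Metric.isOpen_ball.measurableSet]
      refine integral_mono_of_nonneg (.of_forall fun z => ?_) j1 (.of_forall fun z => ?_)
      · exact indicator_nonneg (fun z _ => by positivity) z
      · by_cases hz : z ∈ Metric.ball (0 : ℂ) R
        · beta_reduce
          rw [indicator_of_mem hz, hη1 z (by simpa using (mem_ball_zero_iff.1 hz).le), one_smul]
          exact mul_le_mul_of_nonneg_right (hσ₁ z) (by positivity)
        · rw [indicator_of_notMem hz]
          exact mul_nonneg (hk₁.le.trans (hσ₁ z)) (by positivity)
    have l3 : (∫ z, σ z * ‖w z • ∇ η z‖ ^ 2)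
        ≤ ∫ z in Metric.closedBall (0 : ℂ) (2 * R), k₂ * (M * K / R ^ 2) ^ 2 := by
      rw [← integral_indicator Metric.isClosed_closedBall.measurableSet]
      refine integral_mono_ae j2 ?_ ?_
      · rw [integrable_indicator_iff Metric.isClosed_closedBall.measurableSet]
        exact integrableOn_const measure_closedBall_lt_top.ne
      · filter_upwards [hM] with z hz
        by_cases h1 : z ∈ Metric.closedBall (0 : ℂ) (2 * R)
        · rw [indicator_of_mem h1]
          refine mul_le_mul (hσ₂ z) ?_ (by positivity) hk₂
          by_cases h2 : ‖z‖ < R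
          · rw [hη2 z h2]; simp; positivity
          · push Not at h2
            have h3 := hz (hRR.trans h2)
            have h4 : |w z| ≤ |M| / R := h3.trans
              (div_le_div₀ (abs_nonneg M) (le_abs_self M) hR h2)
            have h5 : ‖w z • ∇ η z‖ ≤ |M| * K / R ^ 2 := by
              rw [norm_smul, Real.norm_eq_abs]
              calc |w z| * ‖∇ η z‖ ≤ |M| / R * (K / R) := by gcongr; exact hηK z
                _ = _ := by ring
            calc ‖w z • ∇ η z‖ ^ 2 ≤ (|M| * K / R ^ 2) ^ 2 := by gcongr
              _ = _ := by rw [div_pow, div_pow, mul_pow, mul_pow, sq_abs]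
        · rw [indicator_of_notMem h1, hη3 z (by simpa using h1)]; simp
    rw [setIntegral_const, measureReal_def, Complex.volume_closedBall] at l3
    have l4 : k₁ * ∫ z in Metric.ball (0 : ℂ) R, ‖F z‖ ^ 2
        ≤ 16 * Real.pi * k₂ * (M * K) ^ 2 / R ^ 2 := by
      refine (l2.trans (l1.trans (mul_le_mul_of_nonneg_left l3 (by norm_num)))).trans_eq ?_
      rw [ENNReal.toReal_mul, ENNReal.toReal_pow, ENNReal.toReal_ofReal (by positivity)]
      simp only [ENNReal.coe_toReal, NNReal.coe_real_pi, smul_eq_mul]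
      field_simp
      ring
    rw [← le_div_iff₀' hk₁] at l4
    refine l4.trans_eq ?_
    field_simp
  have hball : ∀ n : ℕ, ∀ᵐ z ∂(volume.restrict (Metric.ball (0 : ℂ) n)), F z = 0 := by
    intro n
    have hi : ∀ R : ℝ, IntegrableOn (fun z => ‖F z‖ ^ 2) (Metric.ball (0 : ℂ) R) := fun R =>
      (hw.memLp_grad R).integrable_norm_pow (by norm_num)
    have h0 : ∫ z in Metric.ball (0 : ℂ) n, ‖F z‖ ^ 2 = 0 := by
      refine le_antisymm ?_ (integral_nonneg fun z => by positivity)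
      have hlim : Tendsto (fun R : ℝ => 16 * Real.pi * k₂ / k₁ * (M * K) ^ 2 / R ^ 2) atTop (𝓝 0) :=
        tendsto_const_nhds.div_atTop (tendsto_pow_atTop (by norm_num))
      refine ge_of_tendsto hlim ?_
      filter_upwards [eventually_ge_atTop (n : ℝ), eventually_ge_atTop R₀, eventually_gt_atTop 0]
        with R h1 h2 h3
      exact (setIntegral_mono_set (hi R) (.of_forall fun z => by positivity)
        (Metric.ball_subset_ball h1).eventuallyLE).trans (hE R h3 h2)
    have := (setIntegral_eq_zero_iff_of_nonneg_ae (.of_forall fun z => by positivity) (hi n)).1 h0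
    filter_upwards [this] with z hz
    simpa using hz
  have hun : (⋃ n : ℕ, Metric.ball (0 : ℂ) n) = univ := Metric.iUnion_ball_nat 0
  rw [← Measure.restrict_univ (μ := volume (α := ℂ)), ← hun, ae_restrict_iUnion_iff]
  exact hball

/-- Each mollification has zero gradient and is constant; at almost every point the mollifications
converge to `w`. -/
theorem ae_eq_const_of_weakGradient_zero {w : ℂ → ℝ} {F : ℂ → ℂ} (hw : HasWeakGradient w F)
    (hF : ∀ᵐ z, F z = 0) : ∃ c : ℝ, ∀ᵐ z, w z = c := by
  have lw := locallyIntegrable_of_memLp_ball hw.memLp_fun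
  let ρ : ℕ → ContDiffBump (0 : ℂ) := fun n =>
    ⟨1 / (2 * (n + 1)), 1 / (n + 1), by positivity, by
      rw [div_lt_div_iff₀ (by positivity) (by positivity)]; linarith [n.cast_nonneg (α := ℝ)]⟩
  have hρ0 : Tendsto (fun n => (ρ n).rOut) atTop (𝓝 0) := tendsto_one_div_add_atTop_nhds_zero_nat
  -- The two radii of each bump have ratio exactly `2`, whence this value of `K`.
  have hae := ContDiffBump.ae_convolution_tendsto_right_of_locallyIntegrable (μ := volume) (K := 2)
    hρ0 (.of_forall fun n => by simp only [ρ]; rw [← sub_nonneg]; apply le_of_eq; field_simp; ring) lw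
  have hconst : ∀ n x, ((ρ n).normed volume ⋆[lsmul ℝ ℝ] w) x
      = ((ρ n).normed volume ⋆[lsmul ℝ ℝ] w) 0 := by
    intro n x
    have hgrad := hasGradientAt_bump_convolution (ρ n).contDiff_normed
      ((ρ n).hasCompactSupport_normed (μ := volume)) lw hw.integral_eq
    refine is_const_of_fderiv_eq_zero (𝕜 := ℝ) (fun y => (hgrad y).differentiableAt) (fun y => ?_) x 0
    have h0 : ∫ t, (ρ n).normed volume t • F (y - t) = 0 := by
      refine integral_eq_zero_of_ae ?_
      filter_upwards [(Measure.measurePreserving_sub_left volume y).quasiMeasurePreserving.ae hF] with t ht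
      simp [ht]
    have := hgrad y
    rw [h0] at this
    rw [(hasGradientAt_iff_hasFDerivAt.1 this).fderiv, map_zero]
  obtain ⟨x₀, hx₀⟩ := hae.exists
  refine ⟨w x₀, ?_⟩
  filter_upwards [hae] with x hx
  refine tendsto_nhds_unique hx (hx₀.congr fun n => ?_)
  rw [hconst n x₀, hconst n x]

theorem CoreShell.HasWeakGradient.sub {u v : ℂ → ℝ} {F G : ℂ → ℂ} (hu : HasWeakGradient u F)
    (hv : HasWeakGradient v G) : HasWeakGradient (fun z => u z - v z) (fun z => F z - G z) where
  memLp_fun R := (hu.memLp_fun R).sub (hv.memLp_fun R)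
  memLp_grad R := (hu.memLp_grad R).sub (hv.memLp_grad R)
  integral_eq φ hφ hφc := by
    have i1 := (locallyIntegrable_of_memLp_ball hu.memLp_fun).integrable_smul_right_of_hasCompactSupport
      (continuous_gradient hφ) (gradient_hasCompactSupport hφc)
    have i2 := (locallyIntegrable_of_memLp_ball hv.memLp_fun).integrable_smul_right_of_hasCompactSupport
      (continuous_gradient hφ) (gradient_hasCompactSupport hφc)
    have i3 := (locallyIntegrable_of_memLp_ball hu.memLp_grad).integrable_smul_left_of_hasCompactSupport
      hφ.continuous hφc
    have i4 := (locallyIntegrable_of_memLp_ball hv.memLp_grad).integrable_smul_left_of_hasCompactSupport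
      hφ.continuous hφc
    simp only [sub_smul, smul_sub]
    rw [integral_sub i1 i2, integral_sub i3 i4, hu.integral_eq φ hφ hφc, hv.integral_eq φ hφ hφc]
    abel

/-- Two solutions with the same data have the same gradient and differ by a constant. -/
theorem CoreShell.IsSolution.unique {σ H u v : ℂ → ℝ} {F G : ℂ → ℂ} (hu : IsSolution σ H u F)
    (hv : IsSolution σ H v G) (hσm : Measurable σ) {k₁ k₂ : ℝ} (hk₁ : 0 < k₁)
    (hσ₁ : ∀ z, k₁ ≤ σ z) (hσ₂ : ∀ z, σ z ≤ k₂) :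
    (∀ᵐ z, F z = G z) ∧ ∃ c : ℝ, ∀ᵐ z, u z = v z + c := by
  have hw := hu.weakGradient.sub hv.weakGradient
  have hσF : ∀ {F : ℂ → ℂ}, (∀ R : ℝ, MemLp F 2 (volume.restrict (Metric.ball (0 : ℂ) R))) →
      LocallyIntegrable (fun z => σ z • F z) := fun {F} hF => by
    refine locallyIntegrable_of_memLp_ball fun R => ?_
    have : MemLp σ ⊤ (volume.restrict (Metric.ball (0 : ℂ) R)) :=
      memLp_top_of_bound hσm.aestronglyMeasurable k₂ (.of_forall fun z => by
        rw [Real.norm_of_nonneg (hk₁.le.trans (hσ₁ z))]; exact hσ₂ z)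
    exact (hF R).smul this
  have hint : ∀ {F : ℂ → ℂ}, (∀ R : ℝ, MemLp F 2 (volume.restrict (Metric.ball (0 : ℂ) R))) →
      ∀ φ : ℂ → ℝ, ContDiff ℝ ∞ φ → HasCompactSupport φ →
      Integrable fun z => σ z * inner ℝ (F z) (∇ φ z) := fun {F} hF φ hφ hφc => by
    obtain ⟨C, hC⟩ := (continuous_gradient hφ).bounded_above_of_compact_support
      (gradient_hasCompactSupport hφc)
    have hK : IsCompact (tsupport (∇ φ)) := gradient_hasCompactSupport hφc
    have hi := ((hσF hF).integrableOn_isCompact hK).norm.mul_const C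
    rw [← IntegrableOn, ← integrable_indicator_iff hK.measurableSet] at hi
    refine hi.mono' ((hσF hF).aestronglyMeasurable.inner
      (continuous_gradient hφ).aestronglyMeasurable |>.congr (.of_forall fun z => by
        beta_reduce; rw [real_inner_smul_left])) (.of_forall fun z => ?_)
    by_cases hz : z ∈ tsupport (∇ φ)
    · rw [indicator_of_mem hz, ← real_inner_smul_left]
      exact (abs_real_inner_le_norm _ _).trans
        (mul_le_mul_of_nonneg_left (hC z) (norm_nonneg _))
    · rw [indicator_of_notMem hz, image_eq_zero_of_notMem_tsupport hz, inner_zero_right, mul_zero,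
        norm_zero]
  have hzero : ∀ᵐ z, F z - G z = 0 := by
    refine grad_eq_zero_of_decay hw hσm hk₁ hσ₁ hσ₂ (fun φ hφ hφc => ?_) ?_
    · simp only [inner_sub_left, mul_sub]
      rw [integral_sub (hint hu.weakGradient.memLp_grad φ hφ hφc)
        (hint hv.weakGradient.memLp_grad φ hφ hφc), hu.equation φ hφ hφc, hv.equation φ hφ hφc,
        sub_zero]
    · obtain ⟨M, hM⟩ := (hu.decay.sub hv.decay).bound
      -- A set in `cocompact ⊓ ae` contains the intersection of a conull set with the complement of
      -- a compact set; this turns the decay into an almost everywhere bound outside a ball.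
      obtain ⟨s, hs, t, ht, hst⟩ := mem_inf_iff_superset.1 hM
      obtain ⟨K, hK, hKs⟩ := mem_cocompact.1 hs
      obtain ⟨R, hR⟩ := hK.isBounded.subset_ball (0 : ℂ)
      refine ⟨M, R, ?_⟩
      filter_upwards [ht] with z hz hzR
      have h1 : z ∈ s := hKs fun h => by
        have := mem_ball_zero_iff.1 (hR h); linarith
      have h2 := hst ⟨h1, hz⟩
      simpa [div_eq_mul_inv] using h2
  refine ⟨hzero.mono fun z hz => sub_eq_zero.1 hz, ?_⟩
  obtain ⟨c, hc⟩ := ae_eq_const_of_weakGradient_zero hw hzero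
  exact ⟨c, hc.mono fun z hz => by linarith⟩

end

/-! ### The divergence theorem for fields that jump across circles. -/

/-- The divergence of a plane vector field with derivative `L`. -/
noncomputable def divergence (L : ℂ →L[ℝ] ℂ) : ℝ := (L 1).re + (L Complex.I).im

/-- The trace does not depend on the orthonormal basis; the radial and angular directions will be
used. -/
theorem divergence_rotate (L : ℂ →L[ℝ] ℂ) {e : ℂ} (he : ‖e‖ = 1) :
    inner ℝ (L e) e + inner ℝ (L (Complex.I * e)) (Complex.I * e) = divergence L := by
  have h : e.re ^ 2 + e.im ^ 2 = 1 := by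
    have := Complex.sq_norm e
    rw [he, Complex.normSq_apply] at this; nlinarith
  have h1 : L e = e.re • L 1 + e.im • L Complex.I := by
    rw [← map_smul, ← map_smul, ← map_add]; congr 1
    apply Complex.ext <;> simp
  have h2 : L (Complex.I * e) = -e.im • L 1 + e.re • L Complex.I := by
    rw [← map_smul, ← map_smul, ← map_add]; congr 1
    apply Complex.ext <;> simp
  rw [h1, h2]
  simp only [Complex.inner, divergence]
  simp
  linear_combination ((L 1).re + (L Complex.I).im) * h

theorem continuous_divergence : Continuous divergence := by
  unfold divergence; fun_prop

theorem ContDiffAt.continuousAt_fderiv_one {X : ℂ → ℂ} {z : ℂ} (h : ContDiffAt ℝ 1 X z) :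
    ContinuousAt (fderiv ℝ X) z :=
  (h.fderiv_right (m := 0) (by simp)).continuousAt

/-- With `e` the radial unit vector, `∂_r (r X·e) + ∂_θ (X·ie) = r div X`, so the divergence theorem
on a rectangle in `(r, θ)` applies. The sides `θ = ±π` cancel by periodicity. The inner radius may
be `0`, which covers disks. -/
theorem integral_divergence_annulus {X : ℂ → ℂ} {c : ℂ} {a b : ℝ} (ha : 0 ≤ a) (hab : a ≤ b)
    (hX : ∀ z, a ≤ ‖z - c‖ → ‖z - c‖ ≤ b → ContDiffAt ℝ 1 X z) :
    ∫ z in {z : ℂ | a < ‖z - c‖ ∧ ‖z - c‖ < b}, divergence (fderiv ℝ X z) =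
      (∫ θ in -Real.pi..Real.pi,
        b * inner ℝ (X (c + b * Complex.exp (θ * Complex.I))) (Complex.exp (θ * Complex.I))) -
      ∫ θ in -Real.pi..Real.pi,
        a * inner ℝ (X (c + a * Complex.exp (θ * Complex.I))) (Complex.exp (θ * Complex.I)) := by
  set e : ℝ → ℂ := fun θ => Complex.exp (θ * Complex.I) with he
  set P : ℝ × ℝ → ℂ := fun p => c + p.1 * e p.2 with hP
  have hen : ∀ θ, ‖e θ‖ = 1 := fun θ => Complex.norm_exp_ofReal_mul_I θ
  have hPn : ∀ p : ℝ × ℝ, ‖P p - c‖ = |p.1| := fun p => by simp [hP, hen]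
  have hec : Continuous e := by fun_prop
  have hPc : Continuous P := by fun_prop
  let lo : ℝ × ℝ := (a, -Real.pi)
  let hi : ℝ × ℝ := (b, Real.pi)
  have hle : lo ≤ hi := Prod.mk_le_mk.2 ⟨hab, by linarith [Real.pi_pos]⟩
  have hmem : ∀ p ∈ Icc lo hi, ContDiffAt ℝ 1 X (P p) := fun p hp => by
    have h1 : a ≤ p.1 := hp.1.1
    have h2 : p.1 ≤ b := hp.2.1
    refine hX _ ?_ ?_ <;> rw [hPn, abs_of_nonneg (ha.trans h1)] <;> assumption
  have hed : ∀ p : ℝ × ℝ, HasFDerivAt (fun p : ℝ × ℝ => e p.2)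
      ((ContinuousLinearMap.snd ℝ ℝ ℝ).smulRight (Complex.I * e p.2)) p := fun p => by
    have h1 : HasDerivAt e (Complex.I * e p.2) p.2 := by
      have := ((hasDerivAt_id (p.2 : ℂ)).mul_const Complex.I).cexp.comp_ofReal
      refine this.congr_deriv ?_
      simp only [he, id]; ring
    refine (h1.hasFDerivAt.comp p hasFDerivAt_snd).congr_fderiv ?_
    ext <;> simp
  have hPd : ∀ p : ℝ × ℝ, HasFDerivAt P
      ((ContinuousLinearMap.fst ℝ ℝ ℝ).smulRight (e p.2) +
        (ContinuousLinearMap.snd ℝ ℝ ℝ).smulRight ((p.1 : ℂ) * (Complex.I * e p.2))) p := fun p => by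
    have h1 : HasFDerivAt (fun p : ℝ × ℝ => p.1 • e p.2) _ p := hasFDerivAt_fst.smul (hed p)
    have h2 : HasFDerivAt P _ p := h1.const_add c
    refine h2.congr_fderiv ?_
    ext <;> simp
  set Y : ℝ × ℝ → ℂ →L[ℝ] ℂ := fun p => fderiv ℝ X (P p) with hY
  have hXd : ∀ p ∈ Icc lo hi, HasFDerivAt (fun p => X (P p)) ((Y p).comp
      ((ContinuousLinearMap.fst ℝ ℝ ℝ).smulRight (e p.2) +
        (ContinuousLinearMap.snd ℝ ℝ ℝ).smulRight ((p.1 : ℂ) * (Complex.I * e p.2)))) p :=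
    fun p hp => (((hmem p hp).differentiableAt (by simp)).hasFDerivAt).comp p (hPd p)
  set f : ℝ × ℝ → ℝ := fun p => p.1 * inner ℝ (X (P p)) (e p.2) with hfdef
  set g : ℝ × ℝ → ℝ := fun p => inner ℝ (X (P p)) (Complex.I * e p.2) with hgdef
  have hf := fun p hp => hasFDerivAt_fst.mul ((hXd p hp).inner ℝ (hed p))
  have hg := fun p hp => (hXd p hp).inner ℝ ((hed p).const_mul Complex.I)
  have hsub : Ioo lo.1 hi.1 ×ˢ Ioo lo.2 hi.2 ⊆ Icc lo hi := fun p hp =>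
    ⟨⟨hp.1.1.le, hp.2.1.le⟩, ⟨hp.1.2.le, hp.2.2.le⟩⟩
  have hval : ∀ p ∈ Icc lo hi, fderiv ℝ f p (1, 0) + fderiv ℝ g p (0, 1) = p.1 * divergence (Y p) := by
    intro p hp
    have h1 : fderiv ℝ f p = _ := (hf p hp).fderiv
    have h2 : fderiv ℝ g p = _ := (hg p hp).fderiv
    have h3 : Complex.I * (Complex.I * e p.2) = -e p.2 := by
      rw [← mul_assoc, Complex.I_mul_I]; ring
    have h4 : Y p ((p.1 : ℂ) * (Complex.I * e p.2)) = p.1 • Y p (Complex.I * e p.2) := by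
      rw [← map_smul, Complex.real_smul]
    rw [h1, h2, ← divergence_rotate (Y p) (hen p.2)]
    simp only [_root_.add_apply, _root_.smul_apply, ContinuousLinearMap.comp_apply,
      fderivInnerCLM_apply, ContinuousLinearMap.prod_apply, ContinuousLinearMap.smulRight_apply,
      ContinuousLinearMap.coe_fst', ContinuousLinearMap.coe_snd', zero_smul, one_smul, add_zero,
      zero_add, smul_eq_mul, inner_zero_right, h3, inner_neg_right, mul_one]
    rw [h4, real_inner_smul_left]
    ring
  have hYc : ContinuousOn Y (Icc lo hi) := fun p hp =>
    ((hmem p hp).continuousAt_fderiv_one.comp hPc.continuousAt).continuousWithinAt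
  have hdc : ContinuousOn (fun p : ℝ × ℝ => p.1 * divergence (Y p)) (Icc lo hi) :=
    continuousOn_fst.mul (continuous_divergence.comp_continuousOn hYc)
  have hexp := integral_divergence_prod_Icc_of_hasFDerivAt_of_le
    f g (fderiv ℝ f) (fderiv ℝ g) lo hi hle
    (fun p hp => (hf p hp).continuousAt.continuousWithinAt)
    (fun p hp => (hg p hp).continuousAt.continuousWithinAt)
    (fun p hp => (hf p (hsub hp)).differentiableAt.hasFDerivAt)
    (fun p hp => (hg p (hsub hp)).differentiableAt.hasFDerivAt)
    ((hdc.congr hval).integrableOn_compact isCompact_Icc)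
  have hper : ∀ x : ℝ, g (x, Real.pi) = g (x, -Real.pi) := fun x => by
    have : e Real.pi = e (-Real.pi) := by
      simp only [he, Complex.ofReal_neg, neg_mul, Complex.exp_pi_mul_I, Complex.exp_neg]; norm_num
    simp only [hgdef, hP, this]
  have hg0 : (∫ x in lo.1..hi.1, g (x, hi.2)) - ∫ x in lo.1..hi.1, g (x, lo.2) = 0 := by
    simp only [lo, hi, hper, sub_self]
  rw [hg0, zero_add, setIntegral_congr_fun measurableSet_Icc hval] at hexp
  refine Eq.trans ?_ hexp
  set A : Set ℂ := {z : ℂ | a < ‖z - c‖ ∧ ‖z - c‖ < b} with hA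
  have hAm : MeasurableSet A :=
    ((isOpen_lt (f := fun _ => a) (g := fun z => ‖z - c‖) continuous_const (by fun_prop)).and
      (isOpen_lt (f := fun z => ‖z - c‖) (g := fun _ => b) (by fun_prop)
        continuous_const)).measurableSet
  rw [← integral_indicator hAm,
    ← integral_add_left_eq_self (μ := volume) (A.indicator fun z => divergence (fderiv ℝ X z)) c,
    ← Complex.integral_comp_polarCoord_symm]
  have hPs : ∀ p : ℝ × ℝ, c + Complex.polarCoord.symm p = P p := fun p => by
    simp only [Complex.polarCoord_symm_apply, hP, he, Complex.exp_mul_I, Complex.ofReal_cos,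
      Complex.ofReal_sin]
  have hst : Ioo a b ×ˢ Ioo (-Real.pi) Real.pi ⊆ polarCoord.target := fun p hp =>
    ⟨lt_of_le_of_lt ha hp.1.1, hp.2⟩
  have h1 : ∫ p in polarCoord.target, p.1 • A.indicator (fun z => divergence (fderiv ℝ X z))
      (c + Complex.polarCoord.symm p)
      = ∫ p in Ioo a b ×ˢ Ioo (-Real.pi) Real.pi, p.1 * divergence (Y p) := by
    rw [← integral_indicator (polarCoord.open_target.measurableSet),
      ← integral_indicator (measurableSet_Ioo.prod measurableSet_Ioo)]
    congr 1
    ext1 p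
    by_cases hp : p ∈ polarCoord.target
    · rw [indicator_of_mem hp, hPs]
      have hp0 : 0 < p.1 := hp.1
      by_cases hpA : P p ∈ A
      · have h2 := hpA
        rw [hA, mem_ofPred_eq, hPn, abs_of_pos hp0] at h2
        rw [indicator_of_mem hpA, indicator_of_mem (show p ∈ Ioo a b ×ˢ Ioo (-Real.pi) Real.pi from ⟨h2, hp.2⟩), smul_eq_mul]
      · have h2 : p ∉ Ioo a b ×ˢ Ioo (-Real.pi) Real.pi := fun h => hpA (by
          rw [hA, mem_ofPred_eq, hPn, abs_of_pos hp0]; exact h.1)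
        rw [indicator_of_notMem hpA, indicator_of_notMem h2, smul_zero]
    · rw [indicator_of_notMem hp, indicator_of_notMem fun h => hp (hst h)]
  rw [h1]
  refine setIntegral_congr_set ?_
  rw [show Icc lo hi = Icc a b ×ˢ Icc (-Real.pi) Real.pi from Icc_prod_eq _ _]
  exact Measure.set_prod_ae_eq Ioo_ae_eq_Icc Ioo_ae_eq_Icc

theorem measurableSet_annulus (c : ℂ) (a b : ℝ) :
    MeasurableSet {z : ℂ | a < ‖z - c‖ ∧ ‖z - c‖ < b} :=
  ((isOpen_lt (f := fun _ => a) (g := fun z => ‖z - c‖) continuous_const (by fun_prop)).and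
    (isOpen_lt (f := fun z => ‖z - c‖) (g := fun _ => b) (by fun_prop)
      continuous_const)).measurableSet

theorem integrableOn_divergence {X : ℂ → ℂ} {s : Set ℂ} (hs : IsCompact s)
    (hX : ∀ z ∈ s, ContDiffAt ℝ 1 X z) :
    IntegrableOn (fun z => divergence (fderiv ℝ X z)) s :=
  (continuous_divergence.comp_continuousOn fun z hz =>
    (hX z hz).continuousAt_fderiv_one.continuousWithinAt).integrableOn_compact hs

/-- The divergence theorem for a field with a jump across a circle but continuous flux. -/
theorem integral_divergence_two_phase {X₁ X₂ : ℂ → ℂ} {c : ℂ} {r R : ℝ} (hr : 0 < r) (hR : r < R)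
    (h₁ : ∀ z, ‖z - c‖ ≤ r → ContDiffAt ℝ 1 X₁ z)
    (h₂ : ∀ z, r ≤ ‖z - c‖ → ‖z - c‖ ≤ R → ContDiffAt ℝ 1 X₂ z)
    (hflux : ∀ z, ‖z - c‖ = r → inner ℝ (X₁ z) (z - c) = inner ℝ (X₂ z) (z - c))
    (hend : ∀ z, ‖z - c‖ = R → X₂ z = 0) {Q : ℂ → ℝ}
    (hQ₁ : ∀ z, ‖z - c‖ < r → Q z = divergence (fderiv ℝ X₁ z))
    (hQ₂ : ∀ z, r < ‖z - c‖ → ‖z - c‖ < R → Q z = divergence (fderiv ℝ X₂ z))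
    (hQ₃ : ∀ z, R < ‖z - c‖ → Q z = 0) :
    Integrable Q ∧ ∫ z, Q z = 0 := by
  have hnull : ∀ ρ : ℝ, ρ ≠ 0 → ∀ᵐ z : ℂ, ‖z - c‖ ≠ ρ := fun ρ hρ => by
    have := Measure.addHaar_sphere_of_ne_zero (volume : Measure ℂ) c hρ
    rw [ae_iff]
    convert this using 2
    ext z; simp
  have hn0 : ∀ᵐ z : ℂ, ‖z - c‖ ≠ 0 := by
    rw [ae_iff]
    convert measure_singleton (μ := (volume : Measure ℂ)) c using 2
    ext z; simp [sub_eq_zero]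
  -- The disk without its centre is the annulus with inner radius `0`.
  set A : Set ℂ := {z : ℂ | 0 < ‖z - c‖ ∧ ‖z - c‖ < r} with hA
  set B : Set ℂ := {z : ℂ | r < ‖z - c‖ ∧ ‖z - c‖ < R} with hB
  have hAm : MeasurableSet A := measurableSet_annulus c 0 r
  have hBm : MeasurableSet B := measurableSet_annulus c r R
  have i1 : IntegrableOn (fun z => divergence (fderiv ℝ X₁ z)) A :=
    (integrableOn_divergence (isCompact_closedBall c r) fun z hz =>
      h₁ z (by simpa [dist_eq_norm] using hz)).mono_set fun z hz => by
        rw [hA, mem_ofPred_eq] at hz; simpa [dist_eq_norm] using hz.2.le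
  have i2 : IntegrableOn (fun z => divergence (fderiv ℝ X₂ z)) B := by
    refine (integrableOn_divergence (s := Metric.closedBall c R \ Metric.ball c r)
      ((isCompact_closedBall c R).diff Metric.isOpen_ball) fun z hz => ?_).mono_set fun z hz => ?_
    · simp only [Set.mem_sdiff, Metric.mem_closedBall, dist_eq_norm, Metric.mem_ball, not_lt] at hz
      exact h₂ z hz.2 hz.1
    · rw [hB, mem_ofPred_eq] at hz
      simp only [Set.mem_sdiff, Metric.mem_closedBall, dist_eq_norm, Metric.mem_ball, not_lt]
      exact ⟨hz.2.le, hz.1.le⟩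
  have hae : Q =ᵐ[volume] fun z => A.indicator (fun z => divergence (fderiv ℝ X₁ z)) z +
      B.indicator (fun z => divergence (fderiv ℝ X₂ z)) z := by
    filter_upwards [hnull r hr.ne', hnull R (hr.trans hR).ne', hn0] with z h1 h2 h3
    have h3' : 0 < ‖z - c‖ := lt_of_le_of_ne (norm_nonneg _) (Ne.symm h3)
    rcases lt_or_gt_of_ne h1 with h | h
    · rw [indicator_of_mem (show z ∈ A from ⟨h3', h⟩),
        indicator_of_notMem (fun hz : z ∈ B => by rw [hB, mem_ofPred_eq] at hz; linarith [hz.1]),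
        add_zero, hQ₁ z h]
    · rw [indicator_of_notMem (fun hz : z ∈ A => by rw [hA, mem_ofPred_eq] at hz; linarith [hz.2]),
        zero_add]
      rcases lt_or_gt_of_ne h2 with h' | h'
      · rw [indicator_of_mem (show z ∈ B from ⟨h, h'⟩), hQ₂ z h h']
      · rw [indicator_of_notMem (fun hz : z ∈ B => by rw [hB, mem_ofPred_eq] at hz; linarith [hz.2]),
          hQ₃ z h']
  have j1 := i1.integrable_indicator hAm
  have j2 := i2.integrable_indicator hBm
  refine ⟨(j1.add j2).congr hae.symm, ?_⟩
  rw [integral_congr_ae hae, integral_add j1 j2, integral_indicator hAm, integral_indicator hBm,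
    integral_divergence_annulus le_rfl hr.le (fun z _ h => h₁ z h),
    integral_divergence_annulus hr.le hR.le h₂]
  have e1 : ∀ (ρ θ : ℝ), c + ρ * Complex.exp (θ * Complex.I) - c = ρ * Complex.exp (θ * Complex.I) :=
    fun _ _ => by ring
  have e2 : ∀ θ : ℝ, X₂ (c + R * Complex.exp (θ * Complex.I)) = 0 := fun θ => hend _ (by
    rw [e1, norm_mul, Complex.norm_exp_ofReal_mul_I, mul_one, Complex.norm_real, Real.norm_of_nonneg
      (hr.trans hR).le])
  have e3 : ∀ θ : ℝ, r * inner ℝ (X₁ (c + r * Complex.exp (θ * Complex.I)))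
      (Complex.exp (θ * Complex.I)) = r * inner ℝ (X₂ (c + r * Complex.exp (θ * Complex.I)))
      (Complex.exp (θ * Complex.I)) := fun θ => by
    have := hflux (c + r * Complex.exp (θ * Complex.I)) (by
      rw [e1, norm_mul, Complex.norm_exp_ofReal_mul_I, mul_one, Complex.norm_real,
        Real.norm_of_nonneg hr.le])
    rw [e1, ← Complex.real_smul, real_inner_smul_right, real_inner_smul_right] at this
    exact this
  simp only [e2, e3, inner_zero_left, mul_zero, zero_mul, intervalIntegral.integral_zero]
  ring

theorem fderiv_smul_field {φ : ℂ → ℝ} {V : ℂ → ℂ} {z : ℂ} (hφ : DifferentiableAt ℝ φ z)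
    (hV : DifferentiableAt ℝ V z) :
    divergence (fderiv ℝ (fun z => φ z • V z) z) =
      inner ℝ (V z) (∇ φ z) + φ z * divergence (fderiv ℝ V z) := by
  have h1 : ∀ y, fderiv ℝ φ z y = inner ℝ (∇ φ z) y := fun y => by rw [inner_gradient_left]
  rw [fderiv_fun_smul hφ hV]
  simp only [divergence, _root_.add_apply, _root_.smul_apply, ContinuousLinearMap.smulRight_apply, h1,
    Complex.inner]
  simp
  ring

/-- The weak divergence of a piecewise `C¹` field on the core, shell and exterior of two nested
disks, with continuous flux across both circles. -/
theorem integral_piecewise_field {c₁ c₂ : ℂ} {r₁ r₂ : ℝ} (hr₁ : 0 < r₁)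
    (hnest : ‖c₁ - c₂‖ + r₁ < r₂) {V V₁ V₂ V₃ : ℂ → ℂ} {D : ℂ → ℝ}
    (h₁ : ∀ z, ‖z - c₁‖ ≤ r₁ → ContDiffAt ℝ 1 V₁ z)
    (h₂ : ∀ z, r₁ ≤ ‖z - c₁‖ → ‖z - c₂‖ ≤ r₂ → ContDiffAt ℝ 1 V₂ z)
    (h₃ : ∀ z, r₂ ≤ ‖z - c₂‖ → ContDiffAt ℝ 1 V₃ z)
    (hf₁ : ∀ z, ‖z - c₁‖ = r₁ → inner ℝ (V₁ z) (z - c₁) = inner ℝ (V₂ z) (z - c₁))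
    (hf₂ : ∀ z, ‖z - c₂‖ = r₂ → inner ℝ (V₂ z) (z - c₂) = inner ℝ (V₃ z) (z - c₂))
    (hV₁ : ∀ z, ‖z - c₁‖ < r₁ → V z = V₁ z ∧ D z = divergence (fderiv ℝ V₁ z))
    (hV₂ : ∀ z, r₁ < ‖z - c₁‖ → ‖z - c₂‖ < r₂ → V z = V₂ z ∧ D z = divergence (fderiv ℝ V₂ z))
    (hV₃ : ∀ z, r₂ < ‖z - c₂‖ → V z = V₃ z ∧ D z = divergence (fderiv ℝ V₃ z))
    {φ : ℂ → ℝ} (hφ : ContDiff ℝ ∞ φ) (hφc : HasCompactSupport φ) :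
    ∫ z, (inner ℝ (V z) (∇ φ z) + φ z * D z) = 0 := by
  -- A third of the gap between the circles: the disk of radius `r₁ + 2δ` about `c₁` stays inside
  -- the outer one, so the cutoff splits `φ` into a piece that sees only the inner circle and a
  -- piece that sees only the outer one.
  set δ := (r₂ - r₁ - ‖c₁ - c₂‖) / 3 with hδ
  have hδ0 : 0 < δ := by rw [hδ]; linarith
  have hin : ∀ z : ℂ, ‖z - c₁‖ ≤ r₁ + 2 * δ → ‖z - c₂‖ < r₂ := fun z hz => by
    have := norm_add_le (z - c₁) (c₁ - c₂)
    rw [sub_add_sub_cancel] at this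
    linarith
  let χ : ContDiffBump c₁ := ⟨r₁ + δ, r₁ + 2 * δ, by linarith, by linarith⟩
  have hχ : ContDiff ℝ ∞ χ := χ.contDiff
  have hχ1 : ∀ z, ‖z - c₁‖ ≤ r₁ + δ → χ z = 1 := fun z hz => χ.one_of_mem_closedBall (by
    simpa [dist_eq_norm] using hz)
  have hχ0 : ∀ z, r₁ + 2 * δ ≤ ‖z - c₁‖ → χ z = 0 := fun z hz => χ.zero_of_le_dist (by
    simpa [dist_eq_norm] using hz)
  set φ₁ : ℂ → ℝ := fun z => χ z * φ z with hφ₁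
  set φ₂ : ℂ → ℝ := fun z => (1 - χ z) * φ z with hφ₂
  have hφ₁d : ContDiff ℝ ∞ φ₁ := hχ.mul hφ
  have hφ₂d : ContDiff ℝ ∞ φ₂ := (contDiff_const.sub hχ).mul hφ
  have hsum : ∀ z, ∇ φ z = ∇ φ₁ z + ∇ φ₂ z := fun z => by
    have h := (contDiff_hasGradientAt hφ₁d z).differentiableAt.hasFDerivAt.add
      (contDiff_hasGradientAt hφ₂d z).differentiableAt.hasFDerivAt
    have e : φ₁ + φ₂ = φ := by ext z; simp only [Pi.add_apply, hφ₁, hφ₂]; ring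
    rw [e] at h
    refine (hasGradientAt_of_hasFDerivAt h fun y => ?_).gradient
    rw [_root_.add_apply, inner_add_left, inner_gradient_left, inner_gradient_left]
  have hc1 : ∀ (ψ : ℂ → ℝ), ContDiff ℝ ∞ ψ → ∀ z, ContDiffAt ℝ 1 ψ z := fun ψ h z =>
    (h.of_le (by exact_mod_cast le_top)).contDiffAt
  have hgz : ∀ {ψ : ℂ → ℝ} {z : ℂ}, ψ =ᶠ[𝓝 z] (fun _ => 0) → ∇ ψ z = 0 ∧ ψ z = 0 := fun {ψ z} h =>
    ⟨((hasGradientAt_const z (0 : ℝ)).congr_of_eventuallyEq h).gradient, h.self_of_nhds⟩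
  have hn1 : Continuous fun z : ℂ => ‖z - c₁‖ := by fun_prop
  have hn2 : Continuous fun z : ℂ => ‖z - c₂‖ := by fun_prop
  have hφ₁0 : ∀ z, r₁ + 2 * δ < ‖z - c₁‖ → φ₁ =ᶠ[𝓝 z] fun _ => 0 := fun z hz => by
    filter_upwards [(isOpen_lt continuous_const hn1).mem_nhds hz] with y hy
    simp [hφ₁, hχ0 y (le_of_lt hy)]
  have hφ₂0 : ∀ z, ‖z - c₁‖ < r₁ + δ → φ₂ =ᶠ[𝓝 z] fun _ => 0 := fun z hz => by
    filter_upwards [(isOpen_lt hn1 continuous_const).mem_nhds hz] with y hy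
    simp [hφ₂, hχ1 y (le_of_lt hy)]
  have hdiv : ∀ {ψ : ℂ → ℝ} {W : ℂ → ℂ} {z : ℂ}, ContDiff ℝ ∞ ψ → ContDiffAt ℝ 1 W z →
      V z = W z ∧ D z = divergence (fderiv ℝ W z) →
      inner ℝ (V z) (∇ ψ z) + ψ z * D z = divergence (fderiv ℝ (fun z => ψ z • W z) z) :=
    fun {ψ W z} hψ hW h => by
      rw [fderiv_smul_field (contDiff_hasGradientAt hψ z).differentiableAt
        (hW.differentiableAt (by simp)), h.1, h.2]
  obtain ⟨i1, e1⟩ := integral_divergence_two_phase (X₁ := fun z => φ₁ z • V₁ z)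
    (X₂ := fun z => φ₁ z • V₂ z) (c := c₁) (r := r₁) (R := r₁ + 2 * δ)
    (Q := fun z => inner ℝ (V z) (∇ φ₁ z) + φ₁ z * D z) hr₁ (by linarith)
    (fun z hz => (hc1 _ hφ₁d z).smul (h₁ z hz))
    (fun z hz hz' => (hc1 _ hφ₁d z).smul (h₂ z hz (hin z hz').le))
    (fun z hz => by rw [real_inner_smul_left, real_inner_smul_left, hf₁ z hz])
    (fun z hz => by simp [hφ₁, hχ0 z hz.ge])
    (fun z hz => hdiv hφ₁d (h₁ z hz.le) (hV₁ z hz))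
    (fun z hz hz' => hdiv hφ₁d (h₂ z hz.le (hin z hz'.le).le) (hV₂ z hz (hin z hz'.le)))
    (fun z hz => by rw [(hgz (hφ₁0 z hz)).1, (hgz (hφ₁0 z hz)).2, inner_zero_right]; simp)
  obtain ⟨R, hR⟩ := hφc.isCompact.isBounded.subset_ball c₂
  set R' := max R (r₂ + 1) with hR'
  have hφR : ∀ z, R' ≤ ‖z - c₂‖ → φ₂ =ᶠ[𝓝 z] fun _ => 0 := fun z hz => by
    have h : z ∉ tsupport φ := fun h => by
      have := hR h
      rw [Metric.mem_ball, dist_eq_norm] at this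
      linarith [le_max_left R (r₂ + 1)]
    filter_upwards [notMem_tsupport_iff_eventuallyEq.1 h] with y hy
    simp [hφ₂, hy]
  have hr₂ : 0 < r₂ := by linarith [norm_nonneg (c₁ - c₂)]
  -- `V₂` need not be regular in the core, but `φ₂` vanishes there.
  have hX₁ : ∀ z, ‖z - c₂‖ ≤ r₂ → ContDiffAt ℝ 1 (fun z => φ₂ z • V₂ z) z := fun z hz => by
    by_cases h : ‖z - c₁‖ < r₁ + δ
    · refine (contDiffAt_const (c := (0 : ℂ))).congr_of_eventuallyEq ?_
      filter_upwards [hφ₂0 z h] with y hy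
      rw [hy, zero_smul]
    · push Not at h
      exact (hc1 _ hφ₂d z).smul (h₂ z (by linarith) hz)
  obtain ⟨i2, e2⟩ := integral_divergence_two_phase (X₁ := fun z => φ₂ z • V₂ z)
    (X₂ := fun z => φ₂ z • V₃ z) (c := c₂) (r := r₂) (R := R')
    (Q := fun z => inner ℝ (V z) (∇ φ₂ z) + φ₂ z * D z) hr₂
    (by linarith [le_max_right R (r₂ + 1)]) hX₁
    (fun z hz _ => (hc1 _ hφ₂d z).smul (h₃ z hz))
    (fun z hz => by rw [real_inner_smul_left, real_inner_smul_left, hf₂ z hz])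
    (fun z hz => by rw [(hgz (hφR z hz.ge)).2, zero_smul])
    (fun z hz => by
      by_cases h : ‖z - c₁‖ < r₁ + δ
      · have e : (fun z => φ₂ z • V₂ z) =ᶠ[𝓝 z] fun _ => 0 := by
          filter_upwards [hφ₂0 z h] with y hy
          rw [hy, zero_smul]
        rw [(hgz (hφ₂0 z h)).1, (hgz (hφ₂0 z h)).2, e.fderiv_eq, inner_zero_right]
        simp [divergence]
      · push Not at h
        exact hdiv hφ₂d (h₂ z (by linarith) hz.le) (hV₂ z (by linarith) hz))
    (fun z hz _ => hdiv hφ₂d (h₃ z hz.le) (hV₃ z hz))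
    (fun z hz => by rw [(hgz (hφR z hz.le)).1, (hgz (hφR z hz.le)).2, inner_zero_right]; simp)
  have : ∀ z, inner ℝ (V z) (∇ φ z) + φ z * D z = (inner ℝ (V z) (∇ φ₁ z) + φ₁ z * D z) +
      (inner ℝ (V z) (∇ φ₂ z) + φ₂ z * D z) := fun z => by
    rw [hsum, inner_add_right]
    simp only [hφ₁, hφ₂]
    ring
  simp only [this]
  rw [integral_add i1 i2, e1, e2, add_zero]

/-! ### Weak solutions assembled from holomorphic potentials. -/

open scoped ComplexConjugate

theorem hasGradientAt_re {f : ℂ → ℂ} {f' z : ℂ} (hf : HasDerivAt f f' z) :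
    HasGradientAt (fun z => (f z).re) (conj f') z := by
  have h := Complex.reCLM.hasFDerivAt.comp z (hf.hasFDerivAt.restrictScalars ℝ)
  refine hasGradientAt_of_hasFDerivAt h fun y => ?_
  simp [Complex.inner, mul_comm]

theorem AnalyticAt.contDiffAt_real {f : ℂ → ℂ} {z : ℂ} (hf : AnalyticAt ℂ f z) :
    ContDiffAt ℝ 1 f z :=
  (hf.contDiffAt (n := 1)).restrict_scalars ℝ

theorem AnalyticAt.contDiffAt_re_smul {f : ℂ → ℂ} {z : ℂ} (hf : AnalyticAt ℂ f z) (e : ℂ) :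
    ContDiffAt ℝ 1 (fun z => (f z).re • e) z :=
  (Complex.reCLM.contDiff.contDiffAt.comp z hf.contDiffAt_real).smul contDiffAt_const

theorem AnalyticAt.divergence_re_smul {f : ℂ → ℂ} {z : ℂ} (hf : AnalyticAt ℂ f z) (e : ℂ) :
    divergence (fderiv ℝ (fun z => (f z).re • e) z) = inner ℝ e (conj (deriv f z)) := by
  have h := hasGradientAt_re hf.differentiableAt.hasDerivAt
  rw [fderiv_smul_field (φ := fun z => (f z).re) (V := fun _ => e) h.differentiableAt
    (differentiableAt_const _), h.gradient]
  simp [divergence]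

theorem AnalyticAt.contDiffAt_conj_deriv {f : ℂ → ℂ} {z : ℂ} (hf : AnalyticAt ℂ f z) (k : ℝ) :
    ContDiffAt ℝ 1 (fun z => k • conj (deriv f z)) z :=
  have h : ContDiffAt ℝ 1 (fun z => conj (deriv f z)) z :=
    Complex.conjCLE.contDiff.contDiffAt.comp z hf.deriv.contDiffAt_real
  h.const_smul k

/-- `conj f'` is the gradient of the harmonic function `Re f`; concretely, the real-linear map `w ↦
conj (f'' w)` has trace zero. -/
theorem AnalyticAt.divergence_conj_deriv {f : ℂ → ℂ} {z : ℂ} (hf : AnalyticAt ℂ f z) (k : ℝ) :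
    divergence (fderiv ℝ (fun z => k • conj (deriv f z)) z) = 0 := by
  have h := (Complex.conjCLE.toContinuousLinearMap.hasFDerivAt.comp z
    (hf.deriv.differentiableAt.hasDerivAt.hasFDerivAt.restrictScalars ℝ)).const_smul k
  have h' : fderiv ℝ (fun z => k • conj (deriv f z)) z = _ := h.fderiv
  rw [h']
  simp [divergence]

theorem memLp_indicator_of_continuousOn {E : Type*} [NormedAddCommGroup E]
    {F : ℂ → E} {K : Set ℂ} (hK : IsCompact K)
    (hF : ContinuousOn F K) : MemLp (K.indicator F) 2 := by
  rw [memLp_indicator_iff_restrict hK.measurableSet]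
  have : IsFiniteMeasure ((volume : Measure ℂ).restrict K) :=
    ⟨by rw [Measure.restrict_apply_univ]; exact hK.measure_lt_top⟩
  obtain ⟨C, hC⟩ := hK.exists_bound_of_continuousOn hF
  refine MemLp.of_bound (hF.aestronglyMeasurable_of_isCompact hK hK.measurableSet) C ?_
  filter_upwards [ae_restrict_mem hK.measurableSet] with z hz using hC z hz

theorem ae_norm_sub_ne (c : ℂ) {r : ℝ} (hr : r ≠ 0) : ∀ᵐ z : ℂ, ‖z - c‖ ≠ r := by
  have := Measure.addHaar_sphere_of_ne_zero (volume : Measure ℂ) c hr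
  rw [ae_iff]
  convert this using 2
  ext z; simp

theorem memLp_of_piecewise {E : Type*} [NormedAddCommGroup E] {c₁ c₂ : ℂ} {r₁ r₂ : ℝ}
    (hr₁ : 0 < r₁) (hnest : ‖c₁ - c₂‖ + r₁ < r₂) {F F₁ F₂ F₃ : ℂ → E}
    (h₁ : ∀ z, ‖z - c₁‖ ≤ r₁ → ContinuousAt F₁ z)
    (h₂ : ∀ z, r₁ ≤ ‖z - c₁‖ → ‖z - c₂‖ ≤ r₂ → ContinuousAt F₂ z)
    (h₃ : ∀ z, r₂ ≤ ‖z - c₂‖ → ContinuousAt F₃ z)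
    (hF₁ : ∀ z, ‖z - c₁‖ < r₁ → F z = F₁ z)
    (hF₂ : ∀ z, r₁ < ‖z - c₁‖ → ‖z - c₂‖ < r₂ → F z = F₂ z)
    (hF₃ : ∀ z, r₂ < ‖z - c₂‖ → F z = F₃ z) (R : ℝ) :
    MemLp F 2 (volume.restrict (Metric.ball (0 : ℂ) R)) := by
  have hr₂ : 0 < r₂ := by linarith [norm_nonneg (c₁ - c₂)]
  have hin : ∀ z : ℂ, ‖z - c₁‖ ≤ r₁ → ‖z - c₂‖ < r₂ := fun z hz => by
    have := norm_add_le (z - c₁) (c₁ - c₂)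
    rw [sub_add_sub_cancel] at this
    linarith
  set A := Metric.closedBall c₁ r₁
  set B := Metric.closedBall c₂ r₂ \ Metric.ball c₁ r₁
  set C := Metric.closedBall (0 : ℂ) R \ Metric.ball c₂ r₂
  have mA := memLp_indicator_of_continuousOn (F := F₁) (K := A) (isCompact_closedBall _ _)
    fun z hz => (h₁ z (by simpa [A, dist_eq_norm] using hz)).continuousWithinAt
  have mB := memLp_indicator_of_continuousOn (F := F₂) (K := B)
    ((isCompact_closedBall _ _).diff Metric.isOpen_ball) fun z hz => by
      simp only [B, Set.mem_sdiff, Metric.mem_closedBall, Metric.mem_ball, dist_eq_norm, not_lt] at hz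
      exact (h₂ z hz.2 hz.1).continuousWithinAt
  have mC := memLp_indicator_of_continuousOn (F := F₃) (K := C)
    ((isCompact_closedBall _ _).diff Metric.isOpen_ball) fun z hz => by
      simp only [C, Set.mem_sdiff, Metric.mem_closedBall, Metric.mem_ball, dist_eq_norm, not_lt] at hz
      exact (h₃ z hz.2).continuousWithinAt
  refine (memLp_congr_ae ?_).1 ((mA.add (mB.add mC)).restrict (Metric.ball (0 : ℂ) R))
  filter_upwards [ae_restrict_mem Metric.isOpen_ball.measurableSet,
    ae_restrict_of_ae (ae_norm_sub_ne c₁ hr₁.ne'), ae_restrict_of_ae (ae_norm_sub_ne c₂ hr₂.ne')]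
    with z hz n1 n2
  have hzR : ‖z‖ ≤ R := (mem_ball_zero_iff.1 hz).le
  simp only [Pi.add_apply]
  rcases lt_or_gt_of_ne n1 with h | h
  · rw [indicator_of_mem (show z ∈ A by simpa [A, dist_eq_norm] using h.le),
      indicator_of_notMem (show z ∉ B by simp [B, dist_eq_norm, h]),
      indicator_of_notMem (show z ∉ C by simp [C, dist_eq_norm, hin z h.le]), hF₁ z h]
    simp
  · rw [indicator_of_notMem (show z ∉ A by simpa [A, dist_eq_norm] using h), zero_add]
    rcases lt_or_gt_of_ne n2 with h' | h'
    · rw [indicator_of_mem (show z ∈ B by simp [B, dist_eq_norm, h.le, h'.le]),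
        indicator_of_notMem (show z ∉ C by simp [C, dist_eq_norm, h']), hF₂ z h h', add_zero]
    · rw [indicator_of_notMem (show z ∉ B by simp [B, dist_eq_norm, h']),
        indicator_of_mem (show z ∈ C by simp [C, dist_eq_norm, h'.le, hzR]), hF₃ z h', zero_add]

/-- Holomorphic potentials on the core, shell and exterior that satisfy the transmission conditions
are the pieces of a solution of the conductivity problem. -/
theorem isSolution_of_potentials {c₁ c₂ : ℂ} {r₁ r₂ : ℝ} (hr₁ : 0 < r₁)
    (hnest : ‖c₁ - c₂‖ + r₁ < r₂) {f₁ f₂ f₃ : ℂ → ℂ} {k₁ k₂ k₃ : ℝ} {σ H u : ℂ → ℝ} {G : ℂ → ℂ}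
    (h₁ : ∀ z, ‖z - c₁‖ ≤ r₁ → AnalyticAt ℂ f₁ z)
    (h₂ : ∀ z, r₁ ≤ ‖z - c₁‖ → ‖z - c₂‖ ≤ r₂ → AnalyticAt ℂ f₂ z)
    (h₃ : ∀ z, r₂ ≤ ‖z - c₂‖ → AnalyticAt ℂ f₃ z)
    (hcont₁ : ∀ z, ‖z - c₁‖ = r₁ → (f₁ z).re = (f₂ z).re)
    (hcont₂ : ∀ z, ‖z - c₂‖ = r₂ → (f₂ z).re = (f₃ z).re)
    (hflux₁ : ∀ z, ‖z - c₁‖ = r₁ →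
      k₁ * ((z - c₁) * deriv f₁ z).re = k₂ * ((z - c₁) * deriv f₂ z).re)
    (hflux₂ : ∀ z, ‖z - c₂‖ = r₂ →
      k₂ * ((z - c₂) * deriv f₂ z).re = k₃ * ((z - c₂) * deriv f₃ z).re)
    (hu₁ : ∀ z, ‖z - c₁‖ < r₁ → u z = (f₁ z).re ∧ G z = conj (deriv f₁ z) ∧ σ z = k₁)
    (hu₂ : ∀ z, r₁ < ‖z - c₁‖ → ‖z - c₂‖ < r₂ →
      u z = (f₂ z).re ∧ G z = conj (deriv f₂ z) ∧ σ z = k₂)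
    (hu₃ : ∀ z, r₂ < ‖z - c₂‖ → u z = (f₃ z).re ∧ G z = conj (deriv f₃ z) ∧ σ z = k₃)
    (hdec : (fun z => u z - H z) =O[cocompact ℂ ⊓ ae volume] fun z => ‖z‖⁻¹) :
    IsSolution σ H u G := by
  have cre : ∀ {f : ℂ → ℂ} {z : ℂ}, AnalyticAt ℂ f z → ContinuousAt (fun z => (f z).re) z :=
    fun h => Complex.continuous_re.continuousAt.comp h.continuousAt
  have cder : ∀ {f : ℂ → ℂ} {z : ℂ}, AnalyticAt ℂ f z →
      ContinuousAt (fun z => conj (deriv f z)) z :=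
    fun h => Complex.continuous_conj.continuousAt.comp h.deriv.continuousAt
  have mu : ∀ R : ℝ, MemLp u 2 (volume.restrict (Metric.ball (0 : ℂ) R)) :=
    memLp_of_piecewise hr₁ hnest (fun z hz => cre (h₁ z hz)) (fun z hz hz' => cre (h₂ z hz hz'))
      (fun z hz => cre (h₃ z hz)) (fun z hz => (hu₁ z hz).1) (fun z hz hz' => (hu₂ z hz hz').1)
      (fun z hz => (hu₃ z hz).1)
  have mG : ∀ R : ℝ, MemLp G 2 (volume.restrict (Metric.ball (0 : ℂ) R)) :=
    memLp_of_piecewise hr₁ hnest (fun z hz => cder (h₁ z hz)) (fun z hz hz' => cder (h₂ z hz hz'))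
      (fun z hz => cder (h₃ z hz)) (fun z hz => (hu₁ z hz).2.1)
      (fun z hz hz' => (hu₂ z hz hz').2.1) (fun z hz => (hu₃ z hz).2.1)
  have hinner : ∀ (k : ℝ) (d w : ℂ), inner ℝ (k • conj d) w = k * (w * d).re := fun k d w => by
    rw [real_inner_smul_left, Complex.inner]; simp [mul_comm]
  refine ⟨⟨mu, mG, fun φ hφ hφc => ?_⟩, fun φ hφ hφc => ?_, hdec⟩
  · have i1 := (locallyIntegrable_of_memLp_ball mu).integrable_smul_right_of_hasCompactSupport
      (continuous_gradient hφ) (gradient_hasCompactSupport hφc)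
    have i2 := (locallyIntegrable_of_memLp_ball mG).integrable_smul_left_of_hasCompactSupport
      hφ.continuous hφc
    rw [eq_neg_iff_add_eq_zero, ← integral_add i1 i2]
    -- Paired with a constant vector `e`, the defining identity of the weak gradient concerns the
    -- field `u e`, whose divergence is `⟨e, G⟩` in each phase and whose flux is continuous because
    -- the real parts match.
    refine ext_inner_left ℝ fun e => ?_
    have i3 : Integrable fun z => u z • ∇ φ z + φ z • G z := i1.add i2
    rw [← integral_inner i3, inner_zero_right]
    have key := integral_piecewise_field hr₁ hnest (V := fun z => u z • e)
      (D := fun z => inner ℝ e (G z)) (V₁ := fun z => (f₁ z).re • e) (V₂ := fun z => (f₂ z).re • e)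
      (V₃ := fun z => (f₃ z).re • e)
      (fun z hz => (h₁ z hz).contDiffAt_re_smul e) (fun z hz hz' => (h₂ z hz hz').contDiffAt_re_smul e)
      (fun z hz => (h₃ z hz).contDiffAt_re_smul e)
      (fun z hz => by rw [hcont₁ z hz]) (fun z hz => by rw [hcont₂ z hz])
      (fun z hz => ⟨by rw [(hu₁ z hz).1], by
        rw [(hu₁ z hz).2.1, (h₁ z hz.le).divergence_re_smul]⟩)
      (fun z hz hz' => ⟨by rw [(hu₂ z hz hz').1], by
        rw [(hu₂ z hz hz').2.1, (h₂ z hz.le hz'.le).divergence_re_smul]⟩)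
      (fun z hz => ⟨by rw [(hu₃ z hz).1], by
        rw [(hu₃ z hz).2.1, (h₃ z hz.le).divergence_re_smul]⟩) hφ hφc
    rw [← key]
    congr 1; ext1 z
    rw [inner_add_right, real_inner_smul_left, real_inner_smul_right, real_inner_smul_right]
  -- Here the field is `σ G`, divergence-free in each phase; its flux through a circle is `k Re((z -
  -- c) f')` up to the radius.
  · have key := integral_piecewise_field hr₁ hnest (V := fun z => σ z • G z)
      (D := fun z => 0) (V₁ := fun z => k₁ • conj (deriv f₁ z)) (V₂ := fun z => k₂ • conj (deriv f₂ z))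
      (V₃ := fun z => k₃ • conj (deriv f₃ z))
      (fun z hz => (h₁ z hz).contDiffAt_conj_deriv k₁)
      (fun z hz hz' => (h₂ z hz hz').contDiffAt_conj_deriv k₂)
      (fun z hz => (h₃ z hz).contDiffAt_conj_deriv k₃)
      (fun z hz => by rw [hinner, hinner, hflux₁ z hz])
      (fun z hz => by rw [hinner, hinner, hflux₂ z hz])
      (fun z hz => ⟨by rw [(hu₁ z hz).2.1, (hu₁ z hz).2.2],
        ((h₁ z hz.le).divergence_conj_deriv k₁).symm⟩)
      (fun z hz hz' => ⟨by rw [(hu₂ z hz hz').2.1, (hu₂ z hz hz').2.2],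
        ((h₂ z hz.le hz'.le).divergence_conj_deriv k₂).symm⟩)
      (fun z hz => ⟨by rw [(hu₃ z hz).2.1, (hu₃ z hz).2.2],
        ((h₃ z hz.le).divergence_conj_deriv k₃).symm⟩) hφ hφc
    rw [← key]
    congr 1; ext1 z
    rw [real_inner_smul_left, mul_zero, add_zero]

/-! ### The Möbius maps that fix `±α`. -/

/-- Denominator of the Möbius map `orbit α q`. -/
noncomputable def orbitDenom (α q : ℝ) (z : ℂ) : ℂ := (1 - q) * z + (1 + q) * α

/-- The Möbius map with fixed points `±α` and multiplier `q` at `α`. -/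
noncomputable def orbit (α q : ℝ) (z : ℂ) : ℂ := α * ((1 + q) * z + (1 - q) * α) / orbitDenom α q z

section Orbit

variable {α q : ℝ} {z : ℂ}

theorem le_re_orbitDenom (hq : q ≤ 1) (hz : 0 ≤ z.re) :
    (1 + q) * α ≤ (orbitDenom α q z).re := by
  have : (orbitDenom α q z).re = (1 - q) * z.re + (1 + q) * α := by simp [orbitDenom]
  rw [this]; nlinarith

theorem mul_le_norm_orbitDenom (hq : q ≤ 1) (hz : 0 ≤ z.re) :
    (1 + q) * α ≤ ‖orbitDenom α q z‖ :=
  (le_re_orbitDenom hq hz).trans (Complex.re_le_norm _)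

theorem le_norm_orbitDenom (hα : 0 < α) (hq0 : 0 ≤ q) (hq : q ≤ 1) (hz : 0 ≤ z.re) :
    α ≤ ‖orbitDenom α q z‖ :=
  le_trans (by nlinarith) (mul_le_norm_orbitDenom hq hz)

theorem orbitDenom_ne_zero (hα : 0 < α) (hq0 : 0 ≤ q) (hq : q ≤ 1) (hz : 0 ≤ z.re) :
    orbitDenom α q z ≠ 0 :=
  norm_pos_iff.1 (hα.trans_le (le_norm_orbitDenom hα hq0 hq hz))

theorem mul_norm_le_norm_orbitDenom (hα : 0 < α) (hq0 : 0 ≤ q) (hq : q ≤ 1) (hz : 0 ≤ z.re) :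
    (1 - q) * ‖z‖ ≤ ‖orbitDenom α q z‖ := by
  refine le_of_sq_le_sq ?_ (norm_nonneg _)
  rw [mul_pow, Complex.sq_norm, Complex.sq_norm, Complex.normSq_apply, Complex.normSq_apply]
  have h1 : (orbitDenom α q z).re = (1 - q) * z.re + (1 + q) * α := by simp [orbitDenom]
  have h2 : (orbitDenom α q z).im = (1 - q) * z.im := by simp [orbitDenom]
  rw [h1, h2]
  have h3 : 0 ≤ (1 - q) * z.re := mul_nonneg (by linarith) hz
  have h4 : 0 ≤ (1 + q) * α := by positivity
  nlinarith [mul_nonneg h3 h4]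

/-- The modulus dominates each of `(1 - q)‖z‖`, `(1 - q)α` and `α`. The combined bound is affine in
`q`, so its inverse powers have explicit antiderivatives. -/
theorem le_three_mul_norm_orbitDenom (hα : 0 < α) (hq0 : 0 ≤ q) (hq : q ≤ 1) (hz : 0 ≤ z.re) :
    (1 - q) * (‖z‖ + α) + α ≤ 3 * ‖orbitDenom α q z‖ := by
  have h1 := mul_norm_le_norm_orbitDenom hα hq0 hq hz
  have h2 := le_norm_orbitDenom hα hq0 hq hz
  nlinarith

theorem norm_orbit_numerator_le (hq0 : 0 ≤ q) (hq : q ≤ 1) (hα : 0 < α) :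
    ‖(1 + q) * z + (1 - q) * (α : ℂ)‖ ≤ (1 + q) * (‖z‖ + α) := by
  have h1 : ‖(1 + (q : ℂ)) * z‖ = (1 + q) * ‖z‖ := by
    rw [norm_mul, ← Complex.ofReal_one, ← Complex.ofReal_add, Complex.norm_real,
      Real.norm_of_nonneg (by linarith)]
  have h2 : ‖(1 - (q : ℂ)) * α‖ = (1 - q) * α := by
    rw [← Complex.ofReal_one, ← Complex.ofReal_sub, ← Complex.ofReal_mul, Complex.norm_real,
      Real.norm_of_nonneg (mul_nonneg (by linarith) hα.le)]
  refine (norm_add_le _ _).trans ?_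
  rw [h1, h2]
  nlinarith

theorem norm_orbit_le (hα : 0 < α) (hq0 : 0 ≤ q) (hq : q ≤ 1) (hz : 0 ≤ z.re) :
    ‖orbit α q z‖ ≤ ‖z‖ + α := by
  have h1 := mul_le_norm_orbitDenom (α := α) hq hz
  have h2 := norm_orbit_numerator_le (z := z) hq0 hq hα
  have h3 : 0 < ‖orbitDenom α q z‖ := hα.trans_le (le_norm_orbitDenom hα hq0 hq hz)
  rw [orbit, norm_div, norm_mul, Complex.norm_real, Real.norm_of_nonneg hα.le, div_le_iff₀ h3]
  calc α * ‖(1 + q) * z + (1 - q) * (α : ℂ)‖ ≤ α * ((1 + q) * (‖z‖ + α)) := by gcongr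
    _ = (‖z‖ + α) * ((1 + q) * α) := by ring
    _ ≤ _ := by gcongr

theorem norm_orbit_le' (hα : 0 < α) (hq0 : 0 ≤ q) (hq : q ≤ 1) :
    ‖orbit α q z‖ ≤ 2 * α * (‖z‖ + α) / ‖orbitDenom α q z‖ := by
  have h2 := norm_orbit_numerator_le (z := z) hq0 hq hα
  rw [orbit, norm_div, norm_mul, Complex.norm_real, Real.norm_of_nonneg hα.le]
  have : 0 ≤ ‖z‖ + α := by positivity
  gcongr ?_ / _
  calc α * ‖(1 + q) * z + (1 - q) * (α : ℂ)‖ ≤ α * ((1 + q) * (‖z‖ + α)) := by gcongr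
    _ ≤ α * ((1 + 1) * (‖z‖ + α)) := by gcongr
    _ = _ := by ring

/-- In the coordinate `(z - α)/(z + α)` the right half plane is the unit disk and the map is
multiplication by `q ≤ 1`; the proof verifies this by clearing the denominator. -/
theorem re_orbit_pos (hα : 0 < α) (hq0 : 0 ≤ q) (hq : q ≤ 1) (hz : 0 < z.re) :
    0 < (orbit α q z).re := by
  have hN := orbitDenom_ne_zero hα hq0 hq hz.le
  have h1 : orbit α q z = ((α * Complex.normSq (orbitDenom α q z)⁻¹ : ℝ) : ℂ) *
      (((1 + q) * z + (1 - q) * α) * conj (orbitDenom α q z)) := by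
    rw [orbit, Complex.ofReal_mul, ← Complex.mul_conj, map_inv₀]
    have : conj (orbitDenom α q z) ≠ 0 := (map_ne_zero _).2 hN
    field_simp
  rw [h1, Complex.re_ofReal_mul]
  refine mul_pos (mul_pos hα (Complex.normSq_pos.2 (inv_ne_zero hN))) ?_
  have h2 : (((1 + q) * z + (1 - q) * α) * conj (orbitDenom α q z)).re =
      (1 - q ^ 2) * (z.re ^ 2 + z.im ^ 2) + ((1 + q) ^ 2 + (1 - q) ^ 2) * α * z.re +
        (1 - q ^ 2) * α ^ 2 := by
    simp [orbitDenom]; ring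
  rw [h2]
  have h3 : 0 ≤ 1 - q ^ 2 := by nlinarith
  positivity

theorem hasDerivAt_orbit (hN : orbitDenom α q z ≠ 0) :
    HasDerivAt (orbit α q) (4 * α ^ 2 * q / orbitDenom α q z ^ 2) z := by
  have h1 : HasDerivAt (fun z : ℂ => α * ((1 + q) * z + (1 - q) * (α : ℂ))) (α * (1 + q)) z := by
    simpa using ((((hasDerivAt_id z).const_mul (1 + (q : ℂ))).add_const ((1 - q) * (α : ℂ))).const_mul
      (α : ℂ))
  have h2 : HasDerivAt (orbitDenom α q) ((1 - q) * 1) z :=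
    ((hasDerivAt_id z).const_mul (1 - (q : ℂ))).add_const ((1 + q) * (α : ℂ))
  refine (h1.div h2 hN).congr_deriv ?_
  congr 1
  rw [orbitDenom]; ring

theorem hasDerivAt_orbitDenom_param : HasDerivAt (fun q : ℝ => orbitDenom α q z) (α - z) q := by
  have h0 : HasDerivAt (fun q : ℝ => (q : ℂ)) 1 q := Complex.ofRealCLM.hasDerivAt
  have := ((h0.const_sub 1).mul_const z).add ((h0.const_add 1).mul_const (α : ℂ))
  refine this.congr_deriv ?_
  ring

theorem hasDerivAt_orbit_param (hN : orbitDenom α q z ≠ 0) :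
    HasDerivAt (fun q : ℝ => orbit α q z) (2 * α * (z ^ 2 - α ^ 2) / orbitDenom α q z ^ 2) q := by
  have h0 : HasDerivAt (fun q : ℝ => (q : ℂ)) 1 q := Complex.ofRealCLM.hasDerivAt
  have h1 := (((h0.const_add 1).mul_const z).add ((h0.const_sub 1).mul_const (α : ℂ))).const_mul (α : ℂ)
  refine (h1.div hasDerivAt_orbitDenom_param hN).congr_deriv ?_
  congr 1
  simp only [Pi.add_apply, orbitDenom]; ring

/-- In the coordinate `(z - α)/(z + α)` both maps are multiplications. -/
theorem orbit_orbit {q' : ℝ} (hα : 0 < α) (hq0 : 0 ≤ q) (hq : q ≤ 1) (hq0' : 0 ≤ q') (hq' : q' ≤ 1)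
    (hz : 0 < z.re) : orbit α q (orbit α q' z) = orbit α (q * q') z := by
  have h1 := orbitDenom_ne_zero hα hq0' hq' hz.le
  have h2 := orbitDenom_ne_zero hα hq0 hq (re_orbit_pos hα hq0' hq' hz).le
  have h3 := orbitDenom_ne_zero hα (mul_nonneg hq0 hq0')
    (mul_le_one₀ hq hq0' hq') hz.le
  have hα' : (α : ℂ) ≠ 0 := Complex.ofReal_ne_zero.2 hα.ne'
  have e1 : orbitDenom α q (orbit α q' z) = 2 * α * orbitDenom α (q * q') z / orbitDenom α q' z := by
    rw [eq_div_iff h1]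
    conv_lhs => rw [orbitDenom, add_mul, mul_assoc, orbit, div_mul_cancel₀ _ h1]
    simp only [orbitDenom, Complex.ofReal_mul]; ring
  have e2 : (1 + q) * orbit α q' z + (1 - q) * α =
      2 * α * ((1 + (q * q' : ℝ)) * z + (1 - (q * q' : ℝ)) * α) / orbitDenom α q' z := by
    rw [eq_div_iff h1]
    conv_lhs => rw [add_mul, mul_assoc, orbit, div_mul_cancel₀ _ h1]
    simp only [orbitDenom, Complex.ofReal_mul]; ring
  rw [orbit, e1, e2, orbit]
  field_simp

theorem orbit_one (hα : 0 < α) : orbit α 1 z = z := by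
  have hα' : (α : ℂ) ≠ 0 := Complex.ofReal_ne_zero.2 hα.ne'
  simp only [orbit, orbitDenom, Complex.ofReal_one]
  field_simp
  ring

end Orbit

/-! ### Variation along an orbit -/

/-- `z`-derivative of `h ∘ orbit α q` when `h' = h₁`. -/
noncomputable def orbitTerm (h₁ : ℂ → ℂ) (α : ℝ) (z : ℂ) (q : ℝ) : ℂ :=
  h₁ (orbit α q z) * (4 * α ^ 2 * q / orbitDenom α q z ^ 2)

/-- A monotone function dominating the variation of `orbitTerm` in `q`. -/
noncomputable def orbitBound (M₁ M₂ α p q : ℝ) : ℝ :=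
  4 * M₁ * q + (M₁ + M₂ * p) * (108 * α ^ 2 / ((1 - q) * p + α) ^ 2)

section Variation

variable {α q M₁ M₂ : ℝ} {z : ℂ} {h₁ h₂ : ℂ → ℂ}

theorem hasDerivAt_inv_sq (hα : 0 < α) {p : ℝ} (hp : 0 < p) (hq : q ≤ 1) :
    HasDerivAt (fun q : ℝ => 108 * α ^ 2 / ((1 - q) * p + α) ^ 2)
      (216 * α ^ 2 * p / ((1 - q) * p + α) ^ 3) q := by
  have hn : 0 < (1 - q) * p + α := by nlinarith [mul_nonneg (sub_nonneg.2 hq) hp.le]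
  have h1 : HasDerivAt (fun q : ℝ => (1 - q) * p + α) (-p) q := by
    simpa using (((hasDerivAt_id q).const_sub 1).mul_const p).add_const α
  refine ((h1.pow 2).inv (pow_pos hn 2).ne' |>.const_mul (108 * α ^ 2) |>.congr_deriv ?_).congr_of_eventuallyEq
    (.of_forall fun q => by simp [div_eq_mul_inv])
  simp only [Pi.pow_apply]
  field_simp
  ring

theorem norm_div_orbitDenom_cube_le (hα : 0 < α) (hq0 : 0 ≤ q) (hq : q ≤ 1) (hz : 0 ≤ z.re) :
    8 * α ^ 2 * (‖z‖ + α) / ‖orbitDenom α q z‖ ^ 3 ≤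
      216 * α ^ 2 * (‖z‖ + α) / ((1 - q) * (‖z‖ + α) + α) ^ 3 := by
  have h := le_three_mul_norm_orbitDenom hα hq0 hq hz
  have hp : 0 < ‖z‖ + α := by positivity
  have hn : 0 < (1 - q) * (‖z‖ + α) + α := by nlinarith [mul_nonneg (sub_nonneg.2 hq) hp.le]
  have hN : 0 < ‖orbitDenom α q z‖ := hα.trans_le (le_norm_orbitDenom hα hq0 hq hz)
  rw [div_le_div_iff₀ (pow_pos hN 3) (pow_pos hn 3)]
  have h3 : ((1 - q) * (‖z‖ + α) + α) ^ 3 ≤ (3 * ‖orbitDenom α q z‖) ^ 3 := by gcongr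
  have h4 : 0 ≤ 8 * α ^ 2 * (‖z‖ + α) := by positivity
  nlinarith [mul_le_mul_of_nonneg_left h3 h4]

theorem norm_kernel_le (hα : 0 < α) (hq0 : 0 ≤ q) (hq : q ≤ 1) (hz : 0 ≤ z.re) :
    ‖4 * (α : ℂ) ^ 2 / orbitDenom α q z ^ 2‖ ≤ 4 := by
  have hN := le_norm_orbitDenom hα hq0 hq hz
  rw [norm_div, norm_mul, norm_pow, norm_pow, Complex.norm_real, Real.norm_of_nonneg hα.le,
    div_le_iff₀ (pow_pos (hα.trans_le hN) 2)]
  simp only [Complex.norm_ofNat]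
  gcongr

theorem norm_orbitTerm_le (hα : 0 < α) (hq0 : 0 ≤ q) (hq : q ≤ 1) (hz : 0 ≤ z.re)
    (hM₁ : ∀ w, ‖w‖ ≤ ‖z‖ + α → ‖h₁ w‖ ≤ M₁) : ‖orbitTerm h₁ α z q‖ ≤ 4 * M₁ := by
  have h1 := hM₁ _ (norm_orbit_le hα hq0 hq hz)
  have h2 := norm_kernel_le hα hq0 hq hz
  have h0 : 0 ≤ M₁ := (norm_nonneg _).trans h1
  have e : orbitTerm h₁ α z q = h₁ (orbit α q z) * ((4 * (α : ℂ) ^ 2 / orbitDenom α q z ^ 2) * q) := by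
    rw [orbitTerm]; ring
  rw [e, norm_mul, norm_mul, Complex.norm_real, Real.norm_of_nonneg hq0]
  calc _ ≤ M₁ * (4 * 1) := by gcongr
    _ = _ := by ring

/-- The `q`-derivative of the term is of size `4 M₁ + (M₁ + M₂ p) α² p / |N|³`, up to constants,
with `p = ‖z‖ + α` and `N` the denominator; by `le_three_mul_norm_orbitDenom` it is dominated by the
derivative of `orbitBound`. What matters is that `orbitBound` at `q = 1` is controlled by `M₁`, `M₂`
and `p` alone, although `α → 0` as the circles approach each other. -/
theorem norm_orbitTerm_sub_le (hα : 0 < α) (hz : 0 ≤ z.re)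
    (hd : ∀ w, HasDerivAt h₁ (h₂ w) w)
    (hM₁ : ∀ w, ‖w‖ ≤ ‖z‖ + α → ‖h₁ w‖ ≤ M₁) (hM₂ : ∀ w, ‖w‖ ≤ ‖z‖ + α → ‖h₂ w‖ ≤ M₂)
    {q' : ℝ} (hq0 : 0 ≤ q') (hqq : q' ≤ q) (hq : q ≤ 1) :
    ‖orbitTerm h₁ α z q - orbitTerm h₁ α z q'‖ ≤
      orbitBound M₁ M₂ α (‖z‖ + α) q - orbitBound M₁ M₂ α (‖z‖ + α) q' := by
  set p := ‖z‖ + α with hp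
  have hp0 : 0 < p := by positivity
  have hM₁0 : 0 ≤ M₁ := (norm_nonneg _).trans (hM₁ 0 (by simpa using hp0.le))
  have hM₂0 : 0 ≤ M₂ := (norm_nonneg _).trans (hM₂ 0 (by simpa using hp0.le))
  set D : ℝ → ℂ := fun q => h₂ (orbit α q z) * (2 * α * (z ^ 2 - α ^ 2) / orbitDenom α q z ^ 2) *
      (4 * α ^ 2 * q / orbitDenom α q z ^ 2) + h₁ (orbit α q z) *
      (4 * α ^ 2 / orbitDenom α q z ^ 2 - 8 * α ^ 2 * q * (α - z) / orbitDenom α q z ^ 3) with hD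
  have hder : ∀ q, 0 ≤ q → q ≤ 1 → HasDerivAt (orbitTerm h₁ α z) (D q) q := by
    intro q hq0 hq
    have hN := orbitDenom_ne_zero hα hq0 hq hz
    have d1 : HasDerivAt (fun q : ℝ => h₁ (orbit α q z))
        (h₂ (orbit α q z) * (2 * α * (z ^ 2 - α ^ 2) / orbitDenom α q z ^ 2)) q :=
      (hd _).comp_of_eq q (hasDerivAt_orbit_param hN) rfl
    have h0 : HasDerivAt (fun q : ℝ => (q : ℂ)) 1 q := Complex.ofRealCLM.hasDerivAt
    have d2 := (h0.const_mul (4 * (α : ℂ) ^ 2)).div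
      ((hasDerivAt_orbitDenom_param (α := α) (q := q) (z := z)).pow 2) (pow_ne_zero 2 hN)
    refine (d1.mul d2).congr_deriv ?_
    simp only [hD, Pi.pow_apply]
    congr 2
    field_simp
    ring
  have hbd : ∀ q, q ≤ 1 → HasDerivAt (orbitBound M₁ M₂ α p)
      (4 * M₁ + (M₁ + M₂ * p) * (216 * α ^ 2 * p / ((1 - q) * p + α) ^ 3)) q := fun q hq => by
    have h1 : HasDerivAt (fun q : ℝ => 4 * M₁ * q) (4 * M₁) q := by
      simpa using (hasDerivAt_id q).const_mul (4 * M₁)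
    exact h1.add ((hasDerivAt_inv_sq hα hp0 hq).const_mul _)
  have hbound : ∀ q, 0 ≤ q → q ≤ 1 → ‖D q‖ ≤
      4 * M₁ + (M₁ + M₂ * p) * (216 * α ^ 2 * p / ((1 - q) * p + α) ^ 3) := by
    intro q hq0 hq
    have hN := le_norm_orbitDenom hα hq0 hq hz
    have hN0 : 0 < ‖orbitDenom α q z‖ := hα.trans_le hN
    have b1 := hM₁ _ (norm_orbit_le hα hq0 hq hz)
    have b2 := hM₂ _ (norm_orbit_le hα hq0 hq hz)
    have b3 := norm_div_orbitDenom_cube_le hα hq0 hq hz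
    have b4 := norm_kernel_le hα hq0 hq hz
    have b5 : ‖z ^ 2 - (α : ℂ) ^ 2‖ ≤ p ^ 2 := by
      refine (norm_sub_le _ _).trans ?_
      rw [norm_pow, norm_pow, Complex.norm_real, Real.norm_of_nonneg hα.le, hp]
      nlinarith [norm_nonneg z]
    have b6 : ‖(α : ℂ) - z‖ ≤ p := by
      refine (norm_sub_le _ _).trans ?_
      rw [Complex.norm_real, Real.norm_of_nonneg hα.le, hp, add_comm]
    -- A factor `α / |N| ≤ 1` is discarded, so that both contributions take the form `α² p / |N|³`.
    have c1 : ‖h₂ (orbit α q z) * (2 * α * (z ^ 2 - α ^ 2) / orbitDenom α q z ^ 2) *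
      (4 * α ^ 2 * q / orbitDenom α q z ^ 2)‖ ≤ M₂ * p * (8 * α ^ 2 * p / ‖orbitDenom α q z‖ ^ 3) := by
      simp only [norm_mul, norm_div, norm_pow, Complex.norm_real, Real.norm_of_nonneg hα.le,
        Real.norm_of_nonneg hq0, Complex.norm_ofNat]
      calc _ ≤ M₂ * (2 * α * p ^ 2 / ‖orbitDenom α q z‖ ^ 2) *
            (4 * α ^ 2 * 1 / ‖orbitDenom α q z‖ ^ 2) := by gcongr
        _ = M₂ * p * (8 * α ^ 2 * p / ‖orbitDenom α q z‖ ^ 3) * (α / ‖orbitDenom α q z‖) := by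
          field_simp; ring
        _ ≤ M₂ * p * (8 * α ^ 2 * p / ‖orbitDenom α q z‖ ^ 3) * 1 := by
          gcongr; exact div_le_one_of_le₀ hN hN0.le
        _ = _ := mul_one _
    have c2 : ‖8 * (α : ℂ) ^ 2 * q * (α - z) / orbitDenom α q z ^ 3‖ ≤
        8 * α ^ 2 * p / ‖orbitDenom α q z‖ ^ 3 := by
      simp only [norm_mul, norm_div, norm_pow, Complex.norm_real, Real.norm_of_nonneg hα.le,
        Real.norm_of_nonneg hq0, Complex.norm_ofNat]
      calc _ ≤ 8 * α ^ 2 * 1 * p / ‖orbitDenom α q z‖ ^ 3 := by gcongr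
        _ = _ := by ring
    have c3 : ‖h₁ (orbit α q z) * (4 * (α : ℂ) ^ 2 / orbitDenom α q z ^ 2 -
        8 * α ^ 2 * q * (α - z) / orbitDenom α q z ^ 3)‖ ≤
        M₁ * (4 + 8 * α ^ 2 * p / ‖orbitDenom α q z‖ ^ 3) := by
      rw [norm_mul]
      refine mul_le_mul b1 ?_ (norm_nonneg _) hM₁0
      exact (norm_sub_le _ _).trans (add_le_add b4 c2)
    refine (norm_add_le _ _).trans ((add_le_add c1 c3).trans ?_)
    have h5 := mul_le_mul_of_nonneg_left b3 (by positivity : 0 ≤ M₁ + M₂ * p)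
    linarith
  have := image_norm_le_of_norm_deriv_right_le_deriv_boundary'
    (f := fun x => orbitTerm h₁ α z x - orbitTerm h₁ α z q') (f' := D) (a := q') (b := q)
    (B := fun x => orbitBound M₁ M₂ α p x - orbitBound M₁ M₂ α p q')
    (B' := fun q => 4 * M₁ + (M₁ + M₂ * p) * (216 * α ^ 2 * p / ((1 - q) * p + α) ^ 3))
    (fun x hx => ((hder x (hq0.trans hx.1) (hx.2.trans hq)).continuousAt.sub
      continuousAt_const).continuousWithinAt)
    (fun x hx => ((hder x (hq0.trans hx.1) (hx.2.le.trans hq)).sub_const _).hasDerivWithinAt)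
    (by simp)
    (fun x hx => ((hbd x (hx.2.trans hq)).sub_const _).continuousAt.continuousWithinAt)
    (fun x hx => ((hbd x (hx.2.le.trans hq)).sub_const _).hasDerivWithinAt)
    (fun x hx => hbound x (hq0.trans hx.1) (hx.2.le.trans hq))
  exact this ⟨hqq, le_rfl⟩

theorem orbitBound_nonneg {p : ℝ} (hM₁ : 0 ≤ M₁) (hM₂ : 0 ≤ M₂) (hp : 0 ≤ p) (hq : 0 ≤ q) :
    0 ≤ orbitBound M₁ M₂ α p q := by
  unfold orbitBound; positivity

theorem orbitBound_one (hα : 0 < α) {p : ℝ} :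
    orbitBound M₁ M₂ α p 1 = 4 * M₁ + (M₁ + M₂ * p) * 108 := by
  unfold orbitBound
  have : α ≠ 0 := hα.ne'
  rw [sub_self, zero_mul, zero_add, mul_div_assoc, div_self (pow_ne_zero 2 this)]
  ring

end Variation

/-! ### Abel summation and comparison of geometric samples with an integral. -/

/-- Summation by parts for power series with coefficients of bounded variation. -/
theorem norm_one_sub_mul_tsum_le {τ : ℝ} (hτ : |τ| < 1) {g : ℕ → ℂ} {ψ : ℕ → ℝ} {M : ℝ}
    (hM : ∀ n, ‖g n‖ ≤ M) (hg : ∀ n, ‖g (n + 1) - g n‖ ≤ ψ n - ψ (n + 1)) (hψ : ∀ n, 0 ≤ ψ n) :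
    Summable (fun n => (τ : ℂ) ^ n * g n) ∧
      (1 - τ) * ‖∑' n, (τ : ℂ) ^ n * g n‖ ≤ M + ψ 0 := by
  have hτn : ‖(τ : ℂ)‖ = |τ| := by rw [Complex.norm_real, Real.norm_eq_abs]
  have hs : Summable (fun n => (τ : ℂ) ^ n * g n) := by
    refine Summable.of_norm_bounded ((summable_geometric_of_lt_one (abs_nonneg τ) hτ).mul_right M)
      fun n => ?_
    rw [norm_mul, norm_pow, hτn]
    gcongr
    exact hM n
  refine ⟨hs, ?_⟩
  have hd : ∀ N, ∑ n ∈ Finset.range N, ‖g (n + 1) - g n‖ ≤ ψ 0 := fun N => by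
    calc _ ≤ ∑ n ∈ Finset.range N, (ψ n - ψ (n + 1)) := Finset.sum_le_sum fun n _ => hg n
      _ = ψ 0 - ψ N := Finset.sum_range_sub' ψ N
      _ ≤ ψ 0 := by linarith [hψ N]
  have hds : Summable fun n => ‖g (n + 1) - g n‖ :=
    summable_of_sum_range_le (fun _ => norm_nonneg _) hd
  have hs1 : Summable (fun n => (τ : ℂ) ^ (n + 1) * g (n + 1)) := (summable_nat_add_iff 1).2 hs
  -- The factor `1 - τ` absorbs the growth of the series as `τ → 1`; what remains is controlled by
  -- the total variation of `g`.
  have e1 : (1 - (τ : ℂ)) * ∑' n, (τ : ℂ) ^ n * g n =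
      g 0 + ∑' n, (τ : ℂ) ^ (n + 1) * (g (n + 1) - g n) := by
    have e2 : ∑' n, (τ : ℂ) ^ (n + 1) * (g (n + 1) - g n) =
        (∑' n, (τ : ℂ) ^ (n + 1) * g (n + 1)) - τ * ∑' n, (τ : ℂ) ^ n * g n := by
      rw [← tsum_mul_left, ← hs1.tsum_sub (hs.mul_left _)]
      congr 1; ext n; ring
    have e3 := hs.tsum_eq_zero_add
    rw [e2]
    linear_combination e3
  have hb : ‖∑' n, (τ : ℂ) ^ (n + 1) * (g (n + 1) - g n)‖ ≤ ψ 0 := by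
    refine (tsum_of_norm_bounded hds.hasSum fun n => ?_).trans
      (hds.tsum_le_of_sum_range_le hd)
    rw [norm_mul, norm_pow, hτn]
    exact mul_le_of_le_one_left (norm_nonneg _) (pow_le_one₀ (abs_nonneg _) hτ.le)
  have h1 : (1 - τ) * ‖∑' n, (τ : ℂ) ^ n * g n‖ = ‖(1 - (τ : ℂ)) * ∑' n, (τ : ℂ) ^ n * g n‖ := by
    rw [norm_mul, ← Complex.ofReal_one, ← Complex.ofReal_sub, Complex.norm_real,
      Real.norm_of_nonneg (by linarith [(abs_lt.1 hτ).2])]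
  rw [h1, e1]
  refine (norm_add_le _ _).trans (add_le_add (hM 0) hb)

/-- Comparison of a sum over a geometric progression with an integral. -/
theorem norm_tsum_sub_integral_le {l L : ℝ} (hl0 : 0 < l) (hl1 : l < 1) (hL : L = -Real.log l)
    {F : ℝ → ℂ} (hF : ContinuousOn F (Icc 0 1)) {ψ : ℝ → ℝ} (hψ0 : ∀ q, 0 ≤ q → q ≤ 1 → 0 ≤ ψ q)
    (hψ : ∀ q' q, 0 < q' → q' ≤ q → q ≤ 1 → ‖q * F q - q' * F q'‖ ≤ ψ q - ψ q')
    (hs : Summable fun n : ℕ => ((l ^ n : ℝ) : ℂ) * F (l ^ n)) :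
    ‖(∑' n : ℕ, ((l ^ n : ℝ) : ℂ) * F (l ^ n)) - (1 / L : ℝ) * ∫ q in (0 : ℝ)..1, F q‖ ≤ ψ 1 := by
  have hL0 : 0 < L := by rw [hL]; linarith [Real.log_neg hl0 hl1]
  have hint : ∀ a b : ℝ, 0 ≤ a → a ≤ 1 → 0 ≤ b → b ≤ 1 → IntervalIntegrable F volume a b :=
    fun a b ha ha' hb hb' => (hF.mono (by
      intro x hx
      rcases le_total a b with h | h
      · rw [uIcc_of_le h] at hx; exact ⟨ha.trans hx.1, hx.2.trans hb'⟩
      · rw [uIcc_of_ge h] at hx; exact ⟨hb.trans hx.1, hx.2.trans ha'⟩)).intervalIntegrable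
  have hp0 : ∀ n : ℕ, 0 < l ^ n := fun n => pow_pos hl0 n
  have hp1 : ∀ n : ℕ, l ^ n ≤ 1 := fun n => pow_le_one₀ hl0.le hl1.le
  have hps : ∀ n : ℕ, l ^ (n + 1) ≤ l ^ n := fun n => pow_le_pow_of_le_one hl0.le hl1.le (by omega)
  -- On each cell `∫ dq/q = L`, so the `n`-th term is itself `1/L` times an integral. The error is
  -- at most the variation of `q F(q)` on the cell, and these variations telescope.
  have hcell : ∀ n : ℕ, ‖((l ^ n : ℝ) : ℂ) * F (l ^ n) -
      (1 / L : ℝ) * ∫ q in (l ^ (n + 1))..(l ^ n), F q‖ ≤ ψ (l ^ n) - ψ (l ^ (n + 1)) := by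
    intro n
    have hinv : ∫ q in (l ^ (n + 1))..(l ^ n), q⁻¹ = L := by
      rw [integral_inv_of_pos (hp0 _) (hp0 _), pow_succ, div_mul_cancel_left₀ (hp0 n).ne',
        Real.log_inv, hL]
    have hii : IntervalIntegrable (fun q : ℝ => q⁻¹) volume (l ^ (n + 1)) (l ^ n) := by
      refine (continuousOn_inv₀.mono fun x hx => ?_).intervalIntegrable
      rw [uIcc_of_le (hps n)] at hx
      exact ((hp0 (n + 1)).trans_le hx.1).ne'
    have hiic : IntervalIntegrable (fun q : ℝ => ((q⁻¹ : ℝ) : ℂ) * (((l ^ n : ℝ) : ℂ) * F (l ^ n)))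
        volume (l ^ (n + 1)) (l ^ n) := IntervalIntegrable.mul_const ⟨hii.1.ofReal, hii.2.ofReal⟩ _
    have e : ((l ^ n : ℝ) : ℂ) * F (l ^ n) - (1 / L : ℝ) * ∫ q in (l ^ (n + 1))..(l ^ n), F q =
        (1 / L : ℝ) * ∫ q in (l ^ (n + 1))..(l ^ n),
          (((q⁻¹ : ℝ) : ℂ) * (((l ^ n : ℝ) : ℂ) * F (l ^ n)) - F q) := by
      rw [intervalIntegral.integral_sub hiic (hint _ _ (hp0 _).le (hp1 _) (hp0 _).le (hp1 _)),
        intervalIntegral.integral_mul_const, intervalIntegral.integral_ofReal, hinv, mul_sub,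
        ← mul_assoc, ← Complex.ofReal_mul, one_div_mul_cancel hL0.ne', Complex.ofReal_one, one_mul]
    rw [e, norm_mul, Complex.norm_real, Real.norm_of_nonneg (by positivity)]
    have hle : ‖∫ q in (l ^ (n + 1))..(l ^ n),
          (((q⁻¹ : ℝ) : ℂ) * (((l ^ n : ℝ) : ℂ) * F (l ^ n)) - F q)‖ ≤
        ∫ q in (l ^ (n + 1))..(l ^ n), q⁻¹ * (ψ (l ^ n) - ψ (l ^ (n + 1))) := by
      refine intervalIntegral.norm_integral_le_of_norm_le (hps n) (.of_forall fun q hq => ?_)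
        (hii.mul_const _)
      have hq0 : 0 < q := (hp0 _).trans hq.1
      have h1 := hψ q (l ^ n) hq0 hq.2 (hp1 n)
      have h2 := hψ (l ^ (n + 1)) q (hp0 _) hq.1.le (hq.2.trans (hp1 n))
      have h3 : 0 ≤ ψ q - ψ (l ^ (n + 1)) := (norm_nonneg _).trans h2
      have e2 : ((q⁻¹ : ℝ) : ℂ) * (((l ^ n : ℝ) : ℂ) * F (l ^ n)) - F q =
          ((q⁻¹ : ℝ) : ℂ) * (((l ^ n : ℝ) : ℂ) * F (l ^ n) - q * F q) := by
        rw [mul_sub, ← mul_assoc _ (q : ℂ), ← Complex.ofReal_mul, inv_mul_cancel₀ hq0.ne',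
          Complex.ofReal_one, one_mul]
      rw [e2, norm_mul, Complex.norm_real, Real.norm_of_nonneg (inv_nonneg.2 hq0.le)]
      gcongr
      linarith
    rw [intervalIntegral.integral_mul_const, hinv] at hle
    calc _ ≤ 1 / L * (L * (ψ (l ^ n) - ψ (l ^ (n + 1)))) := by gcongr
      _ = _ := by field_simp
  have hpart : ∀ N : ℕ, ‖(∑ n ∈ Finset.range N, ((l ^ n : ℝ) : ℂ) * F (l ^ n)) -
      (1 / L : ℝ) * ∫ q in (l ^ N)..1, F q‖ ≤ ψ 1 := by
    intro N
    have h1 : ∫ q in (l ^ N)..1, F q = ∑ n ∈ Finset.range N, ∫ q in (l ^ (n + 1))..(l ^ n), F q := by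
      have := intervalIntegral.sum_integral_adjacent_intervals (f := F) (μ := volume)
        (a := fun n => l ^ n) (n := N)
        (fun k _ => hint _ _ (hp0 _).le (hp1 _) (hp0 _).le (hp1 _))
      simp only [pow_zero] at this
      rw [intervalIntegral.integral_symm, ← this, ← Finset.sum_neg_distrib]
      exact Finset.sum_congr rfl fun n _ => by rw [intervalIntegral.integral_symm, neg_neg]
    rw [h1, Finset.mul_sum, ← Finset.sum_sub_distrib]
    refine (norm_sum_le _ _).trans ((Finset.sum_le_sum fun n _ => hcell n).trans ?_)
    rw [Finset.sum_range_sub' (fun n => ψ (l ^ n)), pow_zero]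
    linarith [hψ0 (l ^ N) (hp0 N).le (hp1 N)]
  have hlim : Tendsto (fun N : ℕ => ∫ q in (l ^ N)..1, F q) atTop (𝓝 (∫ q in (0 : ℝ)..1, F q)) := by
    have hc : ContinuousOn (fun x => ∫ q in x..1, F q) (Icc 0 1) := by
      have := intervalIntegral.continuousOn_primitive_interval_left (f := F) (μ := volume) (a := 0)
        (b := 1) ((hF.mono (by simp)).integrableOn_compact isCompact_uIcc)
      simpa using this
    have h0 : Tendsto (fun N : ℕ => l ^ N) atTop (𝓝[Icc 0 1] 0) :=
      tendsto_nhdsWithin_iff.2 ⟨tendsto_pow_atTop_nhds_zero_of_lt_one hl0.le hl1,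
        .of_forall fun n => ⟨(hp0 n).le, hp1 n⟩⟩
    exact (hc 0 (by simp)).tendsto.comp h0
  exact le_of_tendsto ((hs.hasSum.tendsto_sum_nat.sub (hlim.const_mul _)).norm) (.of_forall hpart)

theorem integral_rpow_zero_one {b : ℝ} (hb : 0 ≤ b) :
    ∫ q in (0 : ℝ)..1, q ^ b = 1 / (b + 1) := by
  rw [integral_rpow (Or.inl (by linarith)), Real.one_rpow, Real.zero_rpow (by linarith), sub_zero]

theorem continuous_rpow_const' {b : ℝ} (hb : 0 ≤ b) : Continuous fun q : ℝ => q ^ b :=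
  Real.continuous_rpow_const hb

/-- On `(0, 1]` the power `q ^ b` decreases in `b`, so the integrand has constant sign before the
absolute value is taken. -/
theorem integral_abs_rpow_sub_rpow_le {b c : ℝ} (hb : 0 ≤ b) (hc : 0 ≤ c) :
    ∫ q in (0 : ℝ)..1, |q ^ b - q ^ c| = |1 / (b + 1) - 1 / (c + 1)| := by
  wlog h : b ≤ c generalizing b c
  · have := this hc hb (le_of_not_ge h)
    rw [abs_sub_comm (1 / (b + 1)), ← this]
    exact intervalIntegral.integral_congr fun q _ => abs_sub_comm _ _
  have e : ∫ q in (0 : ℝ)..1, |q ^ b - q ^ c| = ∫ q in (0 : ℝ)..1, (q ^ b - q ^ c) := by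
    refine intervalIntegral.integral_congr_ae ?_
    refine .of_forall fun q hq => ?_
    rw [uIoc_of_le zero_le_one] at hq
    exact abs_of_nonneg (sub_nonneg.2 (Real.rpow_le_rpow_of_exponent_ge hq.1 hq.2 h))
  rw [e, intervalIntegral.integral_sub ((continuous_rpow_const' hb).intervalIntegrable _ _)
    ((continuous_rpow_const' hc).intervalIntegrable _ _), integral_rpow_zero_one hb,
    integral_rpow_zero_one hc, abs_of_nonneg]
  rw [sub_nonneg]
  gcongr

/-! ### Series along an orbit: uniform bound and limiting integral. -/

section Sums

variable {α l M₁ M₂ : ℝ} {z : ℂ} {h₁ h₂ : ℂ → ℂ}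

/-- The points `lⁿ` decrease from `1`, so the total variation of the terms is at most `orbitBound`
at `q = 1`, and Abel summation applies. -/
theorem orbitTerm_sum_le (hα : 0 < α) (hz : 0 ≤ z.re) (hd : ∀ w, HasDerivAt h₁ (h₂ w) w)
    (hM₁ : ∀ w, ‖w‖ ≤ ‖z‖ + α → ‖h₁ w‖ ≤ M₁) (hM₂ : ∀ w, ‖w‖ ≤ ‖z‖ + α → ‖h₂ w‖ ≤ M₂)
    (hl0 : 0 < l) (hl1 : l < 1) {τ : ℝ} (hτ : |τ| < 1) :
    Summable (fun n : ℕ => (τ : ℂ) ^ n * orbitTerm h₁ α z (l ^ n)) ∧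
      (1 - τ) * ‖∑' n : ℕ, (τ : ℂ) ^ n * orbitTerm h₁ α z (l ^ n)‖ ≤
        8 * M₁ + (M₁ + M₂ * (‖z‖ + α)) * 108 := by
  have hM₁0 : 0 ≤ M₁ := (norm_nonneg _).trans (hM₁ 0 (by simp; positivity))
  have hM₂0 : 0 ≤ M₂ := (norm_nonneg _).trans (hM₂ 0 (by simp; positivity))
  have hp0 : ∀ n : ℕ, 0 ≤ l ^ n := fun n => pow_nonneg hl0.le n
  have hp1 : ∀ n : ℕ, l ^ n ≤ 1 := fun n => pow_le_one₀ hl0.le hl1.le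
  have := norm_one_sub_mul_tsum_le hτ (g := fun n => orbitTerm h₁ α z (l ^ n))
    (ψ := fun n => orbitBound M₁ M₂ α (‖z‖ + α) (l ^ n)) (M := 4 * M₁)
    (fun n => norm_orbitTerm_le hα (hp0 n) (hp1 n) hz hM₁)
    (fun n => by
      rw [norm_sub_rev]
      exact norm_orbitTerm_sub_le hα hz hd hM₁ hM₂ (hp0 _)
        (pow_le_pow_of_le_one hl0.le hl1.le (by omega)) (hp1 n))
    (fun n => orbitBound_nonneg hM₁0 hM₂0 (by positivity) (hp0 n))
  refine ⟨this.1, this.2.trans_eq ?_⟩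
  rw [pow_zero, orbitBound_one hα]
  ring

theorem continuousOn_orbitDenom_param : ContinuousOn (fun q : ℝ => orbitDenom α q z) (Icc 0 1) :=
  fun _ _ => hasDerivAt_orbitDenom_param.continuousAt.continuousWithinAt

theorem continuousOn_kernel (hα : 0 < α) (hz : 0 ≤ z.re) :
    ContinuousOn (fun q : ℝ => 4 * (α : ℂ) ^ 2 / orbitDenom α q z ^ 2) (Icc 0 1) :=
  continuousOn_const.div (continuousOn_orbitDenom_param.pow 2)
    fun _ hq => pow_ne_zero 2 (orbitDenom_ne_zero hα hq.1 hq.2 hz)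

theorem continuousOn_orbit_param (hα : 0 < α) (hz : 0 ≤ z.re) :
    ContinuousOn (fun q : ℝ => orbit α q z) (Icc 0 1) := fun _ hq =>
  (hasDerivAt_orbit_param (orbitDenom_ne_zero hα hq.1 hq.2 hz)).continuousAt.continuousWithinAt

/-- The limiting integral for the derivative of the image potential. -/
noncomputable def kernelIntegral (α β : ℝ) (z : ℂ) : ℂ :=
  ∫ q in (0 : ℝ)..1, ((q ^ β : ℝ) : ℂ) * (4 * (α : ℂ) ^ 2 / orbitDenom α q z ^ 2)

theorem norm_integral_rpow_mul_le {f : ℝ → ℂ} {B β : ℝ} (hβ : 0 ≤ β)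
    (hB : ∀ q, 0 ≤ q → q ≤ 1 → ‖f q‖ ≤ B) :
    ‖∫ q in (0 : ℝ)..1, ((q ^ β : ℝ) : ℂ) * f q‖ ≤ B / (β + 1) := by
  have := intervalIntegral.norm_integral_le_of_norm_le (μ := volume) (a := 0) (b := 1)
    (f := fun q : ℝ => ((q ^ β : ℝ) : ℂ) * f q) (g := fun q => q ^ β * B) zero_le_one
    (.of_forall fun q hq => by
      rw [norm_mul, Complex.norm_real, Real.norm_of_nonneg (Real.rpow_nonneg hq.1.le _)]
      exact mul_le_mul_of_nonneg_left (hB q hq.1.le hq.2) (Real.rpow_nonneg hq.1.le _))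
    (((continuous_rpow_const' hβ).mul continuous_const).intervalIntegrable _ _)
  rw [intervalIntegral.integral_mul_const, integral_rpow_zero_one hβ] at this
  refine this.trans_eq ?_
  ring

theorem norm_kernelIntegral_le (hα : 0 < α) (hz : 0 ≤ z.re) {β : ℝ} (hβ : 0 ≤ β) :
    ‖kernelIntegral α β z‖ ≤ 4 / (β + 1) :=
  norm_integral_rpow_mul_le hβ fun _ hq0 hq1 => norm_kernel_le hα hq0 hq1 hz

theorem continuousOn_rpow_mul {f : ℝ → ℂ} {β : ℝ} (hβ : 0 ≤ β) (hf : ContinuousOn f (Icc 0 1)) :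
    ContinuousOn (fun q : ℝ => ((q ^ β : ℝ) : ℂ) * f q) (Icc 0 1) :=
  (Complex.continuous_ofReal.comp (continuous_rpow_const' hβ)).continuousOn.mul hf

theorem intervalIntegrable_rpow_mul {f : ℝ → ℂ} {β : ℝ} (hβ : 0 ≤ β)
    (hf : ContinuousOn f (Icc 0 1)) :
    IntervalIntegrable (fun q : ℝ => ((q ^ β : ℝ) : ℂ) * f q) volume 0 1 :=
  ContinuousOn.intervalIntegrable (by
    rw [uIcc_of_le zero_le_one]; exact continuousOn_rpow_mul hβ hf)

/-- `108` is the value at `q = 1` of the antiderivative from `hasDerivAt_inv_sq`, whatever `α` and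
`p` are. -/
theorem integral_deriv_inv_sq (hα : 0 < α) {p : ℝ} (hp : 0 < p) :
    IntervalIntegrable (fun q : ℝ => 216 * α ^ 2 * p / ((1 - q) * p + α) ^ 3) volume 0 1 ∧
    ∫ q in (0 : ℝ)..1, 216 * α ^ 2 * p / ((1 - q) * p + α) ^ 3 ≤ 108 := by
  have hi : IntervalIntegrable (fun q : ℝ => 216 * α ^ 2 * p / ((1 - q) * p + α) ^ 3) volume 0 1 := by
    refine ContinuousOn.intervalIntegrable ?_
    rw [uIcc_of_le zero_le_one]
    refine continuousOn_const.div (by fun_prop) fun q hq => ?_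
    have : 0 < (1 - q) * p + α := by nlinarith [mul_nonneg (sub_nonneg.2 hq.2) hp.le]
    positivity
  refine ⟨hi, ?_⟩
  rw [intervalIntegral.integral_eq_sub_of_hasDerivAt
    (f := fun q => 108 * α ^ 2 / ((1 - q) * p + α) ^ 2) (fun q hq => by
      rw [uIcc_of_le zero_le_one] at hq
      exact hasDerivAt_inv_sq hα hp hq.2) hi]
  have : 0 ≤ 108 * α ^ 2 / ((1 - 0) * p + α) ^ 2 := by positivity
  have e : 108 * α ^ 2 / ((1 - 1) * p + α) ^ 2 = 108 := by
    rw [sub_self, zero_mul, zero_add, mul_div_assoc, div_self (by positivity), mul_one]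
  rw [e]; linarith

/-- Since `e^{-nt} = (lⁿ)^{t/L}` for `l = e^{-L}`, the series samples `q F(q)` along a geometric
progression and is close to `(1/L) ∫ F`. Then `h₁` on the orbit is frozen at `0`, the exponent `t/L`
replaced by `t/L₂`, and `1/L` by `c`. `L₂` and `c` are free here; later they carry the leading
asymptotics of `L` and `1/L`. -/
theorem orbitTerm_sum_sub_integral_le (hα : 0 < α) (hz : 0 ≤ z.re)
    (hd : ∀ w, HasDerivAt h₁ (h₂ w) w)
    (hM₁ : ∀ w, ‖w‖ ≤ ‖z‖ + α → ‖h₁ w‖ ≤ M₁) (hM₂ : ∀ w, ‖w‖ ≤ ‖z‖ + α → ‖h₂ w‖ ≤ M₂)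
    {L t L₂ c : ℝ} (hL : 0 < L) (ht : 0 < t) (hL₂ : 0 < L₂) :
    ‖(∑' n : ℕ, ((Real.exp (-t) : ℝ) : ℂ) ^ n * orbitTerm h₁ α z (Real.exp (-L) ^ n)) -
      c * h₁ 0 * kernelIntegral α (t / L₂) z‖ ≤
      8 * M₁ + (M₁ + M₂ * (‖z‖ + α)) * 108 + 108 * M₂ * (α / L) +
        4 * M₁ * (|1 / L - 1 / L₂| + |1 / L - c|) := by
  set p := ‖z‖ + α with hp
  have hp0 : 0 < p := by positivity
  have hM₁0 : 0 ≤ M₁ := (norm_nonneg _).trans (hM₁ 0 (by simpa using hp0.le))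
  have hM₂0 : 0 ≤ M₂ := (norm_nonneg _).trans (hM₂ 0 (by simpa using hp0.le))
  set b := t / L with hb
  set β := t / L₂ with hβ
  have hb0 : 0 < b := by positivity
  have hβ0 : 0 < β := by positivity
  set l := Real.exp (-L) with hl
  have hl0 : 0 < l := Real.exp_pos _
  have hl1 : l < 1 := by rw [hl, Real.exp_lt_one_iff]; linarith
  set K : ℝ → ℂ := fun q => 4 * (α : ℂ) ^ 2 / orbitDenom α q z ^ 2 with hK
  have hKc : ContinuousOn K (Icc 0 1) := continuousOn_kernel hα hz
  set F : ℝ → ℂ := fun q => ((q ^ b : ℝ) : ℂ) * (h₁ (orbit α q z) * K q) with hF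
  have hh₁c : Continuous h₁ := continuous_iff_continuousAt.2 fun w => (hd w).continuousAt
  have hoc : ContinuousOn (fun q : ℝ => h₁ (orbit α q z)) (Icc 0 1) :=
    hh₁c.comp_continuousOn (continuousOn_orbit_param hα hz)
  have hFc : ContinuousOn F (Icc 0 1) := continuousOn_rpow_mul hb0.le (hoc.mul hKc)
  have hqF : ∀ q : ℝ, q * F q = ((q ^ b : ℝ) : ℂ) * orbitTerm h₁ α z q := fun q => by
    simp only [hF, hK, orbitTerm]; ring
  have hterm : ∀ n : ℕ, ((l ^ n : ℝ) : ℂ) * F (l ^ n) =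
      ((Real.exp (-t) : ℝ) : ℂ) ^ n * orbitTerm h₁ α z (l ^ n) := fun n => by
    rw [hqF, ← Complex.ofReal_pow]
    congr 2
    rw [hl, ← Real.exp_nat_mul, ← Real.exp_nat_mul, ← Real.exp_mul, hb]
    congr 1; field_simp
  have hτ : |Real.exp (-t)| < 1 := by
    rw [abs_of_pos (Real.exp_pos _), Real.exp_lt_one_iff]; linarith
  have hs := (orbitTerm_sum_le hα hz hd hM₁ hM₂ hl0 hl1 hτ).1
  have hR := norm_tsum_sub_integral_le (F := F) (L := L) hl0 hl1 (by rw [hl, Real.log_exp, neg_neg]) hFc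
    (ψ := fun q => 4 * M₁ * q ^ b + orbitBound M₁ M₂ α p q)
    (fun q hq0 _ => add_nonneg (mul_nonneg (by positivity) (Real.rpow_nonneg hq0 _))
      (orbitBound_nonneg hM₁0 hM₂0 hp0.le hq0))
    (fun q' q hq0 hqq hq => by
      rw [hqF, hqF]
      have h1 := norm_orbitTerm_sub_le hα hz hd hM₁ hM₂ hq0.le hqq hq
      have h2 := norm_orbitTerm_le (h₁ := h₁) hα (hq0.le.trans hqq) hq hz hM₁
      have h3 : q' ^ b ≤ q ^ b := Real.rpow_le_rpow hq0.le hqq hb0.le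
      have h4 : q' ^ b ≤ 1 := Real.rpow_le_one hq0.le (hqq.trans hq) hb0.le
      have h5 : 0 ≤ q' ^ b := Real.rpow_nonneg hq0.le _
      have e : ((q ^ b : ℝ) : ℂ) * orbitTerm h₁ α z q - ((q' ^ b : ℝ) : ℂ) * orbitTerm h₁ α z q' =
          ((q ^ b - q' ^ b : ℝ) : ℂ) * orbitTerm h₁ α z q +
          ((q' ^ b : ℝ) : ℂ) * (orbitTerm h₁ α z q - orbitTerm h₁ α z q') := by
        push_cast; ring
      rw [e]
      refine (norm_add_le _ _).trans ?_
      rw [norm_mul, norm_mul, Complex.norm_real, Complex.norm_real,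
        Real.norm_of_nonneg (sub_nonneg.2 h3), Real.norm_of_nonneg h5]
      have h6 : (q ^ b - q' ^ b) * ‖orbitTerm h₁ α z q‖ ≤ (q ^ b - q' ^ b) * (4 * M₁) :=
        mul_le_mul_of_nonneg_left h2 (sub_nonneg.2 h3)
      have h7 : q' ^ b * ‖orbitTerm h₁ α z q - orbitTerm h₁ α z q'‖ ≤
          1 * ‖orbitTerm h₁ α z q - orbitTerm h₁ α z q'‖ :=
        mul_le_mul_of_nonneg_right h4 (norm_nonneg _)
      linarith)
    (by simpa only [hterm] using hs)
  simp only [hterm] at hR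
  rw [Real.one_rpow, orbitBound_one hα] at hR
  -- replace `h₁ (orbit α q z)` by `h₁ 0`
  have hlin : ‖(∫ q in (0 : ℝ)..1, F q) - h₁ 0 * kernelIntegral α b z‖ ≤ 108 * M₂ * α := by
    have i2 : IntervalIntegrable (fun q : ℝ => h₁ 0 * (((q ^ b : ℝ) : ℂ) * K q)) volume 0 1 :=
      (intervalIntegrable_rpow_mul hb0.le hKc).const_mul _
    have i1 : IntervalIntegrable F volume 0 1 := intervalIntegrable_rpow_mul hb0.le (hoc.mul hKc)
    have e0 : (∫ q in (0 : ℝ)..1, F q) - h₁ 0 * kernelIntegral α b z =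
        ∫ q in (0 : ℝ)..1, (F q - h₁ 0 * (((q ^ b : ℝ) : ℂ) * K q)) := by
      rw [intervalIntegral.integral_sub i1 i2, intervalIntegral.integral_const_mul]
      rfl
    rw [e0]
    obtain ⟨hi, hle⟩ := integral_deriv_inv_sq hα hp0
    refine (intervalIntegral.norm_integral_le_of_norm_le zero_le_one (.of_forall fun q hq => ?_)
      (hi.const_mul (M₂ * α))).trans ?_
    · have hq0 := hq.1.le
      have hN := le_norm_orbitDenom hα hq0 hq.2 hz
      have hN0 : 0 < ‖orbitDenom α q z‖ := hα.trans_le hN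
      have e : ((q ^ b : ℝ) : ℂ) * (h₁ (orbit α q z) * K q) - h₁ 0 * (((q ^ b : ℝ) : ℂ) * K q) =
          ((q ^ b : ℝ) : ℂ) * ((h₁ (orbit α q z) - h₁ 0) * K q) := by ring
      rw [e, norm_mul, Complex.norm_real, Real.norm_of_nonneg (Real.rpow_nonneg hq0 _), norm_mul]
      have b1 : ‖h₁ (orbit α q z) - h₁ 0‖ ≤ M₂ * ‖orbit α q z‖ := by
        have := (convex_closedBall (0 : ℂ) p).norm_image_sub_le_of_norm_hasDerivWithin_le
          (f := h₁) (f' := h₂) (C := M₂) (x := 0) (y := orbit α q z)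
          (fun x _ => (hd x).hasDerivWithinAt) (fun x hx => hM₂ x (by simpa using hx))
          (by simpa using hp0.le) (by simpa using norm_orbit_le hα hq0 hq.2 hz)
        simpa using this
      -- This sharper bound supplies the factor `α` that pays for the prefactor `1/L`.
      have b2 := norm_orbit_le' (z := z) hα hq0 hq.2
      have b3 : ‖K q‖ = 4 * α ^ 2 / ‖orbitDenom α q z‖ ^ 2 := by
        simp only [hK, norm_div, norm_mul, norm_pow, Complex.norm_real, Real.norm_of_nonneg hα.le,
          Complex.norm_ofNat]
      have b4 : q ^ b ≤ 1 := Real.rpow_le_one hq0 hq.2 hb0.le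
      have b5 := norm_div_orbitDenom_cube_le hα hq0 hq.2 hz
      calc q ^ b * (‖h₁ (orbit α q z) - h₁ 0‖ * ‖K q‖) ≤
            1 * (M₂ * (2 * α * p / ‖orbitDenom α q z‖) * ‖K q‖) := by
            gcongr
            exact b1.trans (by gcongr)
        _ = M₂ * α * (8 * α ^ 2 * p / ‖orbitDenom α q z‖ ^ 3) := by
            rw [b3]; field_simp; ring
        _ ≤ _ := by gcongr
    · rw [intervalIntegral.integral_const_mul]
      have : M₂ * α * ∫ q in (0 : ℝ)..1, 216 * α ^ 2 * p / ((1 - q) * p + α) ^ 3 ≤ M₂ * α * 108 := by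
        gcongr
      linarith
  -- replace the exponent
  have hexp : ‖kernelIntegral α b z - kernelIntegral α β z‖ ≤ 4 * |1 / (b + 1) - 1 / (β + 1)| := by
    rw [kernelIntegral, kernelIntegral,
      ← intervalIntegral.integral_sub (intervalIntegrable_rpow_mul hb0.le hKc)
        (intervalIntegrable_rpow_mul hβ0.le hKc), ← integral_abs_rpow_sub_rpow_le hb0.le hβ0.le,
      ← intervalIntegral.integral_const_mul]
    refine intervalIntegral.norm_integral_le_of_norm_le zero_le_one (.of_forall fun q hq => ?_)
      (Continuous.intervalIntegrable (by
        have := continuous_rpow_const' hb0.le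
        have := continuous_rpow_const' hβ0.le
        fun_prop) _ _)
    rw [← sub_mul, norm_mul, ← Complex.ofReal_sub, Complex.norm_real, Real.norm_eq_abs, mul_comm]
    exact mul_le_mul_of_nonneg_right (norm_kernel_le hα hq.1.le hq.2 hz) (abs_nonneg _)
  -- The left side is `|1/L - 1/L₂|` times a factor at most `1`, so the cost of changing the
  -- exponent is uniform in `t`.
  have hexp' : 1 / L * |1 / (b + 1) - 1 / (β + 1)| ≤ |1 / L - 1 / L₂| := by
    have e : 1 / L * (1 / (b + 1) - 1 / (β + 1)) =
        (1 / L - 1 / L₂) * (-(b / ((b + 1) * (β + 1)))) := by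
      rw [hb, hβ]; field_simp; ring
    have h1 : 1 / L * |1 / (b + 1) - 1 / (β + 1)| = |1 / L * (1 / (b + 1) - 1 / (β + 1))| := by
      rw [abs_mul, abs_of_pos (show 0 < 1 / L by positivity)]
    rw [h1, e, abs_mul, abs_neg]
    refine mul_le_of_le_one_right (abs_nonneg _) ?_
    rw [abs_of_nonneg (by positivity), div_le_one (by positivity)]
    nlinarith [mul_pos hb0 hβ0]
  have hh0 : ‖h₁ 0‖ ≤ M₁ := hM₁ 0 (by simpa using hp0.le)
  have hk1 : ‖kernelIntegral α β z‖ ≤ 4 :=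
    (norm_kernelIntegral_le hα hz hβ0.le).trans (div_le_self (by norm_num) (by linarith))
  set S := ∑' n : ℕ, ((Real.exp (-t) : ℝ) : ℂ) ^ n * orbitTerm h₁ α z (l ^ n) with hS
  have hdecomp : S - c * h₁ 0 * kernelIntegral α β z =
      (S - (1 / L : ℝ) * ∫ q in (0 : ℝ)..1, F q) +
      (1 / L : ℝ) * ((∫ q in (0 : ℝ)..1, F q) - h₁ 0 * kernelIntegral α b z) +
      (1 / L : ℝ) * (h₁ 0 * (kernelIntegral α b z - kernelIntegral α β z)) +
      ((1 / L - c : ℝ) : ℂ) * (h₁ 0 * kernelIntegral α β z) := by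
    push_cast; ring
  rw [hdecomp]
  refine (norm_add₄_le).trans ?_
  have n2 : ‖((1 / L : ℝ) : ℂ) * ((∫ q in (0 : ℝ)..1, F q) - h₁ 0 * kernelIntegral α b z)‖ ≤
      108 * M₂ * (α / L) := by
    rw [norm_mul, Complex.norm_real, Real.norm_of_nonneg (by positivity)]
    calc _ ≤ 1 / L * (108 * M₂ * α) := by gcongr
      _ = _ := by ring
  have n3 : ‖((1 / L : ℝ) : ℂ) * (h₁ 0 * (kernelIntegral α b z - kernelIntegral α β z))‖ ≤
      4 * M₁ * |1 / L - 1 / L₂| := by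
    rw [norm_mul, norm_mul, Complex.norm_real, Real.norm_of_nonneg (by positivity)]
    calc _ ≤ 1 / L * (M₁ * (4 * |1 / (b + 1) - 1 / (β + 1)|)) := by gcongr
      _ = 4 * M₁ * (1 / L * |1 / (b + 1) - 1 / (β + 1)|) := by ring
      _ ≤ _ := by gcongr
  have n4 : ‖((1 / L - c : ℝ) : ℂ) * (h₁ 0 * kernelIntegral α β z)‖ ≤ 4 * M₁ * |1 / L - c| := by
    rw [norm_mul, norm_mul, Complex.norm_real, Real.norm_eq_abs]
    calc _ ≤ |1 / L - c| * (M₁ * 4) := by gcongr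
      _ = _ := by ring
  linarith

end Sums

/-! ### Nested circles and reflections. -/

/-- Two nested circles with centres `cᵢ < cₑ` on the real axis and common inverse points `±α`. -/
structure NestedCircles (ci ce ri re α : ℝ) : Prop where
  ri_pos : 0 < ri
  ci_pos : 0 < ci
  lt : ci < ce
  nest : ce - ci + ri < re
  alpha_pos : 0 < α
  sq_i : α ^ 2 = ci ^ 2 - ri ^ 2
  sq_e : α ^ 2 = ce ^ 2 - re ^ 2

/-- Reflection in the circle with centre `c` and radius `r`. -/
noncomputable def circleReflection (c r : ℝ) (z : ℂ) : ℂ := c + r ^ 2 / conj (z - c)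

/-- Multiplier of the composition of the two reflections. -/
noncomputable def multiplier (ci ce α : ℝ) : ℝ :=
  (ci * ce - α ^ 2 - α * (ce - ci)) / (ci * ce - α ^ 2 + α * (ce - ci))

section Reflection

variable {c r : ℝ} {z : ℂ}

theorem sub_mul_conj_sub (h : ‖z - c‖ = r) : (z - c) * conj (z - c) = (r : ℂ) ^ 2 := by
  rw [Complex.mul_conj, Complex.normSq_eq_norm_sq, h]; push_cast; rfl

theorem circleReflection_of_mem (hr : 0 < r) (h : ‖z - c‖ = r) : circleReflection c r z = z := by
  have h0 : conj (z - c) ≠ 0 := by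
    rw [map_ne_zero, ← norm_pos_iff, h]; exact hr
  rw [circleReflection, ← sub_mul_conj_sub h, mul_div_cancel_right₀ _ h0]
  ring

theorem norm_circleReflection_sub : ‖circleReflection c r z - c‖ = r ^ 2 / ‖z - c‖ := by
  rw [circleReflection, add_sub_cancel_left, norm_div, Complex.norm_conj, norm_pow,
    Complex.norm_real, Real.norm_eq_abs, sq_abs]

theorem norm_circleReflection_sub_le (hr : 0 < r) (h : r ≤ ‖z - c‖) :
    ‖circleReflection c r z - c‖ ≤ r := by
  rw [norm_circleReflection_sub, div_le_iff₀ (hr.trans_le h)]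
  nlinarith

/-- The reflection is antiholomorphic, so the outer conjugation restores holomorphy: the function is
`conj ∘ f ∘ conj` composed with `z ↦ c + r² / (z - c)`, as `c` and `r` are real. -/
theorem hasDerivAt_conj_comp_circleReflection {f : ℂ → ℂ} {f' : ℂ} (hz : z ≠ c)
    (hf : HasDerivAt f f' (circleReflection c r z)) :
    HasDerivAt (fun z => conj (f (circleReflection c r z))) (-(conj f' * (r ^ 2 / (z - c) ^ 2))) z := by
  have hz' : z - c ≠ 0 := sub_ne_zero.2 hz
  have h1 : HasDerivAt (fun z : ℂ => c + (r : ℂ) ^ 2 / (z - c)) (-(r ^ 2 / (z - c) ^ 2)) z := by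
    have := (((hasDerivAt_id z).sub_const (c : ℂ)).inv hz').const_mul ((r : ℂ) ^ 2)
    refine (this.const_add (c : ℂ)).congr_deriv ?_ |>.congr_of_eventuallyEq (.of_forall fun w => ?_)
    · simp; ring
    · simp [div_eq_mul_inv]
  have h2 : ∀ z : ℂ, circleReflection c r z = conj (c + (r : ℂ) ^ 2 / (z - c)) := fun z => by
    simp [circleReflection]
  have h3 : HasDerivAt (fun w => conj (f (conj w))) (conj f') (c + (r : ℂ) ^ 2 / (z - c)) := by
    rw [h2] at hf
    simpa [Function.comp_def] using hf.conj_conj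
  have h4 := h3.comp z h1
  refine (h4.congr_deriv (by ring)).congr_of_eventuallyEq (.of_forall fun w => ?_)
  simp only [h2, Function.comp_apply]

theorem continuousAt_circleReflection (hz : z ≠ c) : ContinuousAt (circleReflection c r) z := by
  have hz' : conj (z - c) ≠ 0 := (map_ne_zero _).2 (sub_ne_zero.2 hz)
  unfold circleReflection
  exact continuousAt_const.add (continuousAt_const.div
    (Complex.continuous_conj.continuousAt.comp (by fun_prop)) hz')

end Reflection

section Geometry

variable {ci ce ri re α : ℝ} (hc : NestedCircles ci ce ri re α)
include hc

namespace NestedCircles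

theorem ri_lt : ri < ci := by
  have := hc.sq_i; have := hc.alpha_pos; have := hc.ci_pos; have := hc.ri_pos
  nlinarith [sq_nonneg α, mul_pos hc.alpha_pos hc.alpha_pos]

theorem alpha_lt : α < ci := by
  have := hc.sq_i; have := hc.alpha_pos; have := hc.ci_pos
  nlinarith [mul_pos hc.ri_pos hc.ri_pos]

theorem re_pos : 0 < re := by linarith [hc.nest, hc.lt, hc.ri_pos]

theorem re_lt : re < ce := by
  have := hc.sq_e; have := hc.re_pos; have := hc.lt; have := hc.ci_pos
  nlinarith [mul_pos hc.alpha_pos hc.alpha_pos]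

theorem re_pos_of_mem_i {z : ℂ} (hz : ‖z - ci‖ ≤ ri) : 0 < z.re := by
  have h := (Complex.abs_re_le_norm (z - ci)).trans hz
  rw [Complex.sub_re, Complex.ofReal_re] at h
  linarith [(abs_le.1 h).1, hc.ri_lt]

/-- The origin has power `α² > 0` with respect to the circle, so it lies outside. The closed disk is
therefore in the right half plane, where the orbit maps have no poles. -/
theorem re_pos_of_mem_e {z : ℂ} (hz : ‖z - ce‖ ≤ re) : 0 < z.re := by
  have h := (Complex.abs_re_le_norm (z - ce)).trans hz
  rw [Complex.sub_re, Complex.ofReal_re] at h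
  linarith [(abs_le.1 h).1, hc.re_lt]

theorem mem_e_of_mem_i {z : ℂ} (hz : ‖z - ci‖ ≤ ri) : ‖z - ce‖ < re := by
  have h := norm_add_le (z - ci) ((ci : ℂ) - ce)
  rw [sub_add_sub_cancel, ← Complex.ofReal_sub, Complex.norm_real, Real.norm_eq_abs, abs_sub_comm,
    abs_of_pos (sub_pos.2 hc.lt)] at h
  linarith [hc.nest]

theorem lt_of_le_e {z : ℂ} (hz : re ≤ ‖z - ce‖) : ri < ‖z - ci‖ := by
  by_contra! h
  exact absurd (hc.mem_e_of_mem_i h) (not_lt.2 hz)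

theorem re_refl_pos {z : ℂ} (hz : ri ≤ ‖z - ci‖) : 0 < (circleReflection ci ri z).re :=
  hc.re_pos_of_mem_i (norm_circleReflection_sub_le hc.ri_pos hz)

theorem ne_ci {z : ℂ} (hz : ri ≤ ‖z - ci‖) : z ≠ ci := by
  rintro rfl
  simp at hz; linarith [hc.ri_pos]

theorem ne_ce {z : ℂ} (hz : re ≤ ‖z - ce‖) : z ≠ ce := by
  rintro rfl
  simp at hz; linarith [hc.re_pos]

theorem denom_pos : 0 < ci * ce - α ^ 2 - α * (ce - ci) := by
  have h1 := hc.sq_i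
  have h2 := mul_pos (sub_pos.2 hc.alpha_lt) (sub_pos.2 hc.lt)
  nlinarith [mul_pos hc.ri_pos hc.ri_pos]

theorem denom_pos' : 0 < ci * ce - α ^ 2 + α * (ce - ci) := by
  have := hc.denom_pos
  nlinarith [mul_pos hc.alpha_pos (sub_pos.2 hc.lt)]

theorem multiplier_pos : 0 < multiplier ci ce α := div_pos hc.denom_pos hc.denom_pos'

theorem multiplier_lt_one : multiplier ci ce α < 1 := by
  rw [multiplier, div_lt_one hc.denom_pos']
  nlinarith [mul_pos hc.alpha_pos (sub_pos.2 hc.lt)]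

/-- On the outer circle the Möbius map `orbit α l` is the reflection in the inner circle, and its
derivative is the one of the reflection up to conjugation. -/
theorem orbit_on_circle {z : ℂ} (hz : ‖z - ce‖ = re) :
    orbit α (multiplier ci ce α) z = circleReflection ci ri z ∧
    (z - ce) * (4 * α ^ 2 * (multiplier ci ce α : ℝ) / orbitDenom α (multiplier ci ce α) z ^ 2) =
      conj ((z - ce) * (ri ^ 2 / (z - ci) ^ 2)) := by
  set l := multiplier ci ce α with hl
  set d := ce - ci with hd
  set m := ci * ce - α ^ 2 with hm
  have hD : (m : ℂ) + α * d ≠ 0 := by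
    have := hc.denom_pos'.ne'
    exact_mod_cast this
  have hlc : (l : ℂ) = (m - α * d) / (m + α * d) := by
    have : l = (m - α * d) / (m + α * d) := rfl
    rw [this]; push_cast; rfl
  have hzc : z - ce ≠ 0 := sub_ne_zero.2 (hc.ne_ce hz.ge)
  have hzi : z - ci ≠ 0 := sub_ne_zero.2 (hc.ne_ci (hc.lt_of_le_e hz.ge).le)
  have hzi' : conj z - ci ≠ 0 := by
    have := (map_ne_zero (starRingEnd ℂ)).2 hzi
    simpa using this
  have hα : (α : ℂ) ≠ 0 := Complex.ofReal_ne_zero.2 hc.alpha_pos.ne'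
  have s1 : (α : ℂ) ^ 2 = ci ^ 2 - ri ^ 2 := by exact_mod_cast hc.sq_i
  have s2 : (α : ℂ) ^ 2 = ce ^ 2 - re ^ 2 := by exact_mod_cast hc.sq_e
  have s3 := sub_mul_conj_sub hz
  rw [map_sub, Complex.conj_ofReal] at s3
  -- On the outer circle `conj z - ce = re² / (z - ce)`; through this factorization a conjugate
  -- enters and the Möbius map becomes the reflection.
  have hden : (d : ℂ) * z + m = (z - ce) * (conj z - ci) := by
    rw [hd, hm]; push_cast
    linear_combination -s3 - s2
  have hN : orbitDenom α l z = 2 * α * ((z - ce) * (conj z - ci)) / (m + α * d) := by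
    rw [← hden, orbitDenom, hlc]
    field_simp
    ring
  have hnum : (1 + l) * z + (1 - l) * (α : ℂ) = 2 * (m * z + α ^ 2 * d) / (m + α * d) := by
    rw [hlc]
    field_simp
    ring
  constructor
  · rw [orbit, hnum, hN, circleReflection, map_sub, Complex.conj_ofReal]
    have e : (m : ℂ) * z + α ^ 2 * d = ci * ((z - ce) * (conj z - ci)) + ri ^ 2 * (z - ce) := by
      rw [← hden, hd, hm]; push_cast
      linear_combination (ce - z) * s1
    rw [e]
    field_simp
  · have e : (m : ℂ) ^ 2 - α ^ 2 * d ^ 2 = ri ^ 2 * re ^ 2 := by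
      rw [hd, hm]; push_cast
      linear_combination -(ce ^ 2 - α ^ 2) * s1 - ri ^ 2 * s2
    rw [hN, hlc]
    simp only [map_mul, map_div₀, map_sub, map_pow, Complex.conj_ofReal]
    have e2 : 4 * (α : ℂ) ^ 2 * ((m - α * d) / (m + α * d)) /
        (2 * α * ((z - ce) * (conj z - ci)) / (m + α * d)) ^ 2 =
        (m ^ 2 - α ^ 2 * d ^ 2) / ((z - ce) * (conj z - ci)) ^ 2 := by
      field_simp
      ring
    rw [e2, e, ← s3]
    field_simp

end NestedCircles

end Geometry

/-! ### The explicit solution -/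

/-- The potential in the outer disk of the image charges inside the core's complement. -/
noncomputable def potA (h : ℂ → ℂ) (α l τ τe : ℝ) (z : ℂ) : ℂ :=
  (1 + τe) * ∑' n : ℕ, (τ : ℂ) ^ n * h (orbit α (l ^ n) z)

/-- Derivative of `potA`. -/
noncomputable def dpotA (h₁ : ℂ → ℂ) (α l τ τe : ℝ) (z : ℂ) : ℂ :=
  (1 + τe) * ∑' n : ℕ, (τ : ℂ) ^ n * orbitTerm h₁ α z (l ^ n)

section Potential

variable {h h₁ : ℂ → ℂ} {α l τ τe : ℝ}

theorem norm_pot_term_le (hh : Differentiable ℂ h) (hα : 0 < α) (hl0 : 0 < l) (hl1 : l < 1) (M : ℝ) :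
    ∃ C, ∀ n : ℕ, ∀ z : ℂ, 0 < z.re → ‖z‖ ≤ M →
      ‖(τ : ℂ) ^ n * h (orbit α (l ^ n) z)‖ ≤ |τ| ^ n * C := by
  obtain ⟨C, hC⟩ := (isCompact_closedBall (0 : ℂ) (M + α)).exists_bound_of_continuousOn
    hh.continuous.continuousOn
  refine ⟨C, fun n z hz hzM => ?_⟩
  rw [norm_mul, norm_pow, Complex.norm_real, Real.norm_eq_abs]
  gcongr
  refine hC _ ?_
  rw [mem_closedBall_zero_iff]
  exact (norm_orbit_le hα (pow_nonneg hl0.le n) (pow_le_one₀ hl0.le hl1.le) hz.le).trans (by linarith)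

theorem summable_pot (hh : Differentiable ℂ h) (hα : 0 < α) (hl0 : 0 < l) (hl1 : l < 1) (hτ : |τ| < 1)
    {z : ℂ} (hz : 0 < z.re) : Summable fun n : ℕ => (τ : ℂ) ^ n * h (orbit α (l ^ n) z) := by
  obtain ⟨C, hC⟩ := norm_pot_term_le (τ := τ) hh hα hl0 hl1 ‖z‖
  exact Summable.of_norm_bounded ((summable_geometric_of_lt_one (abs_nonneg τ) hτ).mul_right C)
    fun n => hC n z hz le_rfl

/-- Orbits of a bounded part of the half plane stay bounded, so the series is dominated by a
geometric one and Weierstrass' theorem allows termwise differentiation. -/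
theorem hasDerivAt_potA (hh : ∀ w, HasDerivAt h (h₁ w) w) (hα : 0 < α) (hl0 : 0 < l) (hl1 : l < 1)
    (hτ : |τ| < 1) {z : ℂ} (hz : 0 < z.re) :
    HasDerivAt (potA h α l τ τe) (dpotA h₁ α l τ τe z) z := by
  have hd : Differentiable ℂ h := fun w => (hh w).differentiableAt
  obtain ⟨C, hC⟩ := norm_pot_term_le (τ := τ) hd hα hl0 hl1 (‖z‖ + 1)
  set U : Set ℂ := {w : ℂ | 0 < w.re} ∩ Metric.ball 0 (‖z‖ + 1) with hU
  have hUo : IsOpen U :=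
    (isOpen_lt continuous_const Complex.continuous_re).inter Metric.isOpen_ball
  have hzU : z ∈ U := ⟨hz, by simp⟩
  have hp0 : ∀ n : ℕ, 0 ≤ l ^ n := fun n => pow_nonneg hl0.le n
  have hp1 : ∀ n : ℕ, l ^ n ≤ 1 := fun n => pow_le_one₀ hl0.le hl1.le
  have hder : ∀ (n : ℕ) (w : ℂ), w ∈ U → HasDerivAt (fun z => (τ : ℂ) ^ n * h (orbit α (l ^ n) z))
      ((τ : ℂ) ^ n * orbitTerm h₁ α w (l ^ n)) w := fun n w hw =>
    ((hh _).comp w (hasDerivAt_orbit (orbitDenom_ne_zero hα (hp0 n) (hp1 n)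
      (le_of_lt hw.1)))).const_mul _
  have hu : Summable fun n : ℕ => |τ| ^ n * C :=
    (summable_geometric_of_lt_one (abs_nonneg τ) hτ).mul_right C
  have hle : ∀ (n : ℕ) (w : ℂ), w ∈ U → ‖(τ : ℂ) ^ n * h (orbit α (l ^ n) w)‖ ≤ |τ| ^ n * C :=
    fun n w hw => hC n w hw.1 (mem_ball_zero_iff.1 hw.2).le
  have h1 := Complex.hasSum_deriv_of_summable_norm hu
    (fun n w hw => (hder n w hw).differentiableAt.differentiableWithinAt) hUo hle hzU
  have h2 := Complex.differentiableOn_tsum_of_summable_norm hu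
    (fun n w hw => (hder n w hw).differentiableAt.differentiableWithinAt) hUo hle
  have h3 := (h2.differentiableAt (hUo.mem_nhds hzU)).hasDerivAt
  rw [← h1.tsum_eq] at h3
  refine (h3.const_mul (1 + (τe : ℂ))).congr_deriv ?_
  rw [dpotA]
  congr 2
  ext n
  exact (hder n z hzU).deriv

/-- The term `n = 0` is split off and the others are shifted by the semigroup law. On the outer
circle `orbit α l` is the inner reflection, and the identity becomes the transmission condition
there. -/
theorem potA_eq (hh : Differentiable ℂ h) (hα : 0 < α) (hl0 : 0 < l) (hl1 : l < 1) (hτ : |τ| < 1)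
    {z : ℂ} (hz : 0 < z.re) :
    potA h α l τ τe z = (1 + τe) * h z + τ * potA h α l τ τe (orbit α l z) := by
  rw [potA, (summable_pot hh hα hl0 hl1 hτ hz).tsum_eq_zero_add, potA]
  simp only [pow_zero, one_mul, orbit_one hα]
  have e : ∀ n : ℕ, (τ : ℂ) ^ (n + 1) * h (orbit α (l ^ (n + 1)) z) =
      τ * ((τ : ℂ) ^ n * h (orbit α (l ^ n) (orbit α l z))) := fun n => by
    rw [orbit_orbit hα (pow_nonneg hl0.le n) (pow_le_one₀ hl0.le hl1.le) hl0.le hl1.le hz, ← pow_succ,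
      pow_succ (τ : ℂ)]
    ring
  simp only [e, tsum_mul_left]
  ring

theorem dpotA_eq (hh : ∀ w, HasDerivAt h (h₁ w) w) (hα : 0 < α) (hl0 : 0 < l) (hl1 : l < 1)
    (hτ : |τ| < 1) {z : ℂ} (hz : 0 < z.re) :
    dpotA h₁ α l τ τe z = (1 + τe) * h₁ z +
      τ * (dpotA h₁ α l τ τe (orbit α l z) * (4 * α ^ 2 * l / orbitDenom α l z ^ 2)) := by
  have hd : Differentiable ℂ h := fun w => (hh w).differentiableAt
  have h1 := hasDerivAt_potA (τe := τe) hh hα hl0 hl1 hτ hz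
  have h2 := ((hh z).const_mul (1 + (τe : ℂ))).add (((hasDerivAt_potA (τe := τe) hh hα hl0 hl1 hτ
    (re_orbit_pos hα hl0.le hl1.le hz)).comp z
    (hasDerivAt_orbit (orbitDenom_ne_zero hα hl0.le hl1.le hz.le))).const_mul (τ : ℂ))
  refine h1.unique (h2.congr_of_eventuallyEq ?_)
  filter_upwards [(isOpen_lt continuous_const Complex.continuous_re).mem_nhds hz] with w hw
  exact potA_eq hd hα hl0 hl1 hτ hw

end Potential

/-- The potential of the image charges of `a` inside a circle. -/
noncomputable def potB (a : ℂ → ℂ) (c r τi : ℝ) (z : ℂ) : ℂ := -τi * conj (a (circleReflection c r z))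

/-- Derivative of `potB`, where `a'` is the derivative of `a`. -/
noncomputable def dpotB (a' : ℂ → ℂ) (c r τi : ℝ) (z : ℂ) : ℂ :=
  τi * (conj (a' (circleReflection c r z)) * (r ^ 2 / (z - c) ^ 2))

theorem hasDerivAt_potB {a a' : ℂ → ℂ} {c r τi : ℝ} {z : ℂ} (hz : z ≠ c)
    (ha : HasDerivAt a (a' (circleReflection c r z)) (circleReflection c r z)) :
    HasDerivAt (potB a c r τi) (dpotB a' c r τi z) z := by
  refine ((hasDerivAt_conj_comp_circleReflection hz ha).const_mul (-(τi : ℂ))).congr_deriv ?_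
  rw [dpotB]; ring

/-- The reflection sends infinity to the centre, at distance `r² / ‖z - c‖`. -/
theorem isBigO_conj_circleReflection_sub {f : ℂ → ℂ} {c r : ℝ} (hf : DifferentiableAt ℂ f c) :
    (fun z => conj (f (circleReflection c r z)) - conj (f c)) =O[cocompact ℂ] fun z => ‖z‖⁻¹ := by
  have hlim : Tendsto (fun z : ℂ => circleReflection c r z) (cocompact ℂ) (𝓝 (c : ℂ)) := by
    rw [tendsto_iff_norm_sub_tendsto_zero]
    simp only [norm_circleReflection_sub]
    refine tendsto_const_nhds.div_atTop ?_
    have h1 := tendsto_norm_cocompact_atTop (E := ℂ)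
    refine tendsto_atTop_mono (fun z => norm_sub_norm_le z (c : ℂ)) ?_
    exact tendsto_atTop_add_const_right _ _ h1
  have h1 : (fun z : ℂ => f (circleReflection c r z) - f c) =O[cocompact ℂ]
      fun z => circleReflection c r z - c := hf.isBigO_sub.comp_tendsto hlim
  have h2 : (fun z : ℂ => circleReflection c r z - c) =O[cocompact ℂ] fun z => ‖z‖⁻¹ := by
    refine IsBigO.of_bound (2 * r ^ 2) ?_
    filter_upwards [tendsto_norm_cocompact_atTop (E := ℂ) |>.eventually_gt_atTop (2 * |c|)] with z hz
    rw [norm_circleReflection_sub, norm_inv, norm_norm]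
    have h3 : ‖z‖ / 2 ≤ ‖z - c‖ := by
      have := norm_sub_norm_le z (c : ℂ)
      rw [Complex.norm_real, Real.norm_eq_abs] at this
      linarith
    have h0 : 0 < ‖z‖ := by linarith [abs_nonneg c]
    rw [← div_eq_mul_inv, div_le_div_iff₀ (by linarith) h0]
    nlinarith [sq_nonneg r, mul_nonneg (sq_nonneg r) (sub_nonneg.2 h3)]
  refine IsBigO.trans ?_ h2
  refine (isBigO_of_le _ fun z => ?_).trans h1
  rw [← map_sub, Complex.norm_conj]

namespace NestedCircles

variable {ci ce ri re α : ℝ} (hc : NestedCircles ci ce ri re α)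
include hc

/-- The solution of the transmission problem for two nested circles, by the method of images. -/
theorem exists_solution {h h₁ : ℂ → ℂ} (hh : ∀ w, HasDerivAt h (h₁ w) w) {H σ : ℂ → ℝ}
    (hH : ∀ z, H z = (h z).re) {ki ke τi τe τ : ℝ} (hi : ki * (1 - τi) = ke * (1 + τi))
    (he : ke * (1 + τe) = 1 - τe) (hτ : τ = τi * τe) (hτ1 : |τ| < 1)
    (hσ₁ : ∀ z : ℂ, ‖z - ci‖ < ri → σ z = ki)
    (hσ₂ : ∀ z : ℂ, ri < ‖z - ci‖ → ‖z - ce‖ < re → σ z = ke)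
    (hσ₃ : ∀ z : ℂ, re < ‖z - ce‖ → σ z = 1) :
    ∃ (κ : ℂ) (u : ℂ → ℝ) (G : ℂ → ℂ), IsSolution σ H u G ∧
      (∀ z : ℂ, ‖z - ci‖ < ri →
        G z = conj ((1 - τi) * dpotA h₁ α (multiplier ci ce α) τ τe z)) ∧
      (∀ z : ℂ, ri < ‖z - ci‖ → ‖z - ce‖ < re →
        u z = (potA h α (multiplier ci ce α) τ τe z +
          potB (potA h α (multiplier ci ce α) τ τe) ci ri τi z - κ).re ∧
        G z = conj (dpotA h₁ α (multiplier ci ce α) τ τe z +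
          dpotB (dpotA h₁ α (multiplier ci ce α) τ τe) ci ri τi z)) ∧
      (∀ z : ℂ, re < ‖z - ce‖ → G z = conj (h₁ z + dpotB h₁ ce re (-τe) z +
        (1 - τe) * dpotB (dpotA h₁ α (multiplier ci ce α) τ τe) ci ri τi z)) := by
  classical
  set l := multiplier ci ce α
  set a := potA h α l τ τe with ha
  set a' := dpotA h₁ α l τ τe with ha'
  have hl0 := hc.multiplier_pos
  have hl1 := hc.multiplier_lt_one
  have hhd : Differentiable ℂ h := fun w => (hh w).differentiableAt
  have haD : ∀ z : ℂ, 0 < z.re → HasDerivAt a (a' z) z := fun z hz =>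
    hasDerivAt_potA hh hc.alpha_pos hl0 hl1 hτ1 hz
  have hbD : ∀ z : ℂ, z ≠ ci → 0 < (circleReflection ci ri z).re →
      HasDerivAt (potB a ci ri τi) (dpotB a' ci ri τi z) z := fun z hz hz' =>
    hasDerivAt_potB hz (haD _ hz')
  have hoD : ∀ z : ℂ, z ≠ ce →
      HasDerivAt (potB h ce re (-τe)) (dpotB h₁ ce re (-τe) z) z := fun z hz =>
    hasDerivAt_potB hz (hh _)
  -- The limit at infinity of the exterior image terms, both reflections sending infinity to their
  -- centres. Subtracting it in all three phases yields the required decay.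
  set κ : ℂ := τe * conj (h ce) - (1 - τe) * τi * conj (a ci) with hκ
  set f₁ : ℂ → ℂ := fun z => (1 - τi) * a z - κ with hf₁
  set f₂ : ℂ → ℂ := fun z => a z + potB a ci ri τi z - κ with hf₂
  set f₃ : ℂ → ℂ := fun z => h z + potB h ce re (-τe) z + (1 - τe) * potB a ci ri τi z - κ with hf₃
  have hd₁ : ∀ z : ℂ, 0 < z.re → HasDerivAt f₁ ((1 - τi) * a' z) z := fun z hz =>
    ((haD z hz).const_mul _).sub_const _
  have hd₂ : ∀ z : ℂ, 0 < z.re → z ≠ ci → 0 < (circleReflection ci ri z).re →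
      HasDerivAt f₂ (a' z + dpotB a' ci ri τi z) z := fun z h1 h2 h3 =>
    ((haD z h1).add (hbD z h2 h3)).sub_const _
  have hd₃ : ∀ z : ℂ, z ≠ ce → z ≠ ci → 0 < (circleReflection ci ri z).re →
      HasDerivAt f₃ (h₁ z + dpotB h₁ ce re (-τe) z + (1 - τe) * dpotB a' ci ri τi z) z :=
    fun z h1 h2 h3 => (((hh z).add (hoD z h1)).add ((hbD z h2 h3).const_mul _)).sub_const _
  have hre : ∀ z : ℂ, 0 < z.re → ∀ᶠ w : ℂ in 𝓝 z, 0 < w.re := fun z hz =>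
    (isOpen_lt continuous_const Complex.continuous_re).mem_nhds hz
  have hrefl : ∀ z : ℂ, ri ≤ ‖z - ci‖ → ∀ᶠ w : ℂ in 𝓝 z, 0 < (circleReflection ci ri w).re :=
    fun z hz => (continuousAt_circleReflection (hc.ne_ci hz)).eventually (hre _ (hc.re_refl_pos hz))
  have hne : ∀ (c : ℝ) (z : ℂ), z ≠ c → ∀ᶠ w : ℂ in 𝓝 z, w ≠ c := fun c z hz =>
    isOpen_ne.mem_nhds hz
  have hmid : ∀ z : ℂ, ri ≤ ‖z - ci‖ → ‖z - ce‖ ≤ re →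
      HasDerivAt f₂ (a' z + dpotB a' ci ri τi z) z := fun z h1 h2 =>
    hd₂ z (hc.re_pos_of_mem_e h2) (hc.ne_ci h1) (hc.re_refl_pos h1)
  have hout : ∀ z : ℂ, re ≤ ‖z - ce‖ →
      HasDerivAt f₃ (h₁ z + dpotB h₁ ce re (-τe) z + (1 - τe) * dpotB a' ci ri τi z) z :=
    fun z h1 => hd₃ z (hc.ne_ce h1) (hc.ne_ci (hc.lt_of_le_e h1).le)
      (hc.re_refl_pos (hc.lt_of_le_e h1).le)
  set u : ℂ → ℝ := fun z => if ‖z - ci‖ < ri then (f₁ z).re else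
    if ‖z - ce‖ < re then (f₂ z).re else (f₃ z).re with hu
  set G : ℂ → ℂ := fun z => if ‖z - ci‖ < ri then conj (deriv f₁ z) else
    if ‖z - ce‖ < re then conj (deriv f₂ z) else conj (deriv f₃ z) with hG
  have hu₁ : ∀ z : ℂ, ‖z - ci‖ < ri → u z = (f₁ z).re ∧ G z = conj (deriv f₁ z) := fun z hz => by
    simp only [hu, hG, if_pos hz, and_self]
  have hu₂ : ∀ z : ℂ, ri < ‖z - ci‖ → ‖z - ce‖ < re →
      u z = (f₂ z).re ∧ G z = conj (deriv f₂ z) := fun z hz hz' => by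
    simp only [hu, hG, if_neg hz.not_gt, if_pos hz', and_self]
  have hu₃ : ∀ z : ℂ, re < ‖z - ce‖ → u z = (f₃ z).re ∧ G z = conj (deriv f₃ z) := fun z hz => by
    simp only [hu, hG, if_neg (hc.lt_of_le_e hz.le).not_gt, if_neg hz.not_gt, and_self]
  refine ⟨κ, u, G, ?_, ?_, ?_, ?_⟩
  · refine isSolution_of_potentials (c₁ := ci) (c₂ := ce) (r₁ := ri) (r₂ := re) (f₁ := f₁)
      (f₂ := f₂) (f₃ := f₃) (k₁ := ki) (k₂ := ke) (k₃ := 1) hc.ri_pos ?_ ?_ ?_ ?_ ?_ ?_ ?_ ?_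
      ?_ ?_ ?_ ?_
    · rw [← Complex.ofReal_sub, Complex.norm_real, Real.norm_eq_abs, abs_sub_comm,
        abs_of_pos (sub_pos.2 hc.lt)]
      exact hc.nest
    · intro z hz
      rw [Complex.analyticAt_iff_eventually_differentiableAt]
      filter_upwards [hre z (hc.re_pos_of_mem_i hz)] with w hw
      exact (hd₁ w hw).differentiableAt
    · intro z hz hz'
      rw [Complex.analyticAt_iff_eventually_differentiableAt]
      filter_upwards [hre z (hc.re_pos_of_mem_e hz'), hne ci z (hc.ne_ci hz), hrefl z hz]
        with w h1 h2 h3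
      exact (hd₂ w h1 h2 h3).differentiableAt
    · intro z hz
      have hz' := (hc.lt_of_le_e hz).le
      rw [Complex.analyticAt_iff_eventually_differentiableAt]
      filter_upwards [hne ce z (hc.ne_ce hz), hne ci z (hc.ne_ci hz'), hrefl z hz'] with w h1 h2 h3
      exact (hd₃ w h1 h2 h3).differentiableAt
    · intro z hz
      simp only [hf₁, hf₂, potB, circleReflection_of_mem hc.ri_pos hz]
      simp [Complex.mul_re]
      ring
    · intro z hz
      simp only [hf₂, hf₃, potB, circleReflection_of_mem hc.re_pos hz]
      have h1 := potA_eq (τe := τe) hhd hc.alpha_pos hl0 hl1 hτ1 (hc.re_pos_of_mem_e hz.le)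
      rw [(hc.orbit_on_circle hz).1, ← ha] at h1
      rw [h1, hτ]
      simp [Complex.mul_re]
      ring
    · intro z hz
      have hz0 : z - ci ≠ 0 := sub_ne_zero.2 (hc.ne_ci hz.ge)
      rw [(hd₁ z (hc.re_pos_of_mem_i hz.le)).deriv,
        (hmid z hz.ge (hc.mem_e_of_mem_i hz.le).le).deriv, dpotB, circleReflection_of_mem hc.ri_pos hz,
        ← sub_mul_conj_sub hz]
      have e : (z - ci) * (a' z + τi * (conj (a' z) * ((z - ci) * conj (z - ci) / (z - ci) ^ 2))) =
          (z - ci) * a' z + τi * conj ((z - ci) * a' z) := by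
        rw [map_mul]
        field_simp
      have e' : (z - ci) * ((1 - τi) * a' z) = (1 - τi : ℝ) * ((z - ci) * a' z) := by
        push_cast; ring
      rw [e, e', Complex.re_ofReal_mul, Complex.add_re, Complex.re_ofReal_mul, Complex.conj_re]
      linear_combination ((z - ci) * a' z).re * hi
    · intro z hz
      have hz0 : z - ce ≠ 0 := sub_ne_zero.2 (hc.ne_ce hz.ge)
      have h1 := dpotA_eq (τe := τe) hh hc.alpha_pos hl0 hl1 hτ1 (hc.re_pos_of_mem_e hz.le)
      have h2 := hc.orbit_on_circle hz
      rw [h2.1, ← ha'] at h1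
      rw [(hmid z (hc.lt_of_le_e hz.ge).le hz.le).deriv, (hout z hz.ge).deriv, h1, dpotB, dpotB,
        circleReflection_of_mem hc.re_pos hz, ← sub_mul_conj_sub hz]
      set A := a' (circleReflection ci ri z)
      set X := (z - ce) * ((ri : ℂ) ^ 2 / (z - ci) ^ 2) with hX
      have e2 : (z - ce) * ((1 + τe) * h₁ z + τ * (A * (4 * α ^ 2 * l / orbitDenom α l z ^ 2)) +
          τi * (conj A * (ri ^ 2 / (z - ci) ^ 2))) =
          (1 + τe : ℝ) * ((z - ce) * h₁ z) + (τ : ℝ) * conj (conj A * X) + (τi : ℝ) * (conj A * X) := by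
        rw [map_mul, Complex.conj_conj, hX, ← h2.2]
        push_cast
        ring
      have e3 : (z - ce) * (h₁ z + ((-τe : ℝ) : ℂ) * (conj (h₁ z) *
            ((z - ce) * conj (z - ce) / (z - ce) ^ 2)) +
          (1 - τe) * (τi * (conj A * (ri ^ 2 / (z - ci) ^ 2)))) =
          (z - ce) * h₁ z - (τe : ℝ) * conj ((z - ce) * h₁ z) +
            ((1 - τe) * τi : ℝ) * (conj A * X) := by
        rw [map_mul, hX]
        push_cast
        field_simp
        ring
      rw [e2, e3]
      simp only [Complex.add_re, Complex.sub_re, Complex.re_ofReal_mul, Complex.conj_re, hτ]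
      linear_combination (((z - ce) * h₁ z).re + τi * (conj A * X).re) * he
    · exact fun z hz => ⟨(hu₁ z hz).1, (hu₁ z hz).2, hσ₁ z hz⟩
    · exact fun z hz hz' => ⟨(hu₂ z hz hz').1, (hu₂ z hz hz').2, hσ₂ z hz hz'⟩
    · exact fun z hz => ⟨(hu₃ z hz).1, (hu₃ z hz).2, hσ₃ z hz⟩
    · refine IsBigO.mono ?_ inf_le_left
      have ho := isBigO_conj_circleReflection_sub (r := re) (hhd ce)
      have hi := isBigO_conj_circleReflection_sub (r := ri)
        (haD ci (by simpa using hc.ci_pos)).differentiableAt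
      have hsum := (ho.const_mul_left (τe : ℂ)).sub (hi.const_mul_left ((1 - τe) * τi : ℂ))
      refine IsBigO.trans ?_ hsum
      refine IsBigO.of_bound 1 ?_
      filter_upwards [tendsto_norm_cocompact_atTop (E := ℂ) |>.eventually_gt_atTop (re + |ce|)]
        with z hz
      have hz' : re < ‖z - ce‖ := by
        have := norm_sub_norm_le z (ce : ℂ)
        rw [Complex.norm_real, Real.norm_eq_abs] at this
        linarith
      rw [(hu₃ z hz').1, hH, one_mul, ← Complex.sub_re, Real.norm_eq_abs]
      refine (Complex.abs_re_le_norm _).trans_eq (congrArg _ ?_)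
      simp only [hf₃, hκ, potB]
      push_cast
      ring
  · intro z hz
    rw [(hu₁ z hz).2, (hd₁ z (hc.re_pos_of_mem_i hz.le)).deriv]
  · intro z hz hz'
    rw [(hu₂ z hz hz').1, (hu₂ z hz hz').2, (hmid z hz.le hz'.le).deriv]
    exact ⟨rfl, rfl⟩
  · intro z hz
    rw [(hu₃ z hz).2, (hout z hz.le).deriv]

end NestedCircles

/-! ### The core-shell structure: parameters, geometry, and identification of all solutions with the
image solution. -/

namespace CoreShell

section Material

variable {ki ke : ℝ}

theorem abs_tauI_lt_one (hi : 0 < ki) (he : 0 < ke) : |tauI ki ke| < 1 := by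
  rw [tauI, abs_lt, lt_div_iff₀ (by positivity), div_lt_iff₀ (by positivity)]
  constructor <;> linarith

theorem abs_tauE_lt_one (he : 0 < ke) : |tauE ke| < 1 := by
  rw [tauE, abs_lt, lt_div_iff₀ (by positivity), div_lt_iff₀ (by positivity)]
  constructor <;> linarith

theorem abs_tau_lt_one (hi : 0 < ki) (he : 0 < ke) : |tau ki ke| < 1 := by
  rw [tau, abs_mul]
  exact mul_lt_one_of_nonneg_of_lt_one_left (abs_nonneg _) (abs_tauI_lt_one hi he)
    (abs_tauE_lt_one he).le

/-- In the core the potential carries the transmission factor `1 - τ_i` besides the `1 + τ_e` of the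
series; together they compensate for the `1 / (1 - τ)` of Abel summation. -/
theorem one_sub_tauI_mul_le (hi : 0 < ki) (he : 0 < ke) :
    (1 - tauI ki ke) * (1 + tauE ke) ≤ 2 * (1 - tau ki ke) := by
  have e : 2 * (1 - tau ki ke) - (1 - tauI ki ke) * (1 + tauE ke) =
      4 * ke * ki / ((ki + ke) * (1 + ke)) := by
    rw [tau, tauI, tauE]; field_simp; ring
  have : 0 ≤ 4 * ke * ki / ((ki + ke) * (1 + ke)) := by positivity
  linarith

/-- The same compensation in the exterior, where the factor is `1 - τ_e`. -/
theorem one_sub_tauE_mul_le (hi : 0 < ki) (he : 0 < ke) :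
    (1 - tauE ke) * (1 + tauE ke) ≤ 2 * (1 - tau ki ke) := by
  have e : 2 * (1 - tau ki ke) - (1 - tauE ke) * (1 + tauE ke) =
      4 * ke * (1 + ki * ke) / ((ki + ke) * (1 + ke) ^ 2) := by
    rw [tau, tauI, tauE]; field_simp; ring
  have : 0 ≤ 4 * ke * (1 + ki * ke) / ((ki + ke) * (1 + ke) ^ 2) := by positivity
  linarith

/-- The factor `1 + τ_e` is essential: `τ` also approaches `1` when both `τ_i` and `τ_e` approach
`-1`, but for negative values `1 - τ ≥ 1 + τ_e`. If both are nonnegative, `τ` is at most each of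
them. -/
theorem one_add_tauE_le {δ : ℝ} (hδ : 0 < δ) (hδ1 : δ ≤ 1) (hi : 0 < ki) (he : 0 < ke)
    (h : tauI ki ke ≤ 1 - δ ∨ tauE ke ≤ 1 - δ) : δ * (1 + tauE ke) ≤ 2 * (1 - tau ki ke) := by
  have h1 := abs_lt.1 (abs_tauI_lt_one hi he)
  have h2 := abs_lt.1 (abs_tauE_lt_one he)
  rw [tau]
  by_cases h0 : tauI ki ke * tauE ke ≤ 1 - δ
  · nlinarith
  · push Not at h0
    rcases lt_or_ge (tauE ke) 0 with hn | hp
    · have : tauI ki ke < 0 := by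
        by_contra! h3
        nlinarith
      nlinarith
    · have : 0 ≤ tauI ki ke := by
        by_contra! h3
        nlinarith
      rcases h with h | h <;> nlinarith

theorem mul_one_sub_tauI (hi : 0 < ki) (he : 0 < ke) :
    ki * (1 - tauI ki ke) = ke * (1 + tauI ki ke) := by
  rw [tauI]; field_simp; ring

theorem mul_one_add_tauE (he : 0 < ke) : ke * (1 + tauE ke) = 1 - tauE ke := by
  rw [tauE]; field_simp; ring

end Material

section Geometry

variable {ri re ε : ℝ}

theorem nestedCircles (hri : 0 < ri) (hre : ri < re) (hε : 0 < ε) (hε1 : ε < re - ri) :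
    NestedCircles (centerI ri re ε) (centerE ri re ε) ri re (alpha ri re ε) := by
  have hd : 0 < re - ri - ε := by linarith
  have hp : 0 < ε * (2 * ri + ε) * (2 * re - ε) * (2 * re - 2 * ri - ε) := by
    have h1 : 0 < 2 * re - ε := by linarith
    have h2 : 0 < 2 * re - 2 * ri - ε := by linarith
    positivity
  have hsq : alpha ri re ε ^ 2 =
      ε * (2 * ri + ε) * (2 * re - ε) * (2 * re - 2 * ri - ε) / (2 * (re - ri - ε)) ^ 2 := by
    rw [alpha, div_pow, Real.sq_sqrt hp.le]
  refine ⟨hri, ?_, ?_, ?_, ?_, ?_, ?_⟩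
  · rw [centerI]
    refine div_pos ?_ (by linarith)
    nlinarith
  · rw [centerE]; linarith
  · rw [centerE]; linarith
  · exact div_pos (Real.sqrt_pos.2 hp) (by linarith)
  · rw [hsq, centerI]; field_simp; ring
  · rw [hsq, centerE, centerI]; field_simp; ring

theorem mem_diskI_iff {z : ℂ} : z ∈ diskI ri re ε ↔ ‖z - centerI ri re ε‖ < ri :=
  mem_ball_iff_norm

theorem mem_diskE_iff {z : ℂ} : z ∈ diskE ri re ε ↔ ‖z - centerE ri re ε‖ < re :=
  mem_ball_iff_norm

theorem mem_shell_iff (hri : ri ≠ 0) {z : ℂ} : z ∈ shell ri re ε ↔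
    ri < ‖z - centerI ri re ε‖ ∧ ‖z - centerE ri re ε‖ < re := by
  rw [shell, Set.mem_sdiff, mem_diskE_iff, diskI, closure_ball _ hri, mem_closedBall_iff_norm, not_le,
    and_comm]

theorem measurable_conductivity {ki ke : ℝ} : Measurable (conductivity ri re ε ki ke) := by
  classical
  unfold conductivity
  refine Measurable.ite Metric.isOpen_ball.measurableSet measurable_const ?_
  exact Measurable.ite Metric.isOpen_ball.measurableSet measurable_const measurable_const

theorem conductivity_bounds {ki ke : ℝ} (z : ℂ) :
    min ki (min ke 1) ≤ conductivity ri re ε ki ke z ∧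
      conductivity ri re ε ki ke z ≤ max ki (max ke 1) := by
  unfold conductivity
  split_ifs <;> simp

end Geometry

theorem exists_entire {H : ℂ → ℝ} (hH : HarmonicOnNhd H univ) :
    ∃ h h₁ h₂ : ℂ → ℂ, (∀ w, HasDerivAt h (h₁ w) w) ∧ (∀ w, HasDerivAt h₁ (h₂ w) w) ∧
      Continuous h₂ ∧ (∀ z, H z = (h z).re) ∧ ∀ z, ∇ H z = conj (h₁ z) := by
  obtain ⟨h, hh, hre⟩ := hH.exists_analyticOnNhd_univ_re_eq
  have h0 : Differentiable ℂ h := fun w => (hh w (mem_univ w)).differentiableAt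
  have h1 : AnalyticOnNhd ℂ (deriv h) univ := hh.deriv
  have h2 : AnalyticOnNhd ℂ (deriv (deriv h)) univ := h1.deriv
  refine ⟨h, deriv h, deriv (deriv h), fun w => (h0 w).hasDerivAt,
    fun w => (h1 w (mem_univ w)).differentiableAt.hasDerivAt, ?_, fun z => by rw [← hre], fun z => ?_⟩
  · exact continuous_iff_continuousAt.2 fun w => (h2 w (mem_univ w)).continuousAt
  · rw [← hre]
    exact (hasGradientAt_re (h0 z).hasDerivAt).gradient

section Solution

variable {ri re ε ki ke : ℝ} {H : ℂ → ℝ} {h h₁ : ℂ → ℂ} {u : ℂ → ℝ} {G : ℂ → ℂ}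

/-- Every solution agrees with the one obtained by the method of images. -/
theorem IsSolution.eq_images (hri : 0 < ri) (hre : ri < re) (hε : 0 < ε) (hε1 : ε < re - ri)
    (hi : 0 < ki) (he : 0 < ke) (hh : ∀ w, HasDerivAt h (h₁ w) w) (hH : ∀ z, H z = (h z).re)
    {a a' : ℂ → ℂ}
    (ha : a = potA h (alpha ri re ε) (multiplier (centerI ri re ε) (centerE ri re ε) (alpha ri re ε))
      (tau ki ke) (tauE ke))
    (ha' : a' = dpotA h₁ (alpha ri re ε)
      (multiplier (centerI ri re ε) (centerE ri re ε) (alpha ri re ε)) (tau ki ke) (tauE ke))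
    (hu : IsSolution (conductivity ri re ε ki ke) H u G) :
    ∃ κ : ℝ, ∀ᵐ z : ℂ,
      (‖z - centerI ri re ε‖ < ri → G z = conj ((1 - tauI ki ke) * a' z)) ∧
      (ri < ‖z - centerI ri re ε‖ → ‖z - centerE ri re ε‖ < re →
        u z = (a z + potB a (centerI ri re ε) ri (tauI ki ke) z).re + κ ∧
        G z = conj (a' z + dpotB a' (centerI ri re ε) ri (tauI ki ke) z)) ∧
      (re < ‖z - centerE ri re ε‖ → G z = conj (h₁ z + dpotB h₁ (centerE ri re ε) re (-tauE ke) z +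
        (1 - tauE ke) * dpotB a' (centerI ri re ε) ri (tauI ki ke) z)) := by
  have hc := nestedCircles hri hre hε hε1
  obtain ⟨κ, v, F, hv, h1, h2, h3⟩ := hc.exists_solution hh (H := H)
    (σ := conductivity ri re ε ki ke) hH (mul_one_sub_tauI hi he) (mul_one_add_tauE he)
    (rfl : tau ki ke = _) (abs_tau_lt_one hi he)
    (fun z hz => if_pos (mem_diskI_iff.2 hz))
    (fun z hz hz' => by
      rw [conductivity, if_neg (fun h => hz.not_gt (mem_diskI_iff.1 h)), if_pos (mem_diskE_iff.2 hz')])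
    (fun z hz => by
      rw [conductivity, if_neg (fun h => (hc.lt_of_le_e hz.le).not_gt (mem_diskI_iff.1 h)),
        if_neg (fun h => hz.not_gt (mem_diskE_iff.1 h))])
  rw [← ha, ← ha'] at h2
  rw [← ha'] at h1 h3
  obtain ⟨hG, c, hc'⟩ := hu.unique hv measurable_conductivity
    (lt_min hi (lt_min he one_pos)) (fun z => (conductivity_bounds z).1)
    (fun z => (conductivity_bounds z).2)
  refine ⟨c - κ.re, ?_⟩
  filter_upwards [hG, hc'] with z hz hz'
  rw [hz, hz']
  refine ⟨h1 z, fun h4 h5 => ⟨?_, (h2 z h4 h5).2⟩, h3 z⟩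
  rw [(h2 z h4 h5).1, Complex.sub_re]
  ring

end Solution

/-! ### Estimates uniform in `ε`, `k_i` and `k_e`. -/

section Bounds

variable {ri re ε₀ : ℝ}

/-- As `re - ri - ε` stays away from `0`, the outer disk and all orbits starting in it lie in one
ball; the suprema of the derivatives of `h` are then independent of `ε`. -/
theorem centerE_add_le (hri : 0 < ri) (hre : ri < re) (hε₀ : ε₀ < re - ri) {ε : ℝ} (hε : 0 < ε)
    (hε1 : ε ≤ ε₀) {z : ℂ} (hz : ‖z - centerE ri re ε‖ ≤ re) :
    ‖z‖ + alpha ri re ε ≤ 3 * re ^ 2 / (re - ri - ε₀) := by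
  have hc := nestedCircles hri hre hε (hε1.trans_lt hε₀)
  have h1 : ‖z‖ ≤ re + centerE ri re ε := by
    have := norm_sub_norm_le z (centerE ri re ε)
    rw [Complex.norm_real, Real.norm_eq_abs, abs_of_pos (hc.ci_pos.trans hc.lt)] at this
    linarith
  have h2 : centerE ri re ε ≤ re ^ 2 / (re - ri - ε₀) := by
    have hd : 0 < re - ri - ε := by linarith
    have e : centerE ri re ε = (re ^ 2 - ri ^ 2 + (re - ri - ε) ^ 2) / (2 * (re - ri - ε)) := by
      rw [centerE, centerI]; field_simp; ring
    rw [e, div_le_div_iff₀ (by linarith) (by linarith)]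
    have : re ^ 2 - ri ^ 2 + (re - ri - ε) ^ 2 ≤ 2 * re ^ 2 := by nlinarith
    calc _ ≤ (2 * re ^ 2) * (re - ri - ε₀) := by gcongr
      _ ≤ (2 * re ^ 2) * (re - ri - ε) := by gcongr
      _ = _ := by ring
  have h3 := hc.re_lt
  have h4 := hc.alpha_lt.trans hc.lt
  have e : 3 * re ^ 2 / (re - ri - ε₀) = 3 * (re ^ 2 / (re - ri - ε₀)) := by ring
  rw [e]; linarith

/-- Outside its circle the reflection has derivative of modulus `r² / ‖z - c‖² ≤ 1`. -/
theorem norm_dpotB_le {a' : ℂ → ℂ} {c r τi B : ℝ} {z : ℂ} (hr : 0 < r) (hz : r ≤ ‖z - c‖)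
    (hτ : |τi| < 1) (hB : ‖a' (circleReflection c r z)‖ ≤ B) : ‖dpotB a' c r τi z‖ ≤ B := by
  have hB0 : 0 ≤ B := (norm_nonneg _).trans hB
  rw [dpotB, norm_mul, norm_mul, Complex.norm_real, Complex.norm_conj, norm_div, norm_pow, norm_pow,
    Complex.norm_real, Real.norm_of_nonneg hr.le, Real.norm_eq_abs]
  have h1 : r ^ 2 / ‖z - c‖ ^ 2 ≤ 1 := by
    rw [div_le_one (by have := hr.trans_le hz; positivity)]
    gcongr
  calc _ ≤ 1 * (B * 1) := by gcongr
    _ = B := by ring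

/-- `orbitTerm_sum_le` with suprema over the fixed ball. Neither `1 - τ` nor `1 + τ_e` is estimated
yet: in each region they are played off against other factors. -/
theorem exists_norm_dpotA_le {h₁ h₂ : ℂ → ℂ} (hd : ∀ w, HasDerivAt h₁ (h₂ w) w) (hh₂ : Continuous h₂)
    (hri : 0 < ri) (hre : ri < re) (hε₀ : ε₀ < re - ri) :
    ∃ M₁ M₂ B : ℝ, 0 ≤ M₁ ∧ 0 ≤ M₂ ∧ 0 ≤ B ∧ ∀ ε : ℝ, 0 < ε → ε ≤ ε₀ →
      ∀ z : ℂ, ‖z - centerE ri re ε‖ ≤ re →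
        (∀ w, ‖w‖ ≤ ‖z‖ + alpha ri re ε → ‖h₁ w‖ ≤ M₁) ∧
        (∀ w, ‖w‖ ≤ ‖z‖ + alpha ri re ε → ‖h₂ w‖ ≤ M₂) ∧
        ‖h₁ z‖ ≤ M₁ ∧
        ∀ ki ke : ℝ, 0 < ki → 0 < ke → (1 - tau ki ke) * ‖dpotA h₁ (alpha ri re ε)
          (multiplier (centerI ri re ε) (centerE ri re ε) (alpha ri re ε)) (tau ki ke) (tauE ke) z‖ ≤
            (1 + tauE ke) * B := by
  set A := 3 * re ^ 2 / (re - ri - ε₀) with hA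
  have hA0 : 0 ≤ A := by
    have : 0 < re - ri - ε₀ := by linarith
    positivity
  have hh₁ : Continuous h₁ := continuous_iff_continuousAt.2 fun w => (hd w).continuousAt
  obtain ⟨M₁, hM₁⟩ := (isCompact_closedBall (0 : ℂ) A).exists_bound_of_continuousOn
    hh₁.continuousOn
  obtain ⟨M₂, hM₂⟩ := (isCompact_closedBall (0 : ℂ) A).exists_bound_of_continuousOn
    hh₂.continuousOn
  have hM₁0 : 0 ≤ M₁ := (norm_nonneg _).trans (hM₁ 0 (by simpa using hA0))
  have hM₂0 : 0 ≤ M₂ := (norm_nonneg _).trans (hM₂ 0 (by simpa using hA0))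
  refine ⟨M₁, M₂, 8 * M₁ + (M₁ + M₂ * A) * 108, hM₁0, hM₂0, by positivity,
    fun ε hε hε1 z hz => ?_⟩
  have hc := nestedCircles hri hre hε (hε1.trans_lt hε₀)
  have hzA := centerE_add_le hri hre hε₀ hε hε1 hz
  have b1 : ∀ w, ‖w‖ ≤ ‖z‖ + alpha ri re ε → ‖h₁ w‖ ≤ M₁ := fun w hw =>
    hM₁ w (mem_closedBall_zero_iff.2 (hw.trans hzA))
  have b2 : ∀ w, ‖w‖ ≤ ‖z‖ + alpha ri re ε → ‖h₂ w‖ ≤ M₂ := fun w hw =>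
    hM₂ w (mem_closedBall_zero_iff.2 (hw.trans hzA))
  refine ⟨b1, b2, b1 z (by linarith [hc.alpha_pos]), fun ki ke hi he => ?_⟩
  have h1 := (orbitTerm_sum_le hc.alpha_pos (hc.re_pos_of_mem_e hz).le hd b1 b2 hc.multiplier_pos
    hc.multiplier_lt_one (abs_tau_lt_one hi he)).2
  have h2 := abs_lt.1 (abs_tauE_lt_one he)
  rw [dpotA, norm_mul]
  have h3 : ‖(1 + tauE ke : ℂ)‖ = 1 + tauE ke := by
    rw [← Complex.ofReal_one, ← Complex.ofReal_add, Complex.norm_real, Real.norm_of_nonneg (by linarith)]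
  rw [h3, mul_left_comm]
  refine mul_le_mul_of_nonneg_left (h1.trans ?_) (by linarith)
  gcongr

end Bounds

end CoreShell

/-! ### Gradient bounds outside the shell, and in the shell away from the critical regime. -/

namespace CoreShell

variable {ri re ε₀ : ℝ}

theorem ae_norm_sub_center_ne (hri : 0 < ri) (hre : ri < re) (ε : ℝ) :
    ∀ᵐ z : ℂ, ‖z - centerI ri re ε‖ ≠ ri ∧ ‖z - centerE ri re ε‖ ≠ re := by
  filter_upwards [ae_norm_sub_ne (centerI ri re ε : ℂ) hri.ne',
    ae_norm_sub_ne (centerE ri re ε : ℂ) (hri.trans hre).ne'] with z h1 h2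
  exact ⟨h1, h2⟩

/-- Outside the shell the gradient of the perturbation is bounded. -/
theorem exists_bound_outside_shell (hri : 0 < ri) (hre : ri < re) {H : ℂ → ℝ}
    (hH : HarmonicOnNhd H univ) (hε₀ : ε₀ < re - ri) :
    ∃ C : ℝ, ∀ ε ki ke : ℝ, 0 < ε → ε ≤ ε₀ → 0 < ki → 0 < ke →
      ∀ (u : ℂ → ℝ) (G : ℂ → ℂ), IsSolution (conductivity ri re ε ki ke) H u G →
        ∀ᵐ z : ℂ, z ∉ shell ri re ε → ‖G z - ∇ H z‖ ≤ C := by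
  obtain ⟨h, h₁, h₂, hh, hd, hh₂, hHre, hgrad⟩ := exists_entire hH
  obtain ⟨M₁, M₂, B, hM₁, -, hB, hbd⟩ := exists_norm_dpotA_le hd hh₂ hri hre hε₀
  refine ⟨2 * B + M₁, fun ε ki ke hε hε1 hi he u G hu => ?_⟩
  have hc := nestedCircles hri hre hε (hε1.trans_lt hε₀)
  set a' := dpotA h₁ (alpha ri re ε)
    (multiplier (centerI ri re ε) (centerE ri re ε) (alpha ri re ε)) (tau ki ke) (tauE ke) with ha'
  obtain ⟨κ, hκ⟩ := hu.eq_images hri hre hε (hε1.trans_lt hε₀) hi he hh hHre rfl ha'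
  have hti := abs_lt.1 (abs_tauI_lt_one hi he)
  have hte := abs_lt.1 (abs_tauE_lt_one he)
  have ht := abs_lt.1 (abs_tau_lt_one hi he)
  -- Applied with `s = 1 - τ_i` in the core and `s = 1 - τ_e` in the exterior.
  have key : ∀ s : ℝ, 0 ≤ s → s * (1 + tauE ke) ≤ 2 * (1 - tau ki ke) → ∀ z : ℂ,
      ‖z - centerE ri re ε‖ ≤ re → s * ‖a' z‖ ≤ 2 * B := fun s hs hs2 z hz => by
    have h1 := (hbd ε hε hε1 z hz).2.2.2 ki ke hi he
    have h2 := mul_le_mul_of_nonneg_left h1 hs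
    have h3 := mul_le_mul_of_nonneg_right hs2 hB
    refine le_of_mul_le_mul_left ?_ (sub_pos.2 ht.2)
    calc _ = s * ((1 - tau ki ke) * ‖a' z‖) := by ring
      _ ≤ s * ((1 + tauE ke) * B) := h2
      _ = s * (1 + tauE ke) * B := by ring
      _ ≤ 2 * (1 - tau ki ke) * B := h3
      _ = _ := by ring
  have hnorm : ∀ s : ℝ, s < 1 → ∀ w : ℂ, ‖(1 - s : ℂ) * w‖ = (1 - s) * ‖w‖ := fun s hs w => by
    rw [norm_mul, ← Complex.ofReal_one, ← Complex.ofReal_sub, Complex.norm_real,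
      Real.norm_of_nonneg (by linarith)]
  filter_upwards [hκ, ae_norm_sub_center_ne hri hre ε] with z ⟨h1, _, h3⟩ ⟨hz1, hz2⟩ hz
  rw [mem_shell_iff hri.ne', not_and_or, not_lt, not_lt] at hz
  rw [hgrad]
  rcases hz with hz | hz
  · have hze := (hc.mem_e_of_mem_i hz).le
    rw [h1 (lt_of_le_of_ne hz hz1), ← map_sub, Complex.norm_conj]
    refine (norm_sub_le _ _).trans (add_le_add ?_ (hbd ε hε hε1 z hze).2.2.1)
    rw [hnorm _ hti.2]
    exact key _ (by linarith) (one_sub_tauI_mul_le hi he) z hze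
  · have hzi := (hc.lt_of_le_e hz).le
    rw [h3 (lt_of_le_of_ne hz (Ne.symm hz2)), ← map_sub, Complex.norm_conj]
    have e : ∀ x y w : ℂ, x + y + w - x = w + y := fun x y w => by ring
    rw [e]
    refine (norm_add_le _ _).trans (add_le_add ?_ ?_)
    · rw [hnorm _ hte.2]
      have hze : ‖circleReflection (centerI ri re ε) ri z - centerE ri re ε‖ ≤ re :=
        (hc.mem_e_of_mem_i (norm_circleReflection_sub_le hri hzi)).le
      exact (mul_le_mul_of_nonneg_left (norm_dpotB_le hri hzi (abs_tauI_lt_one hi he) le_rfl)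
        (by linarith)).trans (key _ (by linarith) (one_sub_tauE_mul_le hi he) _ hze)
    · refine norm_dpotB_le hc.re_pos hz (by rw [abs_neg]; exact abs_tauE_lt_one he) ?_
      exact (hbd ε hε hε1 _ (norm_circleReflection_sub_le hc.re_pos hz)).2.2.1

/-- If `τ_i` or `τ_e` stays away from `1`, the gradient is bounded in the shell. -/
theorem exists_bound_in_shell (hri : 0 < ri) (hre : ri < re) {H : ℂ → ℝ}
    (hH : HarmonicOnNhd H univ) (hε₀ : ε₀ < re - ri) {δ : ℝ} (hδ : 0 < δ) :
    ∃ C : ℝ, ∀ ε ki ke : ℝ, 0 < ε → ε ≤ ε₀ → 0 < ki → 0 < ke →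
      (tauI ki ke ≤ 1 - δ ∨ tauE ke ≤ 1 - δ) →
      ∀ (u : ℂ → ℝ) (G : ℂ → ℂ), IsSolution (conductivity ri re ε ki ke) H u G →
        ∀ᵐ z : ℂ, z ∈ shell ri re ε → ‖G z - ∇ H z‖ ≤ C := by
  obtain ⟨h, h₁, h₂, hh, hd, hh₂, hHre, hgrad⟩ := exists_entire hH
  obtain ⟨M₁, M₂, B, hM₁, -, hB, hbd⟩ := exists_norm_dpotA_le hd hh₂ hri hre hε₀
  -- `one_add_tauE_le` needs a parameter at most `1`; decreasing `δ` weakens the hypothesis on `τ_i`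
  -- and `τ_e`.
  set η := min δ 1 with hη
  have hη0 : 0 < η := lt_min hδ one_pos
  refine ⟨2 * B / η + 2 * B / η + M₁, fun ε ki ke hε hε1 hi he hτ u G hu => ?_⟩
  have hc := nestedCircles hri hre hε (hε1.trans_lt hε₀)
  set a' := dpotA h₁ (alpha ri re ε)
    (multiplier (centerI ri re ε) (centerE ri re ε) (alpha ri re ε)) (tau ki ke) (tauE ke) with ha'
  obtain ⟨κ, hκ⟩ := hu.eq_images hri hre hε (hε1.trans_lt hε₀) hi he hh hHre rfl ha'
  have ht := abs_lt.1 (abs_tau_lt_one hi he)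
  have hτ' : η * (1 + tauE ke) ≤ 2 * (1 - tau ki ke) :=
    one_add_tauE_le hη0 (min_le_right _ _) hi he
      (hτ.imp (fun h => h.trans (by linarith [min_le_left δ 1]))
        fun h => h.trans (by linarith [min_le_left δ 1]))
  have key : ∀ z : ℂ, ‖z - centerE ri re ε‖ ≤ re → ‖a' z‖ ≤ 2 * B / η := fun z hz => by
    have h1 := (hbd ε hε hε1 z hz).2.2.2 ki ke hi he
    have h3 := mul_le_mul_of_nonneg_right hτ' hB
    rw [le_div_iff₀ hη0]
    refine le_of_mul_le_mul_left ?_ (sub_pos.2 ht.2)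
    calc _ = η * ((1 - tau ki ke) * ‖a' z‖) := by ring
      _ ≤ η * ((1 + tauE ke) * B) := mul_le_mul_of_nonneg_left h1 hη0.le
      _ = η * (1 + tauE ke) * B := by ring
      _ ≤ 2 * (1 - tau ki ke) * B := h3
      _ = _ := by ring
  filter_upwards [hκ] with z ⟨_, h2, _⟩ hz
  rw [mem_shell_iff hri.ne'] at hz
  rw [hgrad, (h2 hz.1 hz.2).2, ← map_sub, Complex.norm_conj]
  refine (norm_sub_le _ _).trans (add_le_add ((norm_add_le _ _).trans (add_le_add ?_ ?_))
    (hbd ε hε hε1 z hz.2.le).2.2.1)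
  · exact key z hz.2.le
  · exact norm_dpotB_le hri hz.1.le (abs_tauI_lt_one hi he)
      (key _ (hc.mem_e_of_mem_i (norm_circleReflection_sub_le hri hz.1.le)).le)

end CoreShell

/-! ### The complex potential of the line charges. -/

/-- Complex potential of the line charges. -/
noncomputable def imagePotential (α β : ℝ) (z : ℂ) : ℂ :=
  ∫ q in (0 : ℝ)..1, ((q ^ β : ℝ) : ℂ) * ((z - α) / orbitDenom α q z)

section ImagePotential

variable {α β : ℝ} {z : ℂ}

theorem continuousOn_div_orbitDenom (hα : 0 < α) (hz : 0 ≤ z.re) (w : ℂ) :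
    ContinuousOn (fun q : ℝ => w / orbitDenom α q z) (Icc 0 1) :=
  continuousOn_const.div continuousOn_orbitDenom_param
    fun _ hq => orbitDenom_ne_zero hα hq.1 hq.2 hz

theorem hasDerivAt_div_orbitDenom {q : ℝ} (hN : orbitDenom α q z ≠ 0) :
    HasDerivAt (fun z => (z - α) / orbitDenom α q z) (2 * α / orbitDenom α q z ^ 2) z := by
  have h1 : HasDerivAt (fun z => orbitDenom α q z) (1 - q : ℂ) z := by
    have := ((hasDerivAt_id z).const_mul (1 - q : ℂ)).add_const ((1 + q : ℂ) * α)
    simpa [orbitDenom] using this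
  refine (((hasDerivAt_id z).sub_const (α : ℂ)).div h1 hN).congr_deriv ?_
  congr 1
  simp only [orbitDenom, id]
  ring

/-- The `z`-derivative of `(z - α)/N` is `2α / N²`, which is the kernel of `kernelIntegral` divided
by `2α`; the bound `2/α` on the half plane permits differentiation under the integral. -/
theorem hasDerivAt_imagePotential (hα : 0 < α) (hβ : 0 ≤ β) (hz : 0 < z.re) :
    HasDerivAt (imagePotential α β) (kernelIntegral α β z / (2 * α)) z := by
  have hα' : (α : ℂ) ≠ 0 := Complex.ofReal_ne_zero.2 hα.ne'
  have hI : uIoc (0 : ℝ) 1 = Ioc 0 1 := uIoc_of_le zero_le_one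
  have hmeas : ∀ {f : ℝ → ℂ}, ContinuousOn f (Icc 0 1) →
      AEStronglyMeasurable (fun q : ℝ => ((q ^ β : ℝ) : ℂ) * f q) (volume.restrict (uIoc (0 : ℝ) 1)) :=
    fun {f} hf => by
      rw [hI]
      exact ((continuousOn_rpow_mul hβ hf).mono Ioc_subset_Icc_self).aestronglyMeasurable
        measurableSet_Ioc
  have hU : {w : ℂ | 0 < w.re} ∈ 𝓝 z :=
    (isOpen_lt continuous_const Complex.continuous_re).mem_nhds hz
  have hcont : ∀ w : ℂ, 0 < w.re →
      ContinuousOn (fun q : ℝ => 2 * (α : ℂ) / orbitDenom α q w ^ 2) (Icc 0 1) := fun w hw =>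
    continuousOn_const.div (continuousOn_orbitDenom_param.pow 2)
      fun _ hq => pow_ne_zero 2 (orbitDenom_ne_zero hα hq.1 hq.2 hw.le)
  have h := (intervalIntegral.hasDerivAt_integral_of_dominated_loc_of_deriv_le (μ := volume)
    (a := 0) (b := 1) (x₀ := z)
    (F := fun z (q : ℝ) => ((q ^ β : ℝ) : ℂ) * ((z - α) / orbitDenom α q z))
    (F' := fun z (q : ℝ) => ((q ^ β : ℝ) : ℂ) * (2 * α / orbitDenom α q z ^ 2))
    (bound := fun _ => 2 / α) hU
    (by
      filter_upwards [hU] with w hw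
      exact hmeas (continuousOn_div_orbitDenom hα (le_of_lt hw) _))
    (intervalIntegrable_rpow_mul hβ (continuousOn_div_orbitDenom hα hz.le _))
    (hmeas (hcont z hz))
    (.of_forall fun q hq w hw => by
      rw [hI] at hq
      have h1 := le_norm_orbitDenom hα hq.1.le hq.2 (le_of_lt hw)
      rw [norm_mul, norm_div, norm_mul, norm_pow, Complex.norm_real, Complex.norm_real,
        Real.norm_of_nonneg (Real.rpow_nonneg hq.1.le _), Real.norm_of_nonneg hα.le,
        RCLike.norm_ofNat]
      have h2 : 2 * α / ‖orbitDenom α q w‖ ^ 2 ≤ 2 * α / α ^ 2 := by gcongr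
      calc _ ≤ 1 * (2 * α / α ^ 2) := by
            gcongr
            exact Real.rpow_le_one hq.1.le hq.2 hβ
        _ = 2 / α := by field_simp)
    intervalIntegrable_const
    (.of_forall fun q hq w hw => by
      rw [hI] at hq
      exact (hasDerivAt_div_orbitDenom (orbitDenom_ne_zero hα hq.1.le hq.2 (le_of_lt hw))).const_mul
        _)).2
  refine h.congr_deriv ?_
  rw [kernelIntegral, ← intervalIntegral.integral_div]
  refine intervalIntegral.integral_congr fun q _ => ?_
  field_simp
  ring

theorem orbitDenom_conj {q : ℝ} : orbitDenom α q (conj z) = conj (orbitDenom α q z) := by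
  simp [orbitDenom]

theorem imagePotential_conj : imagePotential α β (conj z) = conj (imagePotential α β z) := by
  rw [imagePotential, imagePotential, intervalIntegral.integral_of_le zero_le_one,
    intervalIntegral.integral_of_le zero_le_one, ← integral_conj]
  simp [orbitDenom_conj]

theorem integrableOn_imagePotential (hα : 0 < α) (hβ : 0 ≤ β) (hz : 0 ≤ z.re) :
    IntegrableOn (fun q : ℝ => ((q ^ β : ℝ) : ℂ) * ((z - α) / orbitDenom α q z)) (Ioo 0 1) :=
  ((continuousOn_rpow_mul hβ (continuousOn_div_orbitDenom hα hz _)).integrableOn_Icc).mono_set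
    Ioo_subset_Icc_self

theorem setIntegral_im_eq (hα : 0 < α) (hβ : 0 ≤ β) (hz : 0 ≤ z.re) :
    IntegrableOn (fun q : ℝ => q ^ β * ((z - α) / orbitDenom α q z).im) (Ioo 0 1) ∧
    ∫ q in Ioo (0 : ℝ) 1, q ^ β * ((z - α) / orbitDenom α q z).im = (imagePotential α β z).im := by
  have hi := integrableOn_imagePotential hα hβ hz
  have e : ∀ q : ℝ, q ^ β * ((z - α) / orbitDenom α q z).im =
      (((q ^ β : ℝ) : ℂ) * ((z - α) / orbitDenom α q z)).im := fun q => by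
    rw [Complex.im_ofReal_mul]
  simp only [e]
  refine ⟨hi.im, ?_⟩
  rw [imagePotential, intervalIntegral.integral_of_le zero_le_one, integral_Ioc_eq_integral_Ioo]
  exact integral_im hi

theorem integrableOn_rpow_sub_one (hβ : 0 < β) :
    IntegrableOn (fun q : ℝ => β * q ^ (β - 1)) (Ioo 0 1) := by
  have := (intervalIntegral.intervalIntegrable_rpow' (a := 0) (b := 1)
    (by linarith : -1 < β - 1)).const_mul β
  rw [intervalIntegrable_iff_integrableOn_Ioo_of_le zero_le_one] at this
  exact this

theorem setIntegral_rpow_sub_one (hβ : 0 < β) : ∫ q in Ioo (0 : ℝ) 1, β * q ^ (β - 1) = 1 := by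
  rw [← integral_Ioc_eq_integral_Ioo, ← intervalIntegral.integral_of_le zero_le_one,
    intervalIntegral.integral_const_mul, integral_rpow (Or.inl (by linarith))]
  simp [hβ.ne']

/-- Integration by parts for the logarithmic potential. -/
theorem setIntegral_log_norm_eq (hα : 0 < α) (hβ : 0 < β) (hz : 0 ≤ z.re) :
    IntegrableOn (fun q : ℝ => β * q ^ (β - 1) * Real.log ‖orbitDenom α q z‖) (Ioo 0 1) ∧
    ∫ q in Ioo (0 : ℝ) 1, β * q ^ (β - 1) * Real.log ‖orbitDenom α q z‖ =
      Real.log (2 * α) + (imagePotential α β z).re := by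
  have hN : ∀ q ∈ Icc (0 : ℝ) 1, orbitDenom α q z ≠ 0 := fun q hq =>
    orbitDenom_ne_zero hα hq.1 hq.2 hz
  have hlog : ContinuousOn (fun q : ℝ => Real.log ‖orbitDenom α q z‖) (Icc 0 1) :=
    (continuousOn_orbitDenom_param.norm).log fun q hq => norm_ne_zero_iff.2 (hN q hq)
  have hder : ∀ q ∈ Ioo (0 : ℝ) 1, HasDerivAt (fun q : ℝ => Real.log ‖orbitDenom α q z‖)
      (-((z - α) / orbitDenom α q z).re) q := fun q hq => by
    have hs : orbitDenom α q z ∈ Complex.slitPlane := Or.inl (by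
      have := le_re_orbitDenom (α := α) hq.2.le hz
      have h2 : 0 < (1 + q) * α := mul_pos (by linarith [hq.1]) hα
      linarith)
    have h1 := (hasDerivAt_orbitDenom_param (α := α) (q := q) (z := z)).clog_real hs
    have h2 := Complex.reCLM.hasFDerivAt.comp_hasDerivAt q h1
    refine (h2.congr_deriv ?_).congr_of_eventuallyEq (.of_forall fun t => ?_)
    · rw [← neg_sub z, neg_div]; simp
    · simp [Complex.log_re]
  have hi1 : IntegrableOn (fun q : ℝ => β * q ^ (β - 1) * Real.log ‖orbitDenom α q z‖) (Ioo 0 1) := by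
    obtain ⟨C, hC⟩ := isCompact_Icc.exists_bound_of_continuousOn hlog
    refine (integrableOn_rpow_sub_one hβ).mul_bdd (c := C) ?_ ?_
    · exact (hlog.mono Ioo_subset_Icc_self).aestronglyMeasurable measurableSet_Ioo
    · filter_upwards [ae_restrict_mem measurableSet_Ioo] with q hq
      exact hC q (Ioo_subset_Icc_self hq)
  have hi := integrableOn_imagePotential hα hβ.le hz
  have hi2 : IntegrableOn (fun q : ℝ => (((q ^ β : ℝ) : ℂ) * ((z - α) / orbitDenom α q z)).re)
    (Ioo 0 1) := hi.re
  refine ⟨hi1, ?_⟩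
  have hi3 := hi1.sub hi2
  have key := intervalIntegral.integral_eq_sub_of_hasDerivAt_of_le zero_le_one
    (f := fun q : ℝ => q ^ β * Real.log ‖orbitDenom α q z‖)
    (f' := fun q : ℝ => β * q ^ (β - 1) * Real.log ‖orbitDenom α q z‖ -
      (((q ^ β : ℝ) : ℂ) * ((z - α) / orbitDenom α q z)).re)
    ((continuous_rpow_const' hβ.le).continuousOn.mul hlog)
    (fun q hq => ((Real.hasDerivAt_rpow_const (Or.inl hq.1.ne')).mul (hder q hq)).congr_deriv (by
      rw [Complex.re_ofReal_mul]; ring))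
    ((intervalIntegrable_iff_integrableOn_Ioo_of_le zero_le_one).2 hi3)
  rw [intervalIntegral.integral_of_le zero_le_one, integral_Ioc_eq_integral_Ioo,
    integral_sub hi1 hi2] at key
  have e1 : orbitDenom α 1 z = 2 * α := by rw [orbitDenom]; push_cast; ring
  rw [e1, Real.one_rpow, Real.zero_rpow hβ.ne', zero_mul, sub_zero, one_mul, norm_mul,
    Complex.norm_real, Real.norm_of_nonneg hα.le, RCLike.norm_ofNat] at key
  have e2 : ∫ q in Ioo (0 : ℝ) 1, (((q ^ β : ℝ) : ℂ) * ((z - α) / orbitDenom α q z)).re =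
      (imagePotential α β z).re := by
    rw [imagePotential, intervalIntegral.integral_of_le zero_le_one, integral_Ioc_eq_integral_Ioo]
    exact integral_re hi
  linarith

/-- `|log (1 - q)| ≤ 2 (1 - q)^(-1/2)`, so a convergent beta integral dominates, including the
singularity of `q ^ (β - 1)` at `0` when `β < 1`. -/
theorem integrableOn_rpow_mul_log_one_sub (hβ : 0 < β) :
    IntegrableOn (fun q : ℝ => β * q ^ (β - 1) * Real.log (1 - q)) (Ioo 0 1) := by
  have h := (Complex.betaIntegral_convergent (u := β) (v := (1 / 2 : ℝ)) (by simpa using hβ)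
    (by simp)).const_mul ((2 * β : ℝ) : ℂ)
  rw [intervalIntegrable_iff_integrableOn_Ioo_of_le zero_le_one] at h
  refine Integrable.mono h ?_ ?_
  · refine ContinuousOn.aestronglyMeasurable (ContinuousOn.mul ?_ ?_) measurableSet_Ioo
    · exact continuousOn_const.mul (continuousOn_id.rpow_const fun q hq => Or.inl hq.1.ne')
    · exact (continuousOn_const.sub continuousOn_id).log fun q hq => (sub_pos.2 hq.2).ne'
  · filter_upwards [ae_restrict_mem measurableSet_Ioo] with q hq
    have h1 : 0 < 1 - q := sub_pos.2 hq.2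
    have h2 : ((1 : ℂ) - q) = ((1 - q : ℝ) : ℂ) := by push_cast; rfl
    rw [h2, norm_mul, norm_mul, norm_mul, norm_mul, Complex.norm_real,
      Complex.norm_cpow_eq_rpow_re_of_pos hq.1, Complex.norm_cpow_eq_rpow_re_of_pos h1,
      Real.norm_of_nonneg hβ.le, Real.norm_of_nonneg (Real.rpow_nonneg hq.1.le _),
      Real.norm_of_nonneg (by positivity : 0 ≤ 2 * β), Real.norm_eq_abs]
    have h3 := Real.abs_log_mul_self_rpow_lt (1 - q) (1 / 2) h1 (by linarith [hq.1]) (by norm_num)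
    rw [abs_mul, abs_of_pos (Real.rpow_pos_of_pos h1 _)] at h3
    have h4 : (1 - q) ^ (-(1 / 2) : ℝ) * (1 - q) ^ (1 / 2 : ℝ) = 1 := by
      rw [← Real.rpow_add h1]; norm_num
    have h5 : |Real.log (1 - q)| ≤ 2 * (1 - q) ^ (-(1 / 2) : ℝ) := by
      have h6 : 0 < (1 - q) ^ (1 / 2 : ℝ) := Real.rpow_pos_of_pos h1 _
      refine le_of_mul_le_mul_right ?_ h6
      rw [mul_assoc, h4]
      linarith
    have e1 : ((β : ℂ) - 1).re = β - 1 := by simp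
    have e2 : (((1 / 2 : ℝ) : ℂ) - 1).re = -(1 / 2) := by
      rw [Complex.sub_re, Complex.ofReal_re, Complex.one_re]; norm_num
    rw [e1, e2]
    have h7 : 0 ≤ q ^ (β - 1) := Real.rpow_nonneg hq.1.le _
    calc β * q ^ (β - 1) * |Real.log (1 - q)|
        ≤ β * q ^ (β - 1) * (2 * (1 - q) ^ (-(1 / 2) : ℝ)) := by gcongr
      _ = _ := by ring

end ImagePotential

/-! ### From integrals over `q` to charges on the axis. -/

theorem setIntegral_of_image {f f' g k : ℝ → ℝ} {S : Set ℝ}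
    (hf' : ∀ q ∈ Ioo (0 : ℝ) 1, HasDerivAt f (f' q) q)  (hinj : InjOn f (Ioo 0 1)) (hS : f '' Ioo 0 1 =ᵐ[volume] S)
    (h : ∀ q ∈ Ioo (0 : ℝ) 1, |f' q| * g (f q) = k q) (hk : IntegrableOn k (Ioo 0 1)) :
    IntegrableOn g S ∧ ∫ s in S, g s = ∫ q in Ioo (0 : ℝ) 1, k q := by
  have hd : ∀ q ∈ Ioo (0 : ℝ) 1, HasDerivWithinAt f (f' q) (Ioo 0 1) q := fun q hq =>
    (hf' q hq).hasDerivWithinAt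
  constructor
  · rw [← integrableOn_congr_set_ae hS,
      integrableOn_image_iff_integrableOn_abs_deriv_smul measurableSet_Ioo hd hinj]
    exact hk.congr_fun (fun q hq => (h q hq).symm) measurableSet_Ioo
  · rw [← setIntegral_congr_set hS,
      integral_image_eq_integral_abs_deriv_smul measurableSet_Ioo hd hinj]
    exact setIntegral_congr_fun measurableSet_Ioo h

section Substitution

variable {α ci : ℝ} {g k : ℝ → ℝ}

/-- The new variable is the zero of `orbitDenom α q`, that is `q = (s + α)/(s - α)`. -/
theorem setIntegral_Iic_of_moebius (hα : 0 < α)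
    (h : ∀ q ∈ Ioo (0 : ℝ) 1, 2 * α / (1 - q) ^ 2 * g (-(α * (1 + q) / (1 - q))) = k q)
    (hk : IntegrableOn k (Ioo 0 1)) :
    IntegrableOn g (Iic (-α)) ∧ ∫ s in Iic (-α), g s = ∫ q in Ioo (0 : ℝ) 1, k q := by
  have hinv : ∀ q ∈ Ioo (0 : ℝ) 1, (-(α * (1 + q) / (1 - q)) + α) / (-(α * (1 + q) / (1 - q)) - α) = q :=
    fun q hq => by
      have h1 : 0 < 1 - q := sub_pos.2 hq.2
      have e1 : -(α * (1 + q) / (1 - q)) + α = -(2 * α / (1 - q)) * q := by field_simp; ring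
      have e2 : -(α * (1 + q) / (1 - q)) - α = -(2 * α / (1 - q)) := by field_simp; ring
      rw [e1, e2, mul_div_cancel_left₀]
      exact neg_ne_zero.2 (by positivity)
  refine setIntegral_of_image (f := fun q => -(α * (1 + q) / (1 - q)))
    (f' := fun q => -(2 * α / (1 - q) ^ 2)) ?_ ?_ ?_ ?_ hk
  · intro q hq
    have h1 : 1 - q ≠ 0 := (sub_pos.2 hq.2).ne'
    have := ((((hasDerivAt_id q).const_add 1).const_mul α).div ((hasDerivAt_id q).const_sub 1) h1).neg
    refine this.congr_deriv ?_
    simp only [id]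
    field_simp
    ring
  · intro x hx y hy hxy
    simp only at hxy
    rw [← hinv x hx, ← hinv y hy, hxy]
  · have : (fun q => -(α * (1 + q) / (1 - q))) '' Ioo 0 1 = Iio (-α) := by
      ext s
      constructor
      · rintro ⟨q, hq, rfl⟩
        have h1 : 0 < 1 - q := sub_pos.2 hq.2
        rw [mem_Iio, neg_lt_neg_iff, lt_div_iff₀ h1]
        nlinarith [mul_pos hα hq.1]
      · intro hs
        rw [mem_Iio] at hs
        have h2 : s - α < 0 := by linarith
        refine ⟨(s + α) / (s - α), ⟨div_pos_of_neg_of_neg (by linarith) h2,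
          (div_lt_one_of_neg h2).2 (by linarith)⟩, ?_⟩
        have h3 : s - α ≠ 0 := h2.ne
        have e1 : 1 + (s + α) / (s - α) = 2 * s / (s - α) := by field_simp; ring
        have e2 : 1 - (s + α) / (s - α) = -(2 * α) / (s - α) := by field_simp; ring
        simp only [e1, e2]
        field_simp
    rw [this]
    exact Iio_ae_eq_Iic
  · intro q hq
    rw [abs_neg, abs_of_pos]
    · exact h q hq
    · have h1 : 0 < 1 - q := sub_pos.2 hq.2
      positivity

/-- The new variable is `orbit α q ci`, which runs from `α` at `q = 0` to `ci` at `q = 1`. -/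
theorem setIntegral_Icc_of_moebius (hα : 0 < α) (hci : α < ci)
    (h : ∀ q ∈ Ioo (0 : ℝ) 1, 2 * α * ((ci - α) * (ci + α)) / (ci + α - q * (ci - α)) ^ 2 *
      g (α * (ci + α + q * (ci - α)) / (ci + α - q * (ci - α))) = k q)
    (hk : IntegrableOn k (Ioo 0 1)) :
    IntegrableOn g (Icc α ci) ∧ ∫ s in Icc α ci, g s = ∫ q in Ioo (0 : ℝ) 1, k q := by
  have hn : 0 < ci - α := sub_pos.2 hci
  have hp : 0 < ci + α := by linarith
  have hD : ∀ q ∈ Ioo (0 : ℝ) 1, 0 < ci + α - q * (ci - α) := fun q hq => by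
    nlinarith [mul_pos (sub_pos.2 hq.2) hn]
  have hinv : ∀ q ∈ Ioo (0 : ℝ) 1, (α * (ci + α + q * (ci - α)) / (ci + α - q * (ci - α)) - α) /
      (α * (ci + α + q * (ci - α)) / (ci + α - q * (ci - α)) + α) * ((ci + α) / (ci - α)) = q :=
    fun q hq => by
      have h1 := (hD q hq).ne'
      have e1 : α * (ci + α + q * (ci - α)) / (ci + α - q * (ci - α)) - α =
          2 * α * (q * (ci - α)) / (ci + α - q * (ci - α)) := by field_simp; ring
      have e2 : α * (ci + α + q * (ci - α)) / (ci + α - q * (ci - α)) + α =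
          2 * α * (ci + α) / (ci + α - q * (ci - α)) := by field_simp; ring
      rw [e1, e2]
      field_simp
  refine setIntegral_of_image
    (f := fun q => α * (ci + α + q * (ci - α)) / (ci + α - q * (ci - α)))
    (f' := fun q => 2 * α * ((ci - α) * (ci + α)) / (ci + α - q * (ci - α)) ^ 2) ?_ ?_ ?_ ?_ hk
  · intro q hq
    have h1 := (hD q hq).ne'
    have := ((((hasDerivAt_id q).mul_const (ci - α)).const_add (ci + α)).const_mul α).div
      (((hasDerivAt_id q).mul_const (ci - α)).const_sub (ci + α)) h1
    refine this.congr_deriv ?_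
    simp only [id]
    congr 1
    ring
  · intro x hx y hy hxy
    simp only at hxy
    rw [← hinv x hx, ← hinv y hy, hxy]
  · have : (fun q => α * (ci + α + q * (ci - α)) / (ci + α - q * (ci - α))) '' Ioo 0 1 =
        Ioo α ci := by
      ext s
      constructor
      · rintro ⟨q, hq, rfl⟩
        have h1 := hD q hq
        rw [mem_Ioo, lt_div_iff₀ h1, div_lt_iff₀ h1]
        constructor
        · nlinarith [mul_pos hα (mul_pos hq.1 hn)]
        · nlinarith [mul_pos (mul_pos hp hn) (sub_pos.2 hq.2)]
      · rintro ⟨hs1, hs2⟩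
        have h2 : 0 < s + α := by linarith
        have h3 : 0 < (s + α) * (ci - α) := mul_pos h2 hn
        refine ⟨(s - α) * (ci + α) / ((s + α) * (ci - α)),
          ⟨div_pos (mul_pos (sub_pos.2 hs1) hp) h3, (div_lt_one h3).2 (by nlinarith)⟩, ?_⟩
        have e0 : (s - α) * (ci + α) / ((s + α) * (ci - α)) * (ci - α) =
          (s - α) * (ci + α) / (s + α) := by field_simp
        have e1 : ci + α + (s - α) * (ci + α) / (s + α) = 2 * s * (ci + α) / (s + α) := by
          field_simp; ring
        have e2 : ci + α - (s - α) * (ci + α) / (s + α) = 2 * α * (ci + α) / (s + α) := by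
          field_simp; ring
        simp only [e0, e1, e2]
        field_simp
    rw [this]
    exact Ioo_ae_eq_Icc
  · intro q hq
    rw [abs_of_pos]
    · exact h q hq
    · have h1 := hD q hq
      positivity

end Substitution

section LineCharges

variable {α β ci : ℝ} {z y : ℂ}

theorem dipoleKernel_eq (s : ℝ) : dipoleKernel z s = -((z - s)⁻¹).im := by
  rw [dipoleKernel, Complex.inv_im, Complex.normSq_eq_norm_sq, neg_div, neg_neg]

theorem sub_moebius_left {q : ℝ} (hq : q ≠ 1) :
    z - ((-(α * (1 + q) / (1 - q)) : ℝ) : ℂ) = orbitDenom α q z / (1 - q : ℝ) := by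
  have h1 : (1 - q : ℂ) ≠ 0 := by
    rw [sub_ne_zero]; exact_mod_cast hq.symm
  rw [orbitDenom]
  push_cast
  field_simp
  ring

/-- Partial fractions: `(z - α)/N` is the real number `1/(1 - q)` minus the Jacobian times `1/(z -
s)`, and the real summand drops out of the imaginary part. -/
theorem setIntegral_dipole_left (hα : 0 < α) (hβ : 0 ≤ β) (hz : 0 ≤ z.re) :
    IntegrableOn (fun s => dipoleKernel z s * ((s + α) / (s - α)) ^ β) (Iic (-α)) ∧
    ∫ s in Iic (-α), dipoleKernel z s * ((s + α) / (s - α)) ^ β = (imagePotential α β z).im := by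
  have h := setIntegral_im_eq hα hβ hz
  rw [← h.2]
  refine setIntegral_Iic_of_moebius hα (fun q hq => ?_) h.1
  have h1 : 0 < 1 - q := sub_pos.2 hq.2
  have hN := orbitDenom_ne_zero hα hq.1.le hq.2.le hz
  have e1 : (-(α * (1 + q) / (1 - q)) + α) / (-(α * (1 + q) / (1 - q)) - α) = q := by
    have e1 : -(α * (1 + q) / (1 - q)) + α = -(2 * α / (1 - q)) * q := by field_simp; ring
    have e2 : -(α * (1 + q) / (1 - q)) - α = -(2 * α / (1 - q)) := by field_simp; ring
    rw [e1, e2, mul_div_cancel_left₀]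
    exact neg_ne_zero.2 (by positivity)
  have h1' : (1 - q : ℂ) ≠ 0 := by exact_mod_cast h1.ne'
  have e2 : (z - α) / orbitDenom α q z =
      ((1 / (1 - q) : ℝ) : ℂ) - ((2 * α / (1 - q) ^ 2 : ℝ) : ℂ) * ((1 - q : ℝ) / orbitDenom α q z) := by
    push_cast
    rw [eq_sub_iff_add_eq, div_add' _ _ _ hN, div_eq_iff hN]
    field_simp
    rw [orbitDenom]
    ring
  rw [e1, dipoleKernel_eq, sub_moebius_left hq.2.ne, inv_div, e2, Complex.sub_im, Complex.ofReal_im,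
    Complex.im_ofReal_mul]
  ring

/-- Density times Jacobian is `β q ^ (β - 1)` and `log |z - s| = log |N| - log (1 - q)`; the last
term contributes a constant in `z`. -/
theorem setIntegral_log_left (hα : 0 < α) (hβ : 0 < β) (hz : 0 ≤ z.re) :
    IntegrableOn (fun s => logKernel z s * (2 * α * β * (|s + α| ^ (β - 1) / |s - α| ^ (β + 1))))
      (Iic (-α)) ∧
    ∫ s in Iic (-α), logKernel z s * (2 * α * β * (|s + α| ^ (β - 1) / |s - α| ^ (β + 1))) =
      Real.log (2 * α) + (imagePotential α β z).re -
        ∫ q in Ioo (0 : ℝ) 1, β * q ^ (β - 1) * Real.log (1 - q) := by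
  have h := setIntegral_log_norm_eq hα hβ hz
  have h' := integrableOn_rpow_mul_log_one_sub hβ
  rw [← h.2, ← integral_sub h.1 h']
  refine setIntegral_Iic_of_moebius hα (fun q hq => ?_) (h.1.sub h')
  have h1 : 0 < 1 - q := sub_pos.2 hq.2
  have hN := orbitDenom_ne_zero hα hq.1.le hq.2.le hz
  set X := 2 * α / (1 - q) with hX
  have hX0 : 0 < X := by positivity
  have e1 : -(α * (1 + q) / (1 - q)) + α = -(X * q) := by rw [hX]; field_simp; ring
  have e2 : -(α * (1 + q) / (1 - q)) - α = -X := by rw [hX]; field_simp; ring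
  have e3 : |X * q| ^ (β - 1) / |X| ^ (β + 1) = q ^ (β - 1) / X ^ 2 := by
    rw [abs_of_pos hX0, abs_of_pos (mul_pos hX0 hq.1), Real.mul_rpow hX0.le hq.1.le,
      (by ring : β + 1 = β - 1 + 2), Real.rpow_add hX0, Real.rpow_two]
    have := (Real.rpow_pos_of_pos hX0 (β - 1)).ne'
    field_simp
  rw [e1, e2, abs_neg, abs_neg, e3, logKernel, sub_moebius_left hq.2.ne, norm_div, Complex.norm_real,
    Real.norm_of_nonneg h1.le, Real.log_div (norm_ne_zero_iff.2 hN) h1.ne', hX]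
  field_simp

theorem orbitDenom_ofReal {q : ℝ} : orbitDenom α q ci = ((ci + α - q * (ci - α) : ℝ) : ℂ) := by
  rw [orbitDenom]; push_cast; ring

/-- The hypothesis says that `conj y` is the reflection of `z` in the inner circle. The right
sources are the reflections of the left ones, so the distance to a right source at `z` becomes the
left denominator at `y`. -/
theorem sub_moebius_right (hy : (z - ci) * (y - ci) = ((ci ^ 2 - α ^ 2 : ℝ) : ℂ)) {q : ℝ}
    (hq : ci + α - q * (ci - α) ≠ 0) :
    z - ((α * (ci + α + q * (ci - α)) / (ci + α - q * (ci - α)) : ℝ) : ℂ) =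
      (z - ci) * orbitDenom α q y / (ci + α - q * (ci - α) : ℝ) := by
  have hq' : ((ci + α - q * (ci - α) : ℝ) : ℂ) ≠ 0 := Complex.ofReal_ne_zero.2 hq
  rw [Complex.ofReal_div, eq_div_iff hq', sub_mul, div_mul_cancel₀ _ hq', orbitDenom]
  push_cast at hy ⊢
  linear_combination -(1 - q) * hy

theorem setIntegral_dipole_right (hα : 0 < α) (hci : α < ci) (hβ : 0 ≤ β) (hz : z ≠ ci)
    (hyre : 0 ≤ y.re) (hy : (z - ci) * (y - ci) = ((ci ^ 2 - α ^ 2 : ℝ) : ℂ)) :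
    IntegrableOn (fun s => dipoleKernel z s *
      (((ci + α) / (ci - α)) ^ β * ((s - α) / (s + α)) ^ β)) (Icc α ci) ∧
    ∫ s in Icc α ci, dipoleKernel z s * (((ci + α) / (ci - α)) ^ β * ((s - α) / (s + α)) ^ β) =
      -(imagePotential α β y).im := by
  have h := setIntegral_im_eq hα hβ hyre
  rw [← h.2, ← integral_neg]
  refine setIntegral_Icc_of_moebius hα hci (fun q hq => ?_) h.1.neg
  have hn : 0 < ci - α := sub_pos.2 hci
  have hp : 0 < ci + α := by linarith
  have hD : 0 < ci + α - q * (ci - α) := by nlinarith [mul_pos (sub_pos.2 hq.2) hn]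
  have hN := orbitDenom_ne_zero hα hq.1.le hq.2.le hyre
  have e1 : (α * (ci + α + q * (ci - α)) / (ci + α - q * (ci - α)) - α) /
      (α * (ci + α + q * (ci - α)) / (ci + α - q * (ci - α)) + α) = (ci - α) / (ci + α) * q := by
    have e1 : α * (ci + α + q * (ci - α)) / (ci + α - q * (ci - α)) - α =
        2 * α * (q * (ci - α)) / (ci + α - q * (ci - α)) := by field_simp; ring
    have e2 : α * (ci + α + q * (ci - α)) / (ci + α - q * (ci - α)) + α =
        2 * α * (ci + α) / (ci + α - q * (ci - α)) := by field_simp; ring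
    rw [e1, e2]
    field_simp
  have e3 : ((ci + α) / (ci - α)) ^ β * ((ci - α) / (ci + α) * q) ^ β = q ^ β := by
    rw [← Real.mul_rpow (by positivity) (mul_nonneg (by positivity) hq.1.le)]
    congr 1
    field_simp
  have hz' : z - ci ≠ 0 := sub_ne_zero.2 hz
  have hD' : ((ci + α - q * (ci - α) : ℝ) : ℂ) ≠ 0 := Complex.ofReal_ne_zero.2 hD.ne'
  have e2 : (y - α) / orbitDenom α q y = (((ci - α) / (ci + α - q * (ci - α)) : ℝ) : ℂ) +
      ((2 * α * ((ci - α) * (ci + α)) / (ci + α - q * (ci - α)) ^ 2 : ℝ) : ℂ) *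
        ((ci + α - q * (ci - α) : ℝ) / ((z - ci) * orbitDenom α q y)) := by
    have e4 : ((2 * α * ((ci - α) * (ci + α)) / (ci + α - q * (ci - α)) ^ 2 : ℝ) : ℂ) *
        ((ci + α - q * (ci - α) : ℝ) / ((z - ci) * orbitDenom α q y)) =
        2 * α * (y - ci) / ((ci + α - q * (ci - α) : ℝ) * orbitDenom α q y) := by
      rw [Complex.ofReal_div, Complex.ofReal_pow]
      generalize ((ci + α - q * (ci - α) : ℝ) : ℂ) = P at hD' ⊢
      field_simp
      push_cast at hy ⊢
      linear_combination -2 * α * hy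
    have hP : ((ci + α - q * (ci - α) : ℝ) : ℂ) = (1 - q) * ci + (1 + q) * α := by push_cast; ring
    rw [e4, Complex.ofReal_div]
    generalize ((ci + α - q * (ci - α) : ℝ) : ℂ) = P at hD' hP ⊢
    field_simp
    rw [orbitDenom]
    push_cast
    linear_combination (y - α) * hP
  rw [e1, e3, dipoleKernel_eq, sub_moebius_right hy hD.ne', inv_div]
  rw [e2, Complex.add_im, Complex.ofReal_im, Complex.im_ofReal_mul]
  ring

/-- In the variable `q` the charge is `β q ^ (β - 1)` of total mass `1`. By `sub_moebius_right` the
kernel splits into three logarithms, the last being that of `orbitDenom` at `ci`. -/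
theorem setIntegral_log_right (hα : 0 < α) (hci : α < ci) (hβ : 0 < β) (hz : z ≠ ci)
    (hyre : 0 ≤ y.re) (hy : (z - ci) * (y - ci) = ((ci ^ 2 - α ^ 2 : ℝ) : ℂ)) :
    IntegrableOn (fun s => logKernel z s * (2 * α * β * ((ci + α) / (ci - α)) ^ β *
      ((s - α) ^ (β - 1) / (s + α) ^ (β + 1)))) (Icc α ci) ∧
    ∫ s in Icc α ci, logKernel z s * (2 * α * β * ((ci + α) / (ci - α)) ^ β *
      ((s - α) ^ (β - 1) / (s + α) ^ (β + 1))) =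
      Real.log ‖z - ci‖ + (imagePotential α β y).re - (imagePotential α β ci).re := by
  have hn : 0 < ci - α := sub_pos.2 hci
  have hp : 0 < ci + α := by linarith
  have h := setIntegral_log_norm_eq hα hβ hyre
  have h' := setIntegral_log_norm_eq hα hβ (z := ci) (by simpa using (hα.trans hci).le)
  have h0 := (integrableOn_rpow_sub_one hβ).mul_const (Real.log ‖z - ci‖)
  have e : Real.log ‖z - ci‖ + (imagePotential α β y).re - (imagePotential α β ci).re =
      ∫ q in Ioo (0 : ℝ) 1, (β * q ^ (β - 1) * Real.log ‖z - ci‖ +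
        β * q ^ (β - 1) * Real.log ‖orbitDenom α q y‖ -
        β * q ^ (β - 1) * Real.log ‖orbitDenom α q ci‖) := by
    have h1 : Integrable (fun q => β * q ^ (β - 1) * Real.log ‖z - ci‖ +
        β * q ^ (β - 1) * Real.log ‖orbitDenom α q y‖) (volume.restrict (Ioo 0 1)) := h0.add h.1
    rw [integral_sub h1 h'.1, integral_add h0 h.1, h.2, h'.2, integral_mul_const,
      setIntegral_rpow_sub_one hβ]
    ring
  rw [e]
  refine setIntegral_Icc_of_moebius hα hci (fun q hq => ?_) ((h0.add h.1).sub h'.1)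
  have hD : 0 < ci + α - q * (ci - α) := by nlinarith [mul_pos (sub_pos.2 hq.2) hn]
  have hN := orbitDenom_ne_zero hα hq.1.le hq.2.le hyre
  set X := 2 * α * (ci + α) / (ci + α - q * (ci - α)) with hX
  have hX0 : 0 < X := by positivity
  have e1 : α * (ci + α + q * (ci - α)) / (ci + α - q * (ci - α)) - α =
      X * ((ci - α) / (ci + α) * q) := by rw [hX]; field_simp; ring
  have e2 : α * (ci + α + q * (ci - α)) / (ci + α - q * (ci - α)) + α = X := by
    rw [hX]; field_simp; ring
  have e3 : ((ci + α) / (ci - α)) ^ β *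
      ((X * ((ci - α) / (ci + α) * q)) ^ (β - 1) / X ^ (β + 1)) =
      (ci + α) / (ci - α) * q ^ (β - 1) / X ^ 2 := by
    have hw : 0 < (ci - α) / (ci + α) := by positivity
    rw [Real.mul_rpow hX0.le (mul_nonneg hw.le hq.1.le), Real.mul_rpow hw.le hq.1.le,
      (by ring : β + 1 = β - 1 + 2), Real.rpow_add hX0, Real.rpow_two]
    have e4 : ((ci + α) / (ci - α)) ^ β =
        (ci + α) / (ci - α) * ((ci + α) / (ci - α)) ^ (β - 1) := by
      conv_lhs => rw [(by ring : β = 1 + (β - 1)), Real.rpow_add (by positivity), Real.rpow_one]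
    have e5 : ((ci + α) / (ci - α)) ^ (β - 1) * ((ci - α) / (ci + α)) ^ (β - 1) = 1 := by
      rw [← Real.mul_rpow (by positivity) hw.le, (by field_simp :
        (ci + α) / (ci - α) * ((ci - α) / (ci + α)) = 1), Real.one_rpow]
    have h6 := (Real.rpow_pos_of_pos hX0 (β - 1)).ne'
    rw [e4]
    calc _ = (ci + α) / (ci - α) * (((ci + α) / (ci - α)) ^ (β - 1) *
          ((ci - α) / (ci + α)) ^ (β - 1)) * q ^ (β - 1) / X ^ 2 *
          (X ^ (β - 1) / X ^ (β - 1)) := by ring_nf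
      _ = _ := by rw [e5, div_self h6]; ring
  have hz' : z - ci ≠ 0 := sub_ne_zero.2 hz
  rw [e1, e2, mul_assoc (2 * α * β), e3, logKernel, sub_moebius_right hy hD.ne', norm_div, norm_mul,
    Complex.norm_real, Real.norm_of_nonneg hD.le, Real.log_div (by positivity) hD.ne',
    Real.log_mul (norm_ne_zero_iff.2 hz') (norm_ne_zero_iff.2 hN), orbitDenom_ofReal,
    Complex.norm_real, Real.norm_of_nonneg hD.le, hX]
  generalize ci + α - q * (ci - α) = P at hD ⊢
  field_simp

end LineCharges

/-! ### Asymptotics of `α` and of the multiplier as `ε → 0`. -/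

/-- In the series `2 ∑ y^(2k+1)/(2k+1)` the first term gives the lower bound; replacing the
coefficients `1/(2k+1)` by `1` gives the upper one. -/
theorem log_one_add_sub_log_one_sub_bounds {y : ℝ} (h0 : 0 < y) (h1 : y < 1) :
    2 * y ≤ Real.log (1 + y) - Real.log (1 - y) ∧
      Real.log (1 + y) - Real.log (1 - y) ≤ 2 * y / (1 - y ^ 2) := by
  have h := Real.hasSum_log_sub_log_of_abs_lt_one (x := y) (by rwa [abs_of_pos h0])
  have hy2 : y ^ 2 < 1 := by nlinarith
  constructor
  · have := h.summable.sum_le_tsum {0} (fun i _ => by positivity)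
    rw [h.tsum_eq] at this
    simpa using this
  · have hg := (hasSum_geometric_of_lt_one (sq_nonneg y) hy2).mul_left (2 * y)
    rw [← div_eq_mul_inv] at hg
    refine hasSum_le (fun k => ?_) h hg
    have h2 : (1 : ℝ) / (2 * k + 1) ≤ 1 := by
      rw [div_le_one (by positivity)]
      have : (0 : ℝ) ≤ k := by positivity
      linarith
    calc (2 : ℝ) * (1 / (2 * k + 1)) * y ^ (2 * k + 1) ≤ 2 * 1 * y ^ (2 * k + 1) := by gcongr
      _ = 2 * y * (y ^ 2) ^ k := by rw [pow_succ, pow_mul]; ring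

namespace CoreShell

variable {ri re ε : ℝ}

theorem alpha_sq (hri : 0 < ri) (hε : 0 < ε) (hε1 : ε < re - ri) :
    alpha ri re ε ^ 2 =
      ε * (2 * ri + ε) * (2 * re - ε) * (2 * re - 2 * ri - ε) / (2 * (re - ri - ε)) ^ 2 := by
  have h1 : 0 < 2 * re - ε := by linarith
  have h2 : 0 < 2 * re - 2 * ri - ε := by linarith
  rw [alpha, div_pow, Real.sq_sqrt (by positivity)]

/-- `α` is at least of order `√ε`, so the quotients `√ε / α` and `ε / α` in later errors are
bounded. -/
theorem le_alpha_sq (hri : 0 < ri) (hre : ri < re) (hε : 0 < ε) (hε1 : ε < re - ri) :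
    ε * (ri * re) ≤ 2 * (re - ri) * alpha ri re ε ^ 2 := by
  have hd : 0 < re - ri - ε := by linarith
  have hD : 0 < re - ri := by linarith
  have hre0 : 0 < re := hri.trans hre
  rw [alpha_sq hri hε hε1, ← mul_div_assoc, le_div_iff₀ (by positivity)]
  have h1 : 2 * ri * re * (re - ri) ≤ (2 * ri + ε) * (2 * re - ε) * (2 * re - 2 * ri - ε) := by
    have : re ≤ 2 * re - ε := by linarith
    have : re - ri ≤ 2 * re - 2 * ri - ε := by linarith
    have : 0 < 2 * re - ε := by linarith
    gcongr
    linarith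
  have h2 : (2 * (re - ri - ε)) ^ 2 ≤ (2 * (re - ri)) ^ 2 := by
    have : re - ri - ε ≤ re - ri := by linarith
    gcongr
  calc ε * (ri * re) * (2 * (re - ri - ε)) ^ 2 ≤ ε * (ri * re) * (2 * (re - ri)) ^ 2 := by gcongr
    _ = 2 * (re - ri) * ε * (2 * ri * re * (re - ri)) := by ring
    _ ≤ 2 * (re - ri) * ε * ((2 * ri + ε) * (2 * re - ε) * (2 * re - 2 * ri - ε)) := by gcongr
    _ = _ := by ring

theorem rStar_sq (hri : 0 < ri) (hre : ri < re) : rStar ri re ^ 2 = 2 * ri * re / (re - ri) := by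
  have hD : 0 < re - ri := by linarith
  have hre0 : 0 < re := hri.trans hre
  rw [rStar, Real.sq_sqrt (by positivity)]

theorem rStar_pos (hri : 0 < ri) (hre : ri < re) : 0 < rStar ri re := by
  have hD : 0 < re - ri := by linarith
  have hre0 : 0 < re := hri.trans hre
  exact Real.sqrt_pos.2 (by positivity)

theorem abs_alpha_sq_sub_le (hri : 0 < ri) (hre : ri < re) {ε₀ : ℝ} (hε₀ : ε₀ < re - ri) (hε : 0 < ε)
    (hε1 : ε ≤ ε₀) : |alpha ri re ε ^ 2 - rStar ri re ^ 2 * ε| ≤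
      (20 * ri * re * (re - ri) + 4 * (re - ri) ^ 3) / (4 * (re - ri - ε₀) ^ 2 * (re - ri)) * ε ^ 2 := by
  have hd : 0 < re - ri - ε := by linarith
  have hd0 : 0 < re - ri - ε₀ := by linarith
  have hD : 0 < re - ri := by linarith
  have hre0 : 0 < re := hri.trans hre
  have e : alpha ri re ε ^ 2 - rStar ri re ^ 2 * ε =
      (12 * ri * re * (re - ri) - 8 * ri * re * ε + (2 * (re - ri) - ε) ^ 2 * (re - ri)) /
        (4 * (re - ri - ε) ^ 2 * (re - ri)) * ε ^ 2 := by
    rw [alpha_sq hri hε (by linarith), rStar_sq hri hre]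
    field_simp
    ring
  rw [e, abs_mul, abs_div, abs_of_pos (by positivity : 0 < 4 * (re - ri - ε) ^ 2 * (re - ri)),
    abs_of_pos (by positivity : 0 < ε ^ 2)]
  have h1 : |12 * ri * re * (re - ri) - 8 * ri * re * ε + (2 * (re - ri) - ε) ^ 2 * (re - ri)| ≤
      20 * ri * re * (re - ri) + 4 * (re - ri) ^ 3 := by
    have p1 : 0 < ri * re := by positivity
    have p2 : ri * re * ε ≤ ri * re * (re - ri) := by gcongr; linarith
    have p3 : (2 * (re - ri) - ε) ^ 2 * (re - ri) ≤ (2 * (re - ri)) ^ 2 * (re - ri) := by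
      gcongr <;> linarith
    have p4 : 0 ≤ (2 * (re - ri) - ε) ^ 2 * (re - ri) := by positivity
    have p5 : 0 < ri * re * ε := by positivity
    have p6 : 0 < ri * re * (re - ri) := by positivity
    have p7 : 0 < (re - ri) ^ 3 := by positivity
    rw [abs_le]
    constructor <;> nlinarith
  gcongr

/-- The difference equals `ρ (α² - ρ² s²) / (4 s α (α + ρ s))`. With `s = √ε` the numerator is
`O(ε²)`, which outweighs the small denominators. -/
theorem abs_inv_sub_div_le {s ρ α Q K : ℝ} (hs : 0 < s) (hρ : 0 < ρ) (hα : 0 < α) (hQ : 0 ≤ Q)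
    (h : |α ^ 2 - ρ ^ 2 * s ^ 2| ≤ Q * (s ^ 2) ^ 2) (hK : s ^ 2 ≤ K * α) :
    |1 / (4 * s / ρ) - ρ ^ 2 / (4 * α)| ≤ Q * K / 4 := by
  have hK0 : 0 ≤ K := by
    by_contra! hK1
    nlinarith [sq_nonneg s, mul_pos (neg_pos.2 hK1) hα]
  have e : 1 / (4 * s / ρ) - ρ ^ 2 / (4 * α) =
      ρ * (α ^ 2 - ρ ^ 2 * s ^ 2) / (4 * s * α * (α + ρ * s)) := by
    have : α + ρ * s ≠ 0 := by positivity
    field_simp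
    ring
  rw [e, abs_div, abs_mul, abs_of_pos hρ, abs_of_pos (by positivity :
    0 < 4 * s * α * (α + ρ * s)), div_le_iff₀ (by positivity)]
  calc ρ * |α ^ 2 - ρ ^ 2 * s ^ 2| ≤ ρ * (Q * (s ^ 2) ^ 2) := by gcongr
    _ = ρ * Q * s ^ 2 * s ^ 2 := by ring
    _ ≤ ρ * Q * s ^ 2 * (K * α) := by gcongr
    _ = Q * K * α * s * (ρ * s) := by ring
    _ ≤ Q * K * α * s * (α + ρ * s) := by
        gcongr
        linarith
    _ = _ := by ring

/-- At `d = re - ri` one has `m = ri re` and the two fractions agree; hence the factor `re - ri -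
d`, which is `ε` in the application. -/
theorem one_div_sub_div_eq {α d m : ℝ} (hα : α ≠ 0) (hd : d ≠ 0) (hD : re - ri ≠ 0)
    (hm : m = (re ^ 2 + ri ^ 2 - d ^ 2) / 2) (hm0 : m ≠ 0) :
    1 / (2 * (α * d / m)) - 2 * ri * re / (re - ri) / (4 * α) =
      (re - ri - d) * (ri * re / (d * (re - ri)) + (re - ri + d) / (2 * d)) / (2 * α) := by
  have e : 1 / (2 * (α * d / m)) = m / (2 * α * d) := by field_simp
  rw [e, hm]
  field_simp
  ring

set_option maxHeartbeats 1000000 in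
/-- Comparison of the logarithm of the multiplier with its leading asymptotics as `ε → 0`. -/
theorem exists_multiplier_bounds (hri : 0 < ri) (hre : ri < re) {ε₀ : ℝ} (hε₀ : ε₀ < re - ri) :
    ∃ A : ℝ, 0 ≤ A ∧ ∀ ε : ℝ, 0 < ε → ε ≤ ε₀ → ∀ L : ℝ,
      L = -Real.log (multiplier (centerI ri re ε) (centerE ri re ε) (alpha ri re ε)) →
      0 < L ∧ alpha ri re ε / L ≤ A ∧
      |1 / L - 1 / (4 * √ε / rStar ri re)| + |1 / L - rStar ri re ^ 2 / (4 * alpha ri re ε)| ≤ A ∧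
      rStar ri re ^ 2 / (4 * alpha ri re ε) * (4 * √ε / rStar ri re) ≤ A := by
  have hD : 0 < re - ri := by linarith
  have hd0 : 0 < re - ri - ε₀ := by linarith
  have hre0 : 0 < re := hri.trans hre
  have hρ := rStar_pos hri hre
  set ρ := rStar ri re with hρd
  set K := √(2 * (re - ri) ^ 2 / (ri * re)) with hK
  set Q := (20 * ri * re * (re - ri) + 4 * (re - ri) ^ 3) / (4 * (re - ri - ε₀) ^ 2 * (re - ri)) with hQ
  set P := ri * re / ((re - ri - ε₀) * (re - ri)) + (re - ri) / (re - ri - ε₀) with hP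
  have hK0 : 0 ≤ K := Real.sqrt_nonneg _
  have hQ0 : 0 ≤ Q := by positivity
  have hP0 : 0 ≤ P := by positivity
  set A := re ^ 2 / (re - ri - ε₀) + (2 * (1 / 2 + K * P / 2) + Q * K / 4) +
    √(2 * (re - ri) / (ri * re)) * ρ with hA
  refine ⟨A, by positivity, fun ε hε hε1 L hL => ?_⟩
  have hε2 : ε < re - ri := hε1.trans_lt hε₀
  have hc := nestedCircles hri hre hε hε2
  have hα := hc.alpha_pos
  have hlow := le_alpha_sq hri hre hε hε2
  have hsub : |alpha ri re ε ^ 2 - ρ ^ 2 * ε| ≤ Q * ε ^ 2 := abs_alpha_sq_sub_le hri hre hε₀ hε hε1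
  have hden := hc.denom_pos
  have hce : centerE ri re ε = centerI ri re ε + (re - ri - ε) := by rw [centerE]; ring
  have hci : centerI ri re ε * (2 * (re - ri - ε)) = re ^ 2 - ri ^ 2 - (re - ri - ε) ^ 2 := by
    rw [centerI, div_mul_cancel₀]
    linarith
  have hsi := hc.sq_i
  set d := re - ri - ε with hd
  have hdpos : 0 < d := by linarith
  have hd0d : re - ri - ε₀ ≤ d := by linarith
  set α := alpha ri re ε with hαd
  set m := (re ^ 2 + ri ^ 2 - d ^ 2) / 2 with hm
  have hmeq : centerI ri re ε * centerE ri re ε - α ^ 2 = m := by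
    rw [hce, hm]; linarith
  have hdd : centerE ri re ε - centerI ri re ε = d := by rw [hce]; ring
  rw [hmeq, hdd] at hden
  have hm0 : 0 < m := by nlinarith [mul_pos hα hdpos]
  -- The multiplier equals `(1 - y)/(1 + y)`, so `L = log (1 + y) - log (1 - y)`.
  set y := α * d / m with hy
  have hy0 : 0 < y := by positivity
  have hy1 : y < 1 := by rw [hy, div_lt_one hm0]; linarith
  have hLy : L = Real.log (1 + y) - Real.log (1 - y) := by
    rw [hL, multiplier, hmeq, hdd, ← Real.log_inv, inv_div, ← Real.log_div (by linarith) (by linarith)]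
    congr 1
    have : m - α * d ≠ 0 := hden.ne'
    have e1 : 1 + y = (m + α * d) / m := by rw [hy]; field_simp
    have e2 : 1 - y = (m - α * d) / m := by rw [hy]; field_simp
    rw [e1, e2]
    field_simp
  obtain ⟨hL1, hL2⟩ := log_one_add_sub_log_one_sub_bounds hy0 hy1
  rw [← hLy] at hL1 hL2
  have hL0 : 0 < L := by linarith
  have hεα : ε ≤ K * α := by
    refine le_of_sq_le_sq ?_ (by positivity)
    rw [mul_pow, hK, Real.sq_sqrt (by positivity), div_mul_eq_mul_div, le_div_iff₀ (by positivity)]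
    calc ε ^ 2 * (ri * re) = ε * (ε * (ri * re)) := by ring
      _ ≤ (re - ri) * (2 * (re - ri) * α ^ 2) := by gcongr
      _ = _ := by ring
  have hsα : √ε ≤ √(2 * (re - ri) / (ri * re)) * α := by
    rw [Real.sqrt_le_left (by positivity), mul_pow, Real.sq_sqrt (by positivity), div_mul_eq_mul_div,
      le_div_iff₀ (by positivity)]
    exact hlow
  have hs : 0 < √ε := Real.sqrt_pos.2 hε
  have hs2 : √ε ^ 2 = ε := Real.sq_sqrt hε.le
  -- The logarithm bounds place `1/L` within `y/2 < 1/2` of `1/(2y)`, and `1/(2y)` differs from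
  -- `ρ²/(4α)` by `ε/α` times a bounded quantity.
  have b1 : |1 / L - ρ ^ 2 / (4 * α)| ≤ 1 / 2 + K * P / 2 := by
    have h1 : 1 / L ≤ 1 / (2 * y) := one_div_le_one_div_of_le (by positivity) hL1
    have h2 : 1 / (2 * y) - y / 2 ≤ 1 / L := by
      have := one_div_le_one_div_of_le hL0 hL2
      rw [one_div_div] at this
      refine le_trans (le_of_eq ?_) this
      field_simp
    have h3 : 1 / (2 * y) - ρ ^ 2 / (4 * α) =
        ε * (ri * re / (d * (re - ri)) + (2 * (re - ri) - ε) / (2 * d)) / (2 * α) := by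
      rw [hρd, rStar_sq hri hre, hy, one_div_sub_div_eq hα.ne' hdpos.ne' hD.ne' hm hm0.ne', hd]
      ring
    have h4 : ri * re / (d * (re - ri)) + (2 * (re - ri) - ε) / (2 * d) ≤ P := by
      have : (2 * (re - ri) - ε) / (2 * d) ≤ (2 * (re - ri)) / (2 * (re - ri - ε₀)) := by
        gcongr; linarith
      rw [mul_div_mul_left _ _ two_ne_zero] at this
      rw [hP]
      gcongr
    have h5 : 0 ≤ ri * re / (d * (re - ri)) + (2 * (re - ri) - ε) / (2 * d) := by
      have : 0 < 2 * (re - ri) - ε := by linarith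
      positivity
    have h6 : 1 / (2 * y) - ρ ^ 2 / (4 * α) ≤ K * P / 2 := by
      rw [h3, div_le_iff₀ (by positivity)]
      calc _ ≤ K * α * P := by gcongr
        _ = _ := by ring
    have h7 : 0 ≤ 1 / (2 * y) - ρ ^ 2 / (4 * α) := by
      rw [h3]; positivity
    have h8 : 0 ≤ K * P / 2 := by positivity
    rw [abs_le]
    constructor <;> linarith
  have b2 : |1 / (4 * √ε / ρ) - ρ ^ 2 / (4 * α)| ≤ Q * K / 4 := by
    have := abs_inv_sub_div_le hs hρ hα hQ0 (by rwa [hs2]) (by rwa [hs2])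
    exact this
  refine ⟨hL0, ?_, ?_, ?_⟩
  · have h1 : α / L ≤ α / (2 * y) := by gcongr
    have h2 : α / (2 * y) = m / (2 * d) := by rw [hy]; field_simp
    have h3 : m / (2 * d) ≤ re ^ 2 / (re - ri - ε₀) := by
      rw [div_le_div_iff₀ (by positivity) hd0]
      have : m ≤ 2 * re ^ 2 := by rw [hm]; nlinarith
      calc m * (re - ri - ε₀) ≤ 2 * re ^ 2 * d := by gcongr
        _ = _ := by ring
    have h4 : 0 ≤ 2 * (1 / 2 + K * P / 2) + Q * K / 4 + √(2 * (re - ri) / (ri * re)) * ρ := by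
      positivity
    linarith
  · have h1 : |1 / L - 1 / (4 * √ε / ρ)| ≤ (1 / 2 + K * P / 2) + Q * K / 4 := by
      have := abs_sub_le (1 / L) (ρ ^ 2 / (4 * α)) (1 / (4 * √ε / ρ))
      rw [abs_sub_comm (ρ ^ 2 / (4 * α))] at this
      linarith
    have h4 : 0 ≤ re ^ 2 / (re - ri - ε₀) + √(2 * (re - ri) / (ri * re)) * ρ := by positivity
    linarith
  · have e : ρ ^ 2 / (4 * α) * (4 * √ε / ρ) = √ε / α * ρ := by field_simp
    rw [e]
    have h1 : √ε / α ≤ √(2 * (re - ri) / (ri * re)) := by rwa [div_le_iff₀ hα]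
    have h2 : √ε / α * ρ ≤ √(2 * (re - ri) / (ri * re)) * ρ := by gcongr
    have h4 : 0 ≤ re ^ 2 / (re - ri - ε₀) + (2 * (1 / 2 + K * P / 2) + Q * K / 4) := by positivity
    linarith

end CoreShell

/-! ### Image charges for the core-shell structure and the remainder in the shell. -/

namespace CoreShell

section Images

variable {ri re ε ki ke : ℝ} {z : ℂ}

theorem tauI_pos (he : 0 < ke) (hei : ke < ki) : 0 < tauI ki ke :=
  div_pos (sub_pos.2 hei) (by linarith)

theorem tauE_pos (he : 0 < ke) (he1 : ke < 1) : 0 < tauE ke :=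
  div_pos (sub_pos.2 he1) (by linarith)

theorem tau_pos (he : 0 < ke) (he1 : ke < 1) (hei : ke < ki) : 0 < tau ki ke :=
  mul_pos (tauI_pos he hei) (tauE_pos he he1)

theorem neg_log_tau_pos (he : 0 < ke) (he1 : ke < 1) (hei : ke < ki) : 0 < -Real.log (tau ki ke) :=
  neg_pos.2 (Real.log_neg (tau_pos he he1 hei)
    (abs_lt.1 (abs_tau_lt_one (he.trans hei) he)).2)

theorem beta_pos (hri : 0 < ri) (hre : ri < re) (hε : 0 < ε) (he : 0 < ke) (he1 : ke < 1)
    (hei : ke < ki) : 0 < beta ri re ε ki ke := by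
  have h1 := rStar_pos hri hre
  have h2 := neg_log_tau_pos he he1 hei
  have h3 := Real.sqrt_pos.2 hε
  rw [beta]
  positivity

/-- `ri² = (c_i - α)(c_i + α)`, so `e^(2 ξ_i)` is the quotient of the two factors: the normalization
in `setIntegral_log_right`. -/
theorem exp_two_mul_xiI (hri : 0 < ri) (hre : ri < re) (hε : 0 < ε) (hε1 : ε < re - ri) (β : ℝ) :
    Real.exp (2 * β * xiI ri re ε) =
      ((centerI ri re ε + alpha ri re ε) / (centerI ri re ε - alpha ri re ε)) ^ β := by
  have hc := nestedCircles hri hre hε hε1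
  have hn := sub_pos.2 hc.alpha_lt
  have hp : 0 < centerI ri re ε + alpha ri re ε := by linarith [hc.alpha_pos, hc.ci_pos]
  rw [Real.rpow_def_of_pos (div_pos hp hn), Real.log_div hp.ne' hn.ne', xiI, abs_of_pos hp]
  have h : 2 * Real.log ri = Real.log (centerI ri re ε + alpha ri re ε) +
      Real.log (centerI ri re ε - alpha ri re ε) := by
    rw [← Real.log_mul hp.ne' hn.ne', ← Real.log_rpow hri]
    congr 1
    rw [Real.rpow_two]
    linarith [hc.sq_i]
  congr 1
  linear_combination -β * h

theorem image_left (hri : 0 < ri) (hre : ri < re) (hε : 0 < ε) (hε1 : ε < re - ri) (he : 0 < ke)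
    (he1 : ke < 1) (hei : ke < ki) (hz : 0 ≤ z.re) :
    (IntegrableOn (fun s => logKernel z s * phi1 ri re ε ki ke s) (Iic (-alpha ri re ε)) ∧
      ∫ s in Iic (-alpha ri re ε), logKernel z s * phi1 ri re ε ki ke s =
        (tau ki ke + tauE ke) * (Real.log (2 * alpha ri re ε) +
          (imagePotential (alpha ri re ε) (beta ri re ε ki ke) z).re -
          ∫ q in Ioo (0 : ℝ) 1, beta ri re ε ki ke * q ^ (beta ri re ε ki ke - 1) *
            Real.log (1 - q))) ∧
    (IntegrableOn (fun s => dipoleKernel z s * psi1 ri re ε ki ke s) (Iic (-alpha ri re ε)) ∧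
      ∫ s in Iic (-alpha ri re ε), dipoleKernel z s * psi1 ri re ε ki ke s =
        (tau ki ke + tauE ke) * (imagePotential (alpha ri re ε) (beta ri re ε ki ke) z).im) := by
  have hc := nestedCircles hri hre hε hε1
  have hβ := beta_pos hri hre hε he he1 hei
  have h1 := setIntegral_log_left hc.alpha_pos hβ hz
  have h2 := setIntegral_dipole_left hc.alpha_pos hβ.le hz
  rw [← h1.2, ← h2.2, ← integral_const_mul, ← integral_const_mul]
  have e1 : (fun s => logKernel z s * phi1 ri re ε ki ke s) = fun s => (tau ki ke + tauE ke) *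
      (logKernel z s * (2 * alpha ri re ε * beta ri re ε ki ke *
        (|s + alpha ri re ε| ^ (beta ri re ε ki ke - 1) /
          |s - alpha ri re ε| ^ (beta ri re ε ki ke + 1)))) := by
    ext s; rw [phi1]; ring
  have e2 : (fun s => dipoleKernel z s * psi1 ri re ε ki ke s) = fun s => (tau ki ke + tauE ke) *
      (dipoleKernel z s *
        ((s + alpha ri re ε) / (s - alpha ri re ε)) ^ beta ri re ε ki ke) := by
    ext s; rw [psi1]; ring
  rw [e1, e2]
  exact ⟨⟨h1.1.const_mul _, rfl⟩, h2.1.const_mul _, rfl⟩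

theorem image_right (hri : 0 < ri) (hre : ri < re) (hε : 0 < ε) (hε1 : ε < re - ri) (he : 0 < ke)
    (he1 : ke < 1) (hei : ke < ki) (hz : ri ≤ ‖z - centerI ri re ε‖) :
    (IntegrableOn (fun s => logKernel z s * phi2 ri re ε ki ke s)
        (Icc (alpha ri re ε) (centerI ri re ε)) ∧
      ∫ s in Icc (alpha ri re ε) (centerI ri re ε), logKernel z s * phi2 ri re ε ki ke s =
        (tau ki ke + tauI ki ke) * (Real.log ‖z - centerI ri re ε‖ +
          (imagePotential (alpha ri re ε) (beta ri re ε ki ke)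
            (circleReflection (centerI ri re ε) ri z)).re -
          (imagePotential (alpha ri re ε) (beta ri re ε ki ke) (centerI ri re ε)).re)) ∧
    (IntegrableOn (fun s => dipoleKernel z s * psi2 ri re ε ki ke s)
        (Icc (alpha ri re ε) (centerI ri re ε)) ∧
      ∫ s in Icc (alpha ri re ε) (centerI ri re ε), dipoleKernel z s * psi2 ri re ε ki ke s =
        (tau ki ke + tauI ki ke) * (imagePotential (alpha ri re ε) (beta ri re ε ki ke)
          (circleReflection (centerI ri re ε) ri z)).im) := by
  have hc := nestedCircles hri hre hε hε1
  have hβ := beta_pos hri hre hε he he1 hei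
  have hexp := exp_two_mul_xiI hri hre hε hε1 (beta ri re ε ki ke)
  set R := circleReflection (centerI ri re ε) ri z with hR
  have hRre : 0 ≤ (conj R).re := by
    rw [Complex.conj_re]
    exact (hc.re_refl_pos hz).le
  have hz0 := hc.ne_ci hz
  have hy : (z - centerI ri re ε) * (conj R - centerI ri re ε) =
      ((centerI ri re ε ^ 2 - alpha ri re ε ^ 2 : ℝ) : ℂ) := by
    have hz0' := sub_ne_zero.2 hz0
    have h1 : centerI ri re ε ^ 2 - alpha ri re ε ^ 2 = ri ^ 2 := by linarith [hc.sq_i]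
    rw [h1, hR, circleReflection, map_add, map_div₀, Complex.conj_conj, Complex.conj_ofReal,
      add_sub_cancel_left, map_pow, Complex.conj_ofReal, mul_div_cancel₀ _ hz0']
    push_cast
    rfl
  have h1 := setIntegral_log_right hc.alpha_pos hc.alpha_lt hβ hz0 hRre hy
  have h2 := setIntegral_dipole_right hc.alpha_pos hc.alpha_lt hβ.le hz0 hRre hy
  rw [imagePotential_conj, Complex.conj_re] at h1
  rw [imagePotential_conj, Complex.conj_im, neg_neg] at h2
  rw [← h1.2, ← h2.2, ← integral_const_mul, ← integral_const_mul]
  have e1 : (fun s => logKernel z s * phi2 ri re ε ki ke s) = fun s => (tau ki ke + tauI ki ke) *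
      (logKernel z s * (2 * alpha ri re ε * beta ri re ε ki ke *
        ((centerI ri re ε + alpha ri re ε) / (centerI ri re ε - alpha ri re ε)) ^
          beta ri re ε ki ke *
        ((s - alpha ri re ε) ^ (beta ri re ε ki ke - 1) /
          (s + alpha ri re ε) ^ (beta ri re ε ki ke + 1)))) := by
    ext s; rw [phi2, hexp]; ring
  have e2 : (fun s => dipoleKernel z s * psi2 ri re ε ki ke s) = fun s => (tau ki ke + tauI ki ke) *
      (dipoleKernel z s *
        (((centerI ri re ε + alpha ri re ε) / (centerI ri re ε - alpha ri re ε)) ^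
          beta ri re ε ki ke *
        ((s - alpha ri re ε) / (s + alpha ri re ε)) ^ beta ri re ε ki ke)) := by
    ext s; rw [psi2, hexp]; ring
  rw [e1, e2]
  exact ⟨⟨h1.1.const_mul _, rfl⟩, h2.1.const_mul _, rfl⟩

end Images

/-- `1 - e^(-t) ≤ t`, while the kernel integral is at most `4 L₂ / t`. This allows the coefficient
`1 + τ_e` of the series to be replaced by `τ + τ_e` at bounded cost. -/
theorem one_sub_mul_norm_kernelIntegral_le {α t L₂ : ℝ} {z : ℂ} (hα : 0 < α) (hz : 0 ≤ z.re)
    (ht : 0 < t) (hL₂ : 0 < L₂) :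
    (1 - Real.exp (-t)) * ‖kernelIntegral α (t / L₂) z‖ ≤ 4 * L₂ := by
  have h1 : 1 - Real.exp (-t) ≤ t := by linarith [Real.add_one_le_exp (-t)]
  have hβ : 0 < t / L₂ := by positivity
  have h2 := norm_kernelIntegral_le hα hz hβ.le
  calc _ ≤ t * (4 / (t / L₂ + 1)) := by gcongr
    _ ≤ t * (4 / (t / L₂)) := by gcongr; linarith
    _ = 4 * L₂ := by field_simp

/-- The gradient of the part of the solution with sources across the outer circle differs by a
bounded term from the one of the line charges. -/
theorem exists_norm_dpotA_sub_le {ri re ε₀ : ℝ} {h₁ h₂ : ℂ → ℂ}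
    (hd : ∀ w, HasDerivAt h₁ (h₂ w) w) (hh₂ : Continuous h₂)
    (hri : 0 < ri) (hre : ri < re) (hε₀ : ε₀ < re - ri) :
    ∃ C M : ℝ, 0 ≤ C ∧ 0 ≤ M ∧ ∀ ε ki ke : ℝ, 0 < ε → ε ≤ ε₀ → 0 < ke → ke < 1 → ke < ki →
      ‖h₁ 0‖ ≤ M ∧ ∀ z : ℂ, ‖z - centerE ri re ε‖ ≤ re → ‖h₁ z‖ ≤ M ∧
        ‖dpotA h₁ (alpha ri re ε)
            (multiplier (centerI ri re ε) (centerE ri re ε) (alpha ri re ε)) (tau ki ke) (tauE ke) z -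
          (1 + tauE ke) * ((rStar ri re ^ 2 / (4 * alpha ri re ε) : ℝ) * h₁ 0 *
            kernelIntegral (alpha ri re ε) (beta ri re ε ki ke) z)‖ ≤ C ∧
        ‖(1 - tau ki ke) * ((rStar ri re ^ 2 / (4 * alpha ri re ε) : ℝ) * h₁ 0 *
            kernelIntegral (alpha ri re ε) (beta ri re ε ki ke) z)‖ ≤ C := by
  obtain ⟨M₁, M₂, B, hM₁, hM₂, -, hbd⟩ := exists_norm_dpotA_le hd hh₂ hri hre hε₀
  obtain ⟨A, hA, hmul⟩ := exists_multiplier_bounds hri hre hε₀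
  set A' := 3 * re ^ 2 / (re - ri - ε₀) with hA'
  have hA'0 : 0 ≤ A' := by
    have : 0 < re - ri - ε₀ := by linarith
    positivity
  set C₁ := 8 * M₁ + (M₁ + M₂ * A') * 108 + 108 * M₂ * A + 4 * M₁ * A with hC₁
  have hC₁0 : 0 ≤ C₁ := by positivity
  refine ⟨2 * C₁ + 4 * A * M₁, M₁, by positivity, hM₁, fun ε ki ke hε hε1 he he1 hei => ?_⟩
  have hc := nestedCircles hri hre hε (hε1.trans_lt hε₀)
  have hα := hc.alpha_pos
  have h0 : ‖h₁ 0‖ ≤ M₁ := by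
    refine (hbd ε hε hε1 (centerE ri re ε) (by simpa using hc.re_pos.le)).1 0 ?_
    rw [norm_zero]
    positivity
  refine ⟨h0, fun z hz => ?_⟩
  obtain ⟨b1, b2, b3, -⟩ := hbd ε hε hε1 z hz
  refine ⟨b3, ?_⟩
  set L := -Real.log (multiplier (centerI ri re ε) (centerE ri re ε) (alpha ri re ε)) with hL
  obtain ⟨hL0, hL1, hL2, hL3⟩ := hmul ε hε hε1 L hL
  set t := -Real.log (tau ki ke) with ht
  have ht0 : 0 < t := neg_log_tau_pos he he1 hei
  set c := rStar ri re ^ 2 / (4 * alpha ri re ε) with hcdef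
  have hc0 : 0 ≤ c := by positivity
  -- The leading asymptotics of `L`; with it `β = t / L₂`.
  set L₂ := 4 * √ε / rStar ri re with hL₂
  have hL₂0 : 0 < L₂ := by
    have := rStar_pos hri hre
    have := Real.sqrt_pos.2 hε
    positivity
  have hβ : beta ri re ε ki ke = t / L₂ := by
    rw [beta, hL₂, ← ht]
    have := (rStar_pos hri hre).ne'
    have := (Real.sqrt_pos.2 hε).ne'
    field_simp
  have hexpt : Real.exp (-t) = tau ki ke := by rw [ht, neg_neg, Real.exp_log (tau_pos he he1 hei)]
  have hexpL : Real.exp (-L) = multiplier (centerI ri re ε) (centerE ri re ε) (alpha ri re ε) := by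
    rw [hL, neg_neg, Real.exp_log hc.multiplier_pos]
  have hzre := (hc.re_pos_of_mem_e hz).le
  rw [hβ]
  have hte := abs_lt.1 (abs_tauE_lt_one he)
  constructor
  · have key := orbitTerm_sum_sub_integral_le hα hzre hd b1 b2 hL0 ht0 hL₂0 (c := c)
    rw [hexpt, hexpL] at key
    have hbound : ‖(∑' n : ℕ, (tau ki ke : ℂ) ^ n * orbitTerm h₁ (alpha ri re ε) z
        (multiplier (centerI ri re ε) (centerE ri re ε) (alpha ri re ε) ^ n)) -
        c * h₁ 0 * kernelIntegral (alpha ri re ε) (t / L₂) z‖ ≤ C₁ := by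
      refine key.trans ?_
      have := centerE_add_le hri hre hε₀ hε hε1 hz
      rw [hC₁]
      gcongr
    have h3 : ‖(1 + tauE ke : ℂ)‖ ≤ 2 := by
      rw [← Complex.ofReal_one, ← Complex.ofReal_add, Complex.norm_real,
        Real.norm_of_nonneg (by linarith)]
      linarith
    rw [dpotA, ← mul_sub, norm_mul]
    have h4 : 0 ≤ 4 * A * M₁ := by positivity
    calc _ ≤ 2 * C₁ := by gcongr
      _ ≤ _ := by linarith
  · have h3 : ‖(1 - tau ki ke : ℂ)‖ = 1 - Real.exp (-t) := by
      rw [← Complex.ofReal_one, ← Complex.ofReal_sub, Complex.norm_real, hexpt,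
        Real.norm_of_nonneg (by linarith [(abs_lt.1 (abs_tau_lt_one (he.trans hei) he)).2])]
    rw [norm_mul, norm_mul, norm_mul, h3, Complex.norm_real, Real.norm_of_nonneg hc0]
    have h4 := one_sub_mul_norm_kernelIntegral_le hα hzre ht0 hL₂0
    calc _ = c * ((1 - Real.exp (-t)) * ‖kernelIntegral (alpha ri re ε) (t / L₂) z‖) * ‖h₁ 0‖ := by
          ring
      _ ≤ c * (4 * L₂) * M₁ := by gcongr
      _ = 4 * (c * L₂) * M₁ := by ring
      _ ≤ 4 * A * M₁ := by gcongr
      _ ≤ _ := by linarith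

/-- A real function which is locally the real part of a holomorphic one up to a logarithm. -/
theorem hasGradientAt_re_add_log {f : ℂ → ℂ} {f' c z : ℂ} {k m : ℝ} (hf : HasDerivAt f f' z)
    (hz : z ≠ c) :
    HasGradientAt (fun w => (f w).re + k * Real.log ‖w - c‖ + m) (conj (f' + k * (z - c)⁻¹)) z := by
  have hz' : z - c ≠ 0 := sub_ne_zero.2 hz
  -- Dividing by `z - c` moves the base point to `1`, inside the domain of the principal logarithm.
  have h1 : HasDerivAt (fun w => Complex.log ((w - c) / (z - c))) (z - c)⁻¹ z := by
    have h2 : HasDerivAt (fun w => (w - c) / (z - c)) (1 / (z - c)) z :=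
      ((hasDerivAt_id z).sub_const c).div_const (z - c)
    refine (h2.clog (by rw [div_self hz']; exact Complex.one_mem_slitPlane)).congr_deriv ?_
    rw [div_self hz', div_one, one_div]
  have h3 := ((hf.add (h1.const_mul (k : ℂ))).add_const
    ((k * Real.log ‖z - c‖ + m : ℝ) : ℂ))
  refine (hasGradientAt_re h3).congr_of_eventuallyEq ?_
  filter_upwards [isOpen_ne.mem_nhds hz] with w hw
  have hw' : w - c ≠ 0 := sub_ne_zero.2 hw
  simp only [Pi.add_apply, Complex.add_re, Complex.re_ofReal_mul, Complex.log_re, norm_div,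
    Complex.ofReal_re]
  rw [Real.log_div (norm_ne_zero_iff.2 hw') (norm_ne_zero_iff.2 hz')]
  ring

/-- Approximation of the solution in the shell by the potentials of line charges. -/
theorem exists_image_formula {ri re ε₀ : ℝ} (hri : 0 < ri) (hre : ri < re) {H : ℂ → ℝ}
    (hH : HarmonicOnNhd H univ) (hε₀ : ε₀ < re - ri) :
    ∃ C : ℝ, ∀ ε ki ke : ℝ, 0 < ε → ε ≤ ε₀ → 0 < ke → ke < 1 → ke < ki →
      ∀ (u : ℂ → ℝ) (G : ℂ → ℂ), IsSolution (conductivity ri re ε ki ke) H u G →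
        ∃ r : ℂ → ℝ,
          (∀ᵐ z : ℂ, z ∈ shell ri re ε →
            u z = H z
              + (∇ H 0).re * rStar ri re ^ 2 / 2 *
                ((∫ s in Iic (-alpha ri re ε), logKernel z s * phi1 ri re ε ki ke s)
                  - ∫ s in Icc (alpha ri re ε) (centerI ri re ε),
                      logKernel z s * phi2 ri re ε ki ke s)
              + (∇ H 0).im * rStar ri re ^ 2 / 2 *
                ((∫ s in Iic (-alpha ri re ε), dipoleKernel z s * psi1 ri re ε ki ke s)
                  - ∫ s in Icc (alpha ri re ε) (centerI ri re ε),
                      dipoleKernel z s * psi2 ri re ε ki ke s)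
              + r z) ∧
          ∀ z ∈ shell ri re ε, DifferentiableAt ℝ r z ∧ ‖∇ r z‖ ≤ C := by
  obtain ⟨h, h₁, h₂, hh, hd, hh₂, hHre, hgrad⟩ := exists_entire hH
  obtain ⟨C, M, hC, hM, hbd⟩ := exists_norm_dpotA_sub_le hd hh₂ hri hre hε₀
  refine ⟨C + C + M + C + M * rStar ri re ^ 2 * ri⁻¹, fun ε ki ke hε hε1 he he1 hei u G hu => ?_⟩
  have hε2 := hε1.trans_lt hε₀
  have hi := he.trans hei
  have hc := nestedCircles hri hre hε hε2
  have hα := hc.alpha_pos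
  have hβ := beta_pos hri hre hε he he1 hei
  obtain ⟨h0M, hbdz⟩ := hbd ε ki ke hε hε1 he he1 hei
  have hleft := fun (z : ℂ) (hz : 0 ≤ z.re) => image_left hri hre hε hε2 he he1 hei hz
  have hright := fun (z : ℂ) (hz : ri ≤ ‖z - centerI ri re ε‖) =>
    image_right hri hre hε hε2 he he1 hei hz
  obtain ⟨κ, hκ⟩ := hu.eq_images hri hre hε hε2 hi he hh hHre rfl rfl
  have hti := abs_lt.1 (abs_tauI_lt_one hi he)
  have ht := abs_lt.1 (abs_tau_lt_one hi he)
  have htau : tau ki ke = tauI ki ke * tauE ke := rfl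
  have haD : ∀ z : ℂ, 0 < z.re → HasDerivAt _ _ z := fun z hz =>
    hasDerivAt_potA (τe := tauE ke) hh hα hc.multiplier_pos hc.multiplier_lt_one
      (abs_tau_lt_one hi he) hz
  have hPD : ∀ z : ℂ, 0 < z.re → HasDerivAt _ _ z := fun z hz =>
    hasDerivAt_imagePotential hα hβ.le hz
  set ci := centerI ri re ε
  set ce := centerE ri re ε
  set α := alpha ri re ε
  set β := beta ri re ε ki ke
  set l := multiplier ci ce α
  set τ := tau ki ke
  set τi := tauI ki ke
  set τe := tauE ke
  set ρ := rStar ri re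
  set a := potA h α l τ τe
  set a' := dpotA h₁ α l τ τe
  set P := imagePotential α β
  -- The logarithmic integral over `[α, c_i]` contributes `log ‖z - ci‖`, which is absent from `u`.
  -- It is moved to the remainder, where its gradient is bounded because `‖z - ci‖ > ri`.
  set k : ℝ := (τ + τi) * ((h₁ 0).re * (ρ ^ 2 / 2)) with hk
  set Q : ℂ → ℂ := fun z => ((ρ ^ 2 / 2 : ℝ) : ℂ) * h₁ 0 * P z with hQ
  set Q' : ℂ → ℂ := fun z => ((ρ ^ 2 / (4 * α) : ℝ) : ℂ) * h₁ 0 * kernelIntegral α β z with hQ'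
  have hQD : ∀ z : ℂ, 0 < z.re → HasDerivAt Q (Q' z) z := fun z hz => by
    refine ((hPD z hz).const_mul _).congr_deriv ?_
    have : (α : ℂ) ≠ 0 := Complex.ofReal_ne_zero.2 hα.ne'
    simp only [hQ']
    push_cast
    field_simp
    ring
  set b : ℂ → ℂ := fun z => a z - (1 + τe) * Q z with hb
  set b' : ℂ → ℂ := fun z => a' z - (1 + τe) * Q' z with hb'
  -- In `a = b + (1 + τ_e) Q` the coefficient splits as `(1 - τ) + (τ + τ_e)`, the second part being
  -- the left charges. In the reflected term `τ_i (1 + τ_e) = τ + τ_i` is exactly the coefficient of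
  -- the right charges, so only `b` leaves a reflected remainder.
  set f : ℂ → ℂ := fun z => b z + (1 - τ) * Q z - h z + potB b ci ri τi z with hf
  -- Collects all terms constant in `z`; they may blow up as `ε → 0`, but do not affect the
  -- gradient.
  set m : ℝ := κ - (h₁ 0).re * (ρ ^ 2 / 2) * ((τ + τe) * (Real.log (2 * α) -
    ∫ q in Ioo (0 : ℝ) 1, β * q ^ (β - 1) * Real.log (1 - q)) + (τ + τi) * (P ci).re) with hm
  have hbD : ∀ z : ℂ, 0 < z.re → HasDerivAt b (b' z) z := fun z hz =>
    (haD z hz).sub ((hQD z hz).const_mul _)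
  refine ⟨fun z => (f z).re + k * Real.log ‖z - ci‖ + m, ?_, fun z hz => ?_⟩
  · filter_upwards [hκ] with z ⟨_, hz2, _⟩ hz
    rw [mem_shell_iff hri.ne'] at hz
    have hl := hleft z (hc.re_pos_of_mem_e hz.2.le).le
    have hr := hright z hz.1.le
    rw [(hz2 hz.1 hz.2).1, hHre, hgrad, hl.1.2, hl.2.2, hr.1.2, hr.2.2, Complex.conj_re,
      Complex.conj_im]
    simp only [hf, hb, hQ, hk, hm, potB]
    simp [Complex.mul_re, Complex.mul_im, -Complex.ofReal_pow, -Complex.ofReal_div]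
    rw [htau]
    ring
  · rw [mem_shell_iff hri.ne'] at hz
    have hzre := hc.re_pos_of_mem_e hz.2.le
    have hzi := hc.ne_ci hz.1.le
    have hfD : HasDerivAt f (b' z + (1 - τ) * Q' z - h₁ z + dpotB b' ci ri τi z) z :=
      (((hbD z hzre).add ((hQD z hzre).const_mul _)).sub (hh z)).add
        (hasDerivAt_potB hzi (hbD _ (hc.re_refl_pos hz.1.le)))
    have hg := hasGradientAt_re_add_log (k := k) (m := m) hfD hzi
    refine ⟨hg.differentiableAt, ?_⟩
    rw [hg.gradient, Complex.norm_conj]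
    obtain ⟨n1, n2, n3⟩ := hbdz z hz.2.le
    have n4 : ‖dpotB b' ci ri τi z‖ ≤ C :=
      norm_dpotB_le hri hz.1.le (abs_tauI_lt_one hi he)
        (hbdz _ (hc.mem_e_of_mem_i (norm_circleReflection_sub_le hri hz.1.le)).le).2.1
    have n5 : ‖(k : ℂ) * (z - ci)⁻¹‖ ≤ M * ρ ^ 2 * ri⁻¹ := by
      rw [norm_mul, norm_inv, Complex.norm_real, Real.norm_eq_abs, hk, abs_mul, abs_mul,
        abs_of_nonneg (by positivity : 0 ≤ ρ ^ 2 / 2)]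
      have n6 : |τ + τi| ≤ 2 := by rw [abs_le]; constructor <;> linarith
      have n7 := (Complex.abs_re_le_norm (h₁ 0)).trans h0M
      have n8 : ‖z - ci‖⁻¹ ≤ ri⁻¹ := inv_anti₀ hri hz.1.le
      calc _ ≤ 2 * (M * (ρ ^ 2 / 2)) * ri⁻¹ := by gcongr
        _ = _ := by ring
    refine (norm_add_le _ _).trans (add_le_add ((norm_add_le _ _).trans (add_le_add
      ((norm_sub_le _ _).trans (add_le_add ((norm_add_le _ _).trans (add_le_add ?_ ?_)) n1)) n4)) n5)
    · exact n2
    · exact n3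

end CoreShell

theorem theorem5p2 (ri re : ℝ) (hri : 0 < ri) (hre : ri < re)
    (H : ℂ → ℝ) (hH : HarmonicOnNhd H univ) (ε₀ : ℝ) (hε₀ : ε₀ < re - ri) :
    -- outside the shell the gradient of `u - H` is bounded
    (∃ C : ℝ, ∀ ε ki ke : ℝ, 0 < ε → ε ≤ ε₀ → 0 < ki → 0 < ke → ke ≠ 1 →
      ∀ (u : ℂ → ℝ) (G : ℂ → ℂ), IsSolution (conductivity ri re ε ki ke) H u G →
        ∀ᵐ z : ℂ, z ∉ closure (shell ri re ε) → ‖G z - ∇ H z‖ ≤ C) ∧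
    -- blow-up anywhere requires both `τ_i` and `τ_e` to be close to `1`
    (∀ δ : ℝ, 0 < δ →
      ∃ C : ℝ, ∀ ε ki ke : ℝ, 0 < ε → ε ≤ ε₀ → 0 < ki → 0 < ke → ke ≠ 1 →
      (tauI ki ke ≤ 1 - δ ∨ tauE ke ≤ 1 - δ) →
      ∀ (u : ℂ → ℝ) (G : ℂ → ℂ), IsSolution (conductivity ri re ε ki ke) H u G →
        ∀ᵐ z : ℂ, ‖G z - ∇ H z‖ ≤ C) ∧
    -- image charge formula in the shell
    (∃ C : ℝ, ∀ ε ki ke : ℝ, 0 < ε → ε ≤ ε₀ → 0 < ke → ke < 1 → ke < ki →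
      (∀ z ∈ shell ri re ε,
        IntegrableOn (fun s => logKernel z s * phi1 ri re ε ki ke s) (Iic (-alpha ri re ε)) ∧
        IntegrableOn (fun s => logKernel z s * phi2 ri re ε ki ke s)
          (Icc (alpha ri re ε) (centerI ri re ε)) ∧
        IntegrableOn (fun s => dipoleKernel z s * psi1 ri re ε ki ke s) (Iic (-alpha ri re ε)) ∧
        IntegrableOn (fun s => dipoleKernel z s * psi2 ri re ε ki ke s)
          (Icc (alpha ri re ε) (centerI ri re ε))) ∧
      ∀ (u : ℂ → ℝ) (G : ℂ → ℂ), IsSolution (conductivity ri re ε ki ke) H u G →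
        ∃ r : ℂ → ℝ,
          (∀ᵐ z : ℂ, z ∈ shell ri re ε →
            u z = H z
              + (∇ H 0).re * rStar ri re ^ 2 / 2 *
                ((∫ s in Iic (-alpha ri re ε), logKernel z s * phi1 ri re ε ki ke s)
                  - ∫ s in Icc (alpha ri re ε) (centerI ri re ε),
                      logKernel z s * phi2 ri re ε ki ke s)
              + (∇ H 0).im * rStar ri re ^ 2 / 2 *
                ((∫ s in Iic (-alpha ri re ε), dipoleKernel z s * psi1 ri re ε ki ke s)
                  - ∫ s in Icc (alpha ri re ε) (centerI ri re ε),
                      dipoleKernel z s * psi2 ri re ε ki ke s)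
              + r z) ∧
          ∀ z ∈ shell ri re ε, DifferentiableAt ℝ r z ∧ ‖∇ r z‖ ≤ C) := by
  obtain ⟨C₁, h₁⟩ := exists_bound_outside_shell hri hre hH hε₀
  refine ⟨⟨C₁, fun ε ki ke hε hε1 hi he _ u G hu => ?_⟩, fun δ hδ => ?_, ?_⟩
  · filter_upwards [h₁ ε ki ke hε hε1 hi he u G hu] with z hz hz'
    exact hz fun h => hz' (subset_closure h)
  · obtain ⟨C₂, h₂⟩ := exists_bound_in_shell hri hre hH hε₀ hδ
    refine ⟨max C₁ C₂, fun ε ki ke hε hε1 hi he _ hτ u G hu => ?_⟩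
    filter_upwards [h₁ ε ki ke hε hε1 hi he u G hu, h₂ ε ki ke hε hε1 hi he hτ u G hu] with z hz hz'
    by_cases h : z ∈ shell ri re ε
    · exact (hz' h).trans (le_max_right _ _)
    · exact (hz h).trans (le_max_left _ _)
  · obtain ⟨C₃, h₃⟩ := exists_image_formula hri hre hH hε₀
    refine ⟨C₃, fun ε ki ke hε hε1 he he1 hei => ⟨fun z hz => ?_, h₃ ε ki ke hε hε1 he he1 hei⟩⟩
    have hε2 := hε1.trans_lt hε₀
    rw [mem_shell_iff hri.ne'] at hz
    have hl := image_left hri hre hε hε2 he he1 hei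
      ((nestedCircles hri hre hε hε2).re_pos_of_mem_e hz.2.le).le
    have hr := image_right hri hre hε hε2 he he1 hei hz.1.le
    exact ⟨hl.1.1, hr.1.1, hl.2.1, hr.2.1⟩
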